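/- Let $1\le d\le 3$, let $\Omega\subset\mathbb{R}^d$ be a nonempty bounded connected open set with smooth boundary and outward unit normal $\mathbf n$, and let $a>0$. Write $\overline{w}:=\frac1{|\Omega|}\int_\Omega w\,dx$, $W(r):=\frac a4(r^2-1)^2$, $$F[w]:=\tfrac12\|\nabla w\|_2^2+\int_\Omega W(w)\,dx\quad (w\in H^1(\Omega)),\qquad E[w]:=\tfrac12\int_\Omega\big(-\Delta w+W'(w)\big)^2dx\quad (w\in H^2(\Omega)),$$ and $H^2_N(\Omega):=\{w\in H^2(\Omega):\nabla w\cdot\mathbf n=0\text{ on }\partial\Omega\}$. For $f\in L^2(\Omega)$ with $\overline f=0$, let $\mathcal N(f)\in H^2_N(\Omega)$ be the unique function with $-\Delta\mathcal N(f)=f$ in $\Omega$ and $\overline{\mathcal N(f)}=0$. For $\alpha,\beta\in\mathbb{R}$ set $$\beta_\alpha:=\inf\{F[w]:w\in H^1(\Omega),\ \overline w=\alpha\},\qquad \mathcal M^2_{\alpha,\beta}:=\{w\in H^2_N(\Omega):\overline w=\alpha,\ F[w]=\beta\},$$ $$\mathcal Z_{\alpha,\beta}:=\{w\in\mathcal M^2_{\alpha,\beta}:-\Delta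 w+W'(w)-\overline{W'(w)}=0\text{ a.e. in }\Omega\},\qquad \mathcal O_\alpha:=\{\beta\in(\beta_\alpha,\infty):\mathcal Z_{\alpha,\beta}=\emptyset\}.$$ Let $\alpha\in\mathbb{R}$. Then: (1) The set $\mathcal O_\alpha$ is open, and $\beta\in\mathcal O_\alpha$ for all sufficiently large $\beta$. (2) If $\beta\in\mathcal O_\alpha$ and $M>0$, then (with $\inf\emptyset=+\infty$) $$m_M:=\inf\Big\{\big\|\nabla\mathcal N\big(-\Delta v+W'(v)-\overline{W'(v)}\big)\big\|_2^2:\ v\in\mathcal M^2_{\alpha,\beta},\ E[v]\le M\Big\}>0 .$$ -/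

import Mathlib

open MeasureTheory Set Filter
open scoped ContDiff

noncomputable section

namespace PhaseField

/-- Euclidean space `ℝ^d`. -/
abbrev Euc (d : ℕ) : Type := EuclideanSpace ℝ (Fin d)

/-- `Ω ⊆ ℝ^d` has a smooth boundary: near every boundary point, `Ω` is, in the direction of some
unit vector `e`, the region strictly above the graph of a smooth function `γ` of the variables
orthogonal to `e` (a function on `ℝ^d` that does not depend on the `e`-component). -/
def HasSmoothBoundary {d : ℕ} (Ω : Set (Euc d)) : Prop :=
  ∀ x ∈ frontier Ω, ∃ (e : Euc d) (r : ℝ) (γ : Euc d → ℝ),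
    ‖e‖ = 1 ∧ 0 < r ∧ ContDiff ℝ ∞ γ ∧ (∀ (y : Euc d) (t : ℝ), γ (y + t • e) = γ y) ∧
    Ω ∩ Metric.ball x r = {y : Euc d | γ y < inner ℝ y e} ∩ Metric.ball x r

/-- A bounded connected (in particular nonempty) open set with smooth boundary. -/
structure IsSmoothBoundedDomain {d : ℕ} (Ω : Set (Euc d)) : Prop where
  isOpen : IsOpen Ω
  isConnected : IsConnected Ω
  isBounded : Bornology.IsBounded Ω
  smooth : HasSmoothBoundary Ω

/-- The mean value of `w` over `Ω`. -/
def mean {d : ℕ} (Ω : Set (Euc d)) (w : Euc d → ℝ) : ℝ :=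
  (volume.real Ω)⁻¹ * ∫ x in Ω, w x

/-- `g` is the `i`-th partial derivative of `w` in `Ω` in the sense of distributions:
`∫_Ω w ∂ᵢφ = - ∫_Ω g φ` for all test functions `φ ∈ C_c^∞(Ω)`. -/
def IsWeakDeriv {d : ℕ} (Ω : Set (Euc d)) (i : Fin d) (w g : Euc d → ℝ) : Prop :=
  ∀ φ : Euc d → ℝ, ContDiff ℝ ∞ φ → HasCompactSupport φ → tsupport φ ⊆ Ω →
    ∫ x in Ω, w x * fderiv ℝ φ x (EuclideanSpace.single i 1) = - ∫ x in Ω, g x * φ x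

/-- `g` is an `i`-th weak derivative of `w` in `Ω` and lies in `L²(Ω)`. -/
def IsL2WeakDeriv {d : ℕ} (Ω : Set (Euc d)) (i : Fin d) (w g : Euc d → ℝ) : Prop :=
  MemLp g 2 (volume.restrict Ω) ∧ IsWeakDeriv Ω i w g

/-- The Sobolev space `H¹(Ω)`. Functions are given on `ℝ^d`; only their values almost everywhere
in `Ω` matter. -/
def MemH1 {d : ℕ} (Ω : Set (Euc d)) (w : Euc d → ℝ) : Prop :=
  MemLp w 2 (volume.restrict Ω) ∧ ∀ i, ∃ g, IsL2WeakDeriv Ω i w g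

open Classical in
/-- The `i`-th weak derivative of `w` in `Ω` (unique up to null sets), if it exists in `L²(Ω)`,
and `0` otherwise. -/
def weakDeriv {d : ℕ} (Ω : Set (Euc d)) (i : Fin d) (w : Euc d → ℝ) : Euc d → ℝ :=
  if h : ∃ g, IsL2WeakDeriv Ω i w g then h.choose else 0

/-- The Sobolev space `H²(Ω)`: `w` and all its first weak derivatives are in `H¹(Ω)`. -/
def MemH2 {d : ℕ} (Ω : Set (Euc d)) (w : Euc d → ℝ) : Prop :=
  MemH1 Ω w ∧ ∀ i, MemH1 Ω (weakDeriv Ω i w)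

/-- `∇u · ∇w`. -/
def gradInner {d : ℕ} (Ω : Set (Euc d)) (u w : Euc d → ℝ) (x : Euc d) : ℝ :=
  ∑ i, weakDeriv Ω i u x * weakDeriv Ω i w x

/-- `‖∇w‖₂²`. -/
def gradNormSq {d : ℕ} (Ω : Set (Euc d)) (w : Euc d → ℝ) : ℝ :=
  ∫ x in Ω, gradInner Ω w w x

/-- The Laplacian `Δw`, for `w ∈ H²(Ω)`. -/
def laplacian {d : ℕ} (Ω : Set (Euc d)) (w : Euc d → ℝ) (x : Euc d) : ℝ :=
  ∑ i, weakDeriv Ω i (weakDeriv Ω i w) x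

/-- The space `H²_N(Ω)` of `w ∈ H²(Ω)` with `∇w · n = 0` on `∂Ω`. As usual, the normal trace of
the `L²` vector field `∇w`, whose divergence `Δw` is in `L²(Ω)`, is the functional
`φ ↦ ∫_Ω ∇w · ∇φ + ∫_Ω Δw φ` on `H¹(Ω)` (that is, `∫_∂Ω (∇w · n) φ`, by Green's formula);
the condition says that it vanishes. -/
def MemH2N {d : ℕ} (Ω : Set (Euc d)) (w : Euc d → ℝ) : Prop :=
  MemH2 Ω w ∧ ∀ φ : Euc d → ℝ, MemH1 Ω φ →
    (∫ x in Ω, gradInner Ω w φ x) + ∫ x in Ω, laplacian Ω w x * φ x = 0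

/-- The double-well potential `W(r) = (a/4) (r² - 1)²`. -/
def W (a r : ℝ) : ℝ := a / 4 * (r ^ 2 - 1) ^ 2

/-- `F[w] = ‖∇w‖₂² / 2 + ∫_Ω W(w)`. -/
def F {d : ℕ} (Ω : Set (Euc d)) (a : ℝ) (w : Euc d → ℝ) : ℝ :=
  gradNormSq Ω w / 2 + ∫ x in Ω, W a (w x)

/-- `-Δw + W'(w)`. -/
def chemPot {d : ℕ} (Ω : Set (Euc d)) (a : ℝ) (w : Euc d → ℝ) (x : Euc d) : ℝ :=
  - laplacian Ω w x + deriv (W a) (w x)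

/-- `E[w] = (1/2) ∫_Ω (-Δw + W'(w))²`. -/
def E {d : ℕ} (Ω : Set (Euc d)) (a : ℝ) (w : Euc d → ℝ) : ℝ :=
  1 / 2 * ∫ x in Ω, chemPot Ω a w x ^ 2

/-- `-Δw + W'(w) - mean (W'(w))`. -/
def residual {d : ℕ} (Ω : Set (Euc d)) (a : ℝ) (w : Euc d → ℝ) (x : Euc d) : ℝ :=
  chemPot Ω a w x - mean Ω (fun y => deriv (W a) (w y))

/-- `β_α`, the infimum of `F` over all `w ∈ H¹(Ω)` with mean value `α`. -/
def betaInf {d : ℕ} (Ω : Set (Euc d)) (a α : ℝ) : ℝ :=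
  sInf {t : ℝ | ∃ w : Euc d → ℝ, MemH1 Ω w ∧ mean Ω w = α ∧ F Ω a w = t}

/-- The set `M¹_{α,β}` of `w ∈ H¹(Ω)` with mean value `α` and `F[w] = β`. -/
def M1 {d : ℕ} (Ω : Set (Euc d)) (a α β : ℝ) : Set (Euc d → ℝ) :=
  {w | MemH1 Ω w ∧ mean Ω w = α ∧ F Ω a w = β}

/-- The set `M²_{α,β} = M¹_{α,β} ∩ H²_N(Ω)`. -/
def M2 {d : ℕ} (Ω : Set (Euc d)) (a α β : ℝ) : Set (Euc d → ℝ) :=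
  {w | MemH2N Ω w ∧ w ∈ M1 Ω a α β}

/-- The set `Z_{α,β}` of critical points of `F` in `M²_{α,β}` under the mean value constraint. -/
def Z {d : ℕ} (Ω : Set (Euc d)) (a α β : ℝ) : Set (Euc d → ℝ) :=
  {w | w ∈ M2 Ω a α β ∧ ∀ᵐ x ∂(volume.restrict Ω), residual Ω a w x = 0}

/-- The set `O_α` of all `β > β_α` with `Z_{α,β} = ∅`. -/
def O {d : ℕ} (Ω : Set (Euc d)) (a α : ℝ) : Set ℝ :=
  {β | betaInf Ω a α < β ∧ Z Ω a α β = ∅}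

/-- `u ∈ H²_N(Ω)` solves `-Δu = f` in `Ω`, `∇u · n = 0` on `∂Ω`, and has mean value zero. -/
def IsNeumannSolution {d : ℕ} (Ω : Set (Euc d)) (f u : Euc d → ℝ) : Prop :=
  MemH2N Ω u ∧ (∀ᵐ x ∂(volume.restrict Ω), - laplacian Ω u x = f x) ∧ mean Ω u = 0

open Classical in
/-- `N(f)`, the solution `u ∈ H²_N(Ω)` of mean value zero of `-Δu = f` in `Ω` (it exists and is
unique up to null sets if `f ∈ L²(Ω)` has mean value zero and `Ω` is a smooth bounded domain). -/
def neumannInv {d : ℕ} (Ω : Set (Euc d)) (f : Euc d → ℝ) : Euc d → ℝ :=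
  if h : ∃ u, IsNeumannSolution Ω f u then h.choose else 0

/-- `m_M`, the infimum of `‖∇N(-Δv + W'(v) - mean (W'(v)))‖₂²` over all `v ∈ M²_{α,β}` with
`E[v] ≤ M`, as an extended real number: it is `+∞` if there are no such `v`. -/
def mInf {d : ℕ} (Ω : Set (Euc d)) (a α β M : ℝ) : EReal :=
  sInf {t : EReal | ∃ v ∈ M2 Ω a α β, E Ω a v ≤ M ∧
    t = ((gradNormSq Ω (neumannInv Ω (residual Ω a v)) : ℝ) : EReal)}

end PhaseField

end

/-!
Both parts rest on a Palais-Smale condition for `F` under the constraint of a prescribed mean value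
(`Z_nonempty_of_tendsto`): if `v n` has mean value `α` and energy `β n → b`, and if the pairing of
its residual `-Δv + W'(v) - mean W'(v)` with `φ` is at most `δ n * ‖∇φ‖₂` with `δ n → 0`, then there
is a critical point at the level `b`. Bounded energy bounds the sequence in `H¹`, so Rellich's
theorem gives a subsequence that converges to some `w`, weakly in `H¹` and strongly in `L²`.
Testing the equation of `v n` with `v n - w`, and using that `W` is convex up to a quadratic term
(`deriv_W_sub_mul_ge`), one obtains strong convergence of the gradients and convergence in `L⁴`
(`exists_strong_limit`). Hence `F[w] = b` and `w` is a weak solution of the Euler-Lagrange equation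
with natural boundary condition. As `d ≤ 3`, `H¹ ⊆ L⁶` and `W'(w) ∈ L²`, and regularity for the
Neumann problem shows `w ∈ H²_N`.

The set of levels that carry critical points is therefore closed, so `O_α` is open (`isOpen_O`).
Testing the equation of a critical point `w` with `w - α` bounds its energy (`energy_le_of_mem_Z`),
so large levels are in `O_α`. Finally `‖∇N(f)‖₂` is the norm of `f` in the dual of the functions of
mean value zero (`abs_integral_residual_le`), so a sequence in `M²_{α,β}` along which it tends to
zero for the residuals satisfies the Palais-Smale condition at the level `β`, and `Z_{α,β}` is not
empty (`mInf_pos`). Neither the value of `β_α` nor the bound `E[v] ≤ M` matters for this.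

The analysis that this needs is developed for functions `u` with a weak gradient `g` in `L²`
(`HasWeakGrad`) on open sets that are locally the region above the graph of a function `γ`
(`epigraph`). Such a region has two kinds of volume preserving symmetries, which replace the
flattening of the boundary: the reflection across the graph in the vertical direction, and flows
that translate horizontally and move up and down with the graph. The reflection extends `H¹`
functions to the whole space (`exists_extension`), where mollification gives the Sobolev embedding
(`HasWeakGrad.memLp_six`), Rellich's theorem (`rellich`) and, by compactness, the Poincaré
inequality (`poincare`). The flows give difference quotients that respect the boundary: the weak
Neumann problem, solved by the Riesz representation theorem (`exists_weak_solution`), is tested with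
second differences to bound tangential derivatives of the gradient (`l2_grad_comp_flow_sub_le`), and
the equation determines the remaining second derivative (`testBounded_epigraph`). A partition of
unity leads to `H²` regularity on the whole domain (`memH2N_of_weak`).
-/

noncomputable section

namespace PhaseField

open Topology InnerProductSpace

/-! ### The `L²` norm as a real number -/

section LTwo

variable {α : Type*} [MeasurableSpace α] {μ : Measure α}
  {V : Type*} [NormedAddCommGroup V]

/-- The `L²(μ)` norm of a function, as a real number (`0` if the function is not in `L²(μ)`). -/
def l2 (μ : Measure α) (f : α → V) : ℝ := (eLpNorm f 2 μ).toReal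

theorem l2_nonneg (f : α → V) : 0 ≤ l2 μ f := ENNReal.toReal_nonneg

theorem l2_congr {f g : α → V} (h : f =ᵐ[μ] g) : l2 μ f = l2 μ g := by
  simp only [l2, eLpNorm_congr_ae h]

theorem l2_zero : l2 μ (fun _ => (0 : V)) = 0 := by simp [l2]

theorem l2_add_le {f g : α → V} (hf : MemLp f 2 μ) (hg : MemLp g 2 μ) :
    l2 μ (fun x => f x + g x) ≤ l2 μ f + l2 μ g := by
  rw [l2, l2, l2, ← ENNReal.toReal_add hf.2.ne hg.2.ne]
  exact ENNReal.toReal_mono (ENNReal.add_lt_top.2 ⟨hf.2, hg.2⟩).ne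
    (eLpNorm_add_le hf.1 hg.1 (by norm_num))

theorem l2_sub_le {f g : α → V} (hf : MemLp f 2 μ) (hg : MemLp g 2 μ) :
    l2 μ (fun x => f x - g x) ≤ l2 μ f + l2 μ g := by
  rw [l2, l2, l2, ← ENNReal.toReal_add hf.2.ne hg.2.ne]
  exact ENNReal.toReal_mono (ENNReal.add_lt_top.2 ⟨hf.2, hg.2⟩).ne
    (eLpNorm_sub_le hf.1 hg.1 (by norm_num))

theorem l2_le_of_norm_le {V' : Type*} [NormedAddCommGroup V'] {f : α → V} {g : α → V'} {c : ℝ}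
    (hc : 0 ≤ c) (hg : MemLp g 2 μ) (h : ∀ᵐ x ∂μ, ‖f x‖ ≤ c * ‖g x‖) : l2 μ f ≤ c * l2 μ g := by
  have := eLpNorm_le_mul_eLpNorm_of_ae_le_mul h 2
  have h2 := ENNReal.toReal_mono (ENNReal.mul_lt_top ENNReal.ofReal_lt_top hg.2).ne this
  rwa [ENNReal.toReal_mul, ENNReal.toReal_ofReal hc] at h2

theorem l2_mono {V' : Type*} [NormedAddCommGroup V'] {f : α → V} {g : α → V'}
    (hg : MemLp g 2 μ) (h : ∀ᵐ x ∂μ, ‖f x‖ ≤ ‖g x‖) : l2 μ f ≤ l2 μ g := by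
  have := l2_le_of_norm_le (c := 1) zero_le_one hg (by simpa using h)
  simpa using this

theorem l2_const_smul [NormedSpace ℝ V] (c : ℝ) (f : α → V) :
    l2 μ (fun x => c • f x) = |c| * l2 μ f := by
  have := eLpNorm_const_smul c f 2 μ
  simp only [l2]
  change (eLpNorm (c • f) 2 μ).toReal = _
  rw [this, ENNReal.toReal_mul]; simp

theorem l2_comp_measurePreserving {β : Type*} [MeasurableSpace β] {ν : Measure β} {T : α → β}
    (hT : MeasurePreserving T μ ν) {f : β → V} (hf : MemLp f 2 ν) :
    l2 μ (fun x => f (T x)) = l2 ν f := by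
  have := eLpNorm_comp_measurePreserving (p := 2) hf.1 hT
  simp only [l2]
  exact congrArg _ this

theorem l2_mono_measure {ν : Measure α} (hμν : μ ≤ ν) {f : α → V} (hf : MemLp f 2 ν) :
    l2 μ f ≤ l2 ν f :=
  ENNReal.toReal_mono hf.2.ne (eLpNorm_mono_measure f hμν)

theorem l2_sq {f : α → V} (hf : MemLp f 2 μ) : l2 μ f ^ 2 = ∫ x, ‖f x‖ ^ 2 ∂μ := by
  have h := hf.eLpNorm_eq_integral_rpow_norm (by norm_num) (by norm_num)
  have hn : 0 ≤ ∫ x, ‖f x‖ ^ (2 : ℝ) ∂μ := integral_nonneg fun x => by positivity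
  rw [l2, h, ENNReal.toReal_ofReal (by positivity)]
  simp only [ENNReal.toReal_ofNat, Real.rpow_ofNat] at hn ⊢
  rw [← Real.rpow_natCast, ← Real.rpow_mul hn]; norm_num

theorem l2_le_iff_sq {f : α → V} (hf : MemLp f 2 μ) {c : ℝ} (hc : 0 ≤ c) :
    l2 μ f ≤ c ↔ ∫ x, ‖f x‖ ^ 2 ∂μ ≤ c ^ 2 := by
  rw [← l2_sq hf, sq_le_sq₀ (l2_nonneg f) hc]

theorem integrable_norm_sq {f : α → V} (hf : MemLp f 2 μ) : Integrable (fun x => ‖f x‖ ^ 2) μ := by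
  simpa using hf.integrable_norm_rpow (by norm_num) (by norm_num)

theorem norm_toLp_eq_l2 {f : α → V} (hf : MemLp f 2 μ) : ‖hf.toLp f‖ = l2 μ f :=
  Lp.norm_toLp f hf

section Inner

variable [InnerProductSpace ℝ V]

theorem integrable_inner {f g : α → V} (hf : MemLp f 2 μ) (hg : MemLp g 2 μ) :
    Integrable (fun x => inner ℝ (f x) (g x)) μ := by
  have h := hf.norm.integrable_mul hg.norm
  refine Integrable.mono' h (hf.1.inner hg.1) (Eventually.of_forall fun x => ?_)
  exact norm_inner_le_norm _ _

theorem integrable_mul_of_memLp {f g : α → ℝ} (hf : MemLp f 2 μ) (hg : MemLp g 2 μ) :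
    Integrable (fun x => f x * g x) μ := hf.integrable_mul hg

theorem inner_toLp {f g : α → V} (hf : MemLp f 2 μ) (hg : MemLp g 2 μ) :
    inner ℝ (hf.toLp f) (hg.toLp g) = ∫ x, inner ℝ (f x) (g x) ∂μ := by
  rw [L2.inner_def]
  refine integral_congr_ae ?_
  filter_upwards [hf.coeFn_toLp, hg.coeFn_toLp] with x h1 h2
  rw [h1, h2]

theorem abs_integral_inner_le {f g : α → V} (hf : MemLp f 2 μ) (hg : MemLp g 2 μ) :
    |∫ x, inner ℝ (f x) (g x) ∂μ| ≤ l2 μ f * l2 μ g := by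
  rw [← inner_toLp hf hg, ← norm_toLp_eq_l2 hf, ← norm_toLp_eq_l2 hg]
  exact abs_real_inner_le_norm _ _

theorem abs_integral_mul_le {f g : α → ℝ} (hf : MemLp f 2 μ) (hg : MemLp g 2 μ) :
    |∫ x, f x * g x ∂μ| ≤ l2 μ f * l2 μ g := by
  have := abs_integral_inner_le hg hf
  simpa [mul_comm] using this

theorem l2_sq_inner {f : α → V} (hf : MemLp f 2 μ) :
    l2 μ f ^ 2 = ∫ x, inner ℝ (f x) (f x) ∂μ := by
  rw [l2_sq hf]; simp

end Inner

end LTwo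

/-! ### Duality with test functions -/

/-- Test functions in `D`: smooth functions with compact support contained in `D`. -/
structure IsTest {d : ℕ} (D : Set (Euc d)) (φ : Euc d → ℝ) : Prop where
  contDiff : ContDiff ℝ ∞ φ
  compact : HasCompactSupport φ
  subset : tsupport φ ⊆ D

section Test

variable {d : ℕ} {D : Set (Euc d)} {φ ψ : Euc d → ℝ}

theorem IsTest.continuous (h : IsTest D φ) : Continuous φ := h.contDiff.continuous

theorem IsTest.differentiable (h : IsTest D φ) : Differentiable ℝ φ :=
  h.contDiff.differentiable (by simp)

theorem IsTest.mono {D' : Set (Euc d)} (h : IsTest D φ) (hD : D ⊆ D') : IsTest D' φ :=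
  ⟨h.contDiff, h.compact, h.subset.trans hD⟩

theorem IsTest.memLp (h : IsTest D φ) {μ : Measure (Euc d)} [IsFiniteMeasureOnCompacts μ]
    (p : ENNReal) : MemLp φ p μ :=
  h.continuous.memLp_of_hasCompactSupport h.compact

theorem IsTest.add (h : IsTest D φ) (h' : IsTest D ψ) : IsTest D (fun x => φ x + ψ x) :=
  ⟨h.contDiff.add h'.contDiff, h.compact.add h'.compact,
    (tsupport_add φ ψ).trans (union_subset h.subset h'.subset)⟩

theorem IsTest.mul_left (h : IsTest D φ) {ζ : Euc d → ℝ} (hζ : ContDiff ℝ ∞ ζ) :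
    IsTest D (fun x => ζ x * φ x) :=
  ⟨hζ.mul h.contDiff, h.compact.mul_left, (tsupport_mul_subset_right).trans h.subset⟩

theorem IsTest.const_mul (h : IsTest D φ) (c : ℝ) : IsTest D (fun x => c * φ x) :=
  h.mul_left contDiff_const

theorem IsTest.zero : IsTest D (fun _ : Euc d => (0 : ℝ)) :=
  ⟨contDiff_const, HasCompactSupport.zero, by simp [tsupport]⟩

theorem IsTest.dirDeriv (h : IsTest D φ) (v : Euc d) : IsTest D (fun x => fderiv ℝ φ x v) := by
  refine ⟨(h.contDiff.fderiv_right (m := ∞) (by simp)).clm_apply contDiff_const,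
    h.compact.fderiv_apply ℝ v, ?_⟩
  refine Subset.trans ?_ h.subset
  refine (closure_mono ?_).trans (tsupport_fderiv_subset ℝ (f := φ))
  intro x hx
  simp only [Function.mem_support] at hx ⊢
  intro h0; simp [h0] at hx

theorem locallyIntegrableOn_of_memLp {V : Type*} [NormedAddCommGroup V] {f : Euc d → V}
    (hf : MemLp f 2 (volume.restrict D)) : LocallyIntegrableOn f D volume := by
  intro x _
  refine ⟨Metric.ball x 1 ∩ D,
    inter_mem (mem_nhdsWithin_of_mem_nhds (Metric.ball_mem_nhds x one_pos))
    self_mem_nhdsWithin, ?_⟩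
  have : IsFiniteMeasure (volume.restrict (Metric.ball x 1 ∩ D)) :=
    ⟨by simpa using (measure_mono inter_subset_left).trans_lt measure_ball_lt_top⟩
  exact (hf.mono_measure (Measure.restrict_mono inter_subset_right le_rfl)).integrable (by norm_num)

theorem ae_eq_zero_of_integral_test (hD : IsOpen D) {f : Euc d → ℝ}
    (hf : MemLp f 2 (volume.restrict D)) (h : ∀ φ, IsTest D φ → ∫ x in D, f x * φ x = 0) :
    f =ᵐ[volume.restrict D] 0 := by
  have := hD.ae_eq_zero_of_integral_contDiff_smul_eq_zero (locallyIntegrableOn_of_memLp hf)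
    (fun φ h1 h2 h3 => ?_)
  · exact (ae_restrict_iff' hD.measurableSet).2 this
  · rw [← h φ ⟨h1, h2, h3⟩]
    have hs : Function.support (fun x => φ x • f x) ⊆ D := fun x hx => h3 <| subset_tsupport φ <| by
      simp only [Function.mem_support] at hx ⊢
      intro h0; simp [h0] at hx
    rw [← setIntegral_eq_integral_of_forall_compl_eq_zero (s := D)]
    · simp [mul_comm]
    · intro x hx
      by_contra hne
      exact hx (hs hne)

/-- The test functions in `D` as a subspace of `L²(D)`. -/
def testSubmodule (D : Set (Euc d)) : Submodule ℝ (Lp ℝ 2 (volume.restrict D)) where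
  carrier := {f | ∃ φ, ∃ h : IsTest D φ, f = (h.memLp 2).toLp φ}
  add_mem' := by
    rintro _ _ ⟨φ, h, rfl⟩ ⟨ψ, h', rfl⟩
    exact ⟨_, h.add h', rfl⟩
  zero_mem' := ⟨_, IsTest.zero, rfl⟩
  smul_mem' := by
    rintro c _ ⟨φ, h, rfl⟩
    exact ⟨_, h.const_mul c, rfl⟩

theorem testSubmodule_dense (hD : IsOpen D) : (testSubmodule D).topologicalClosure = ⊤ := by
  rw [Submodule.topologicalClosure_eq_top_iff, Submodule.eq_bot_iff]
  intro f hf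
  rw [Submodule.mem_orthogonal] at hf
  have h0 := ae_eq_zero_of_integral_test hD (Lp.memLp f) (fun φ hφ => ?_)
  · exact Lp.eq_zero_iff_ae_eq_zero.2 h0
  · have := hf _ ⟨φ, hφ, rfl⟩
    have h2 : f = (Lp.memLp f).toLp f := (Lp.toLp_coeFn f (Lp.memLp f)).symm
    rw [h2, inner_toLp] at this
    simpa using this

/-- Test functions are dense in `L²(D)`. -/
theorem exists_test_l2_sub_lt (hD : IsOpen D) {f : Euc d → ℝ}
    (hf : MemLp f 2 (volume.restrict D)) {ε : ℝ} (hε : 0 < ε) :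
    ∃ φ, IsTest D φ ∧ l2 (volume.restrict D) (fun x => f x - φ x) < ε := by
  have : hf.toLp f ∈ (testSubmodule D).topologicalClosure := by
    rw [testSubmodule_dense hD]; trivial
  obtain ⟨_, ⟨φ, hφ, rfl⟩, h⟩ := Metric.mem_closure_iff.1 this ε hε
  refine ⟨φ, hφ, ?_⟩
  rwa [dist_eq_norm, ← MemLp.toLp_sub, norm_toLp_eq_l2] at h

/-- A bound for the pairings with test functions bounds the `L²` norm. -/
theorem l2_le_of_forall_test (hD : IsOpen D) {f : Euc d → ℝ}
    (hf : MemLp f 2 (volume.restrict D)) {C : ℝ} (hC : 0 ≤ C)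
    (h : ∀ φ, IsTest D φ → |∫ x in D, f x * φ x| ≤ C * l2 (volume.restrict D) φ) :
    l2 (volume.restrict D) f ≤ C := by
  set μ := volume.restrict D
  by_contra! hlt
  set ε := (l2 μ f - C) / 4
  have hε : 0 < ε := by simp only [ε]; linarith
  have hpos : 0 < l2 μ f := hC.trans_lt hlt
  -- it suffices to approximate `f` itself with relative precision
  obtain ⟨φ, hφ, hlt2⟩ := exists_test_l2_sub_lt hD hf hε
  have hφm : MemLp φ 2 μ := hφ.memLp 2
  have h1 := h φ hφ
  have h2 := abs_integral_mul_le hf (hf.sub hφm)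
  have h3 : ∫ x, f x * (f - φ) x ∂μ = l2 μ f ^ 2 - ∫ x, f x * φ x ∂μ := by
    rw [l2_sq hf, ← integral_sub (integrable_norm_sq hf) (integrable_mul_of_memLp hf hφm)]
    congr 1; ext x; simp [sq]; ring
  have h4 : l2 μ φ ≤ l2 μ f + ε := by
    have := l2_sub_le hf (hf.sub hφm)
    simp only [Pi.sub_apply, sub_sub_cancel] at this
    exact this.trans (by gcongr; exact hlt2.le)
  rw [h3] at h2
  have h5 : l2 μ f ^ 2 ≤ l2 μ f * ε + C * (l2 μ f + ε) := by
    have := (abs_le.1 h1).2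
    have h6 := (abs_le.1 h2).2
    have h7 : l2 μ f * l2 μ (f - φ) ≤ l2 μ f * ε := by gcongr; exact hlt2.le
    have h8 : C * l2 μ φ ≤ C * (l2 μ f + ε) := by gcongr
    linarith
  have : l2 μ f = C + 4 * ε := by simp only [ε]; ring
  nlinarith

/-- A linear functional on test functions that is bounded in the `L²` norm is represented by an
`L²` function. -/
theorem exists_l2_repr (L : (Euc d → ℝ) → ℝ)
    (hadd : ∀ φ ψ, IsTest D φ → IsTest D ψ → L (fun x => φ x + ψ x) = L φ + L ψ)
    (hsmul : ∀ (c : ℝ) φ, IsTest D φ → L (fun x => c * φ x) = c * L φ) {C : ℝ}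
    (hC : ∀ φ, IsTest D φ → |L φ| ≤ C * l2 (volume.restrict D) φ) :
    ∃ g, MemLp g 2 (volume.restrict D) ∧ ∀ φ, IsTest D φ → L φ = ∫ x in D, g x * φ x := by
  set μ := volume.restrict D
  -- the bound makes `L` well defined on classes of almost everywhere equal functions
  have hcongr : ∀ φ ψ, IsTest D φ → IsTest D ψ → φ =ᵐ[μ] ψ → L φ = L ψ := by
    intro φ ψ hφ hψ h
    have h1 := hC _ (hφ.add (hψ.const_mul (-1)))
    rw [hadd _ _ hφ (hψ.const_mul (-1)), hsmul _ _ hψ] at h1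
    have : l2 μ (fun x => φ x + -1 * ψ x) = 0 := by
      rw [← l2_zero (μ := μ) (V := ℝ)]
      refine l2_congr ?_
      filter_upwards [h] with x hx
      rw [hx]; ring
    rw [this, mul_zero] at h1
    have := abs_nonpos_iff.1 h1
    linarith
  have hrep : ∀ f : testSubmodule D, ∃ φ, IsTest D φ ∧ (f : Lp ℝ 2 μ) =ᵐ[μ] φ := by
    rintro ⟨_, φ, hφ, rfl⟩
    exact ⟨φ, hφ, (hφ.memLp 2).coeFn_toLp⟩
  choose P hP hPeq using hrep
  let ℓ₀ : testSubmodule D →ₗ[ℝ] ℝ :=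
    { toFun := fun f => L (P f)
      map_add' := by
        intro f g
        rw [← hadd _ _ (hP f) (hP g)]
        refine hcongr _ _ (hP _) ((hP f).add (hP g)) ?_
        filter_upwards [hPeq f, hPeq g, hPeq (f + g),
          Lp.coeFn_add (f : Lp ℝ 2 μ) (g : Lp ℝ 2 μ)] with x h1 h2 h3 h4
        rw [← h1, ← h2, ← h3, Submodule.coe_add, h4, Pi.add_apply]
      map_smul' := by
        intro c f
        rw [RingHom.id_apply, smul_eq_mul, ← hsmul _ _ (hP f)]
        refine hcongr _ _ (hP _) ((hP f).const_mul c) ?_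
        filter_upwards [hPeq f, hPeq (c • f), Lp.coeFn_smul c (f : Lp ℝ 2 μ)] with x h1 h2 h3
        rw [← h1, ← h2, Submodule.coe_smul, h3, Pi.smul_apply, smul_eq_mul] }
  have hℓ₀ : ∀ f, ‖ℓ₀ f‖ ≤ C * ‖f‖ := by
    intro f
    have h1 : ‖f‖ = l2 μ (P f) := by
      rw [← l2_congr (hPeq f), l2, ← Lp.norm_def]; rfl
    rw [h1]
    exact hC _ (hP f)
  obtain ⟨ℓ', hℓ', -⟩ := exists_extension_norm_eq (testSubmodule D) (ℓ₀.mkContinuous C hℓ₀)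
  obtain ⟨G, rfl⟩ := (toDual ℝ (Lp ℝ 2 μ)).surjective ℓ'
  refine ⟨G, Lp.memLp G, fun φ hφ => ?_⟩
  have h1 := hℓ' ⟨(hφ.memLp 2).toLp φ, φ, hφ, rfl⟩
  have h2 : P ⟨(hφ.memLp 2).toLp φ, φ, hφ, rfl⟩ =ᵐ[μ] φ :=
    (hPeq _).symm.trans (hφ.memLp 2).coeFn_toLp
  have h3 : L φ = inner ℝ G ((hφ.memLp 2).toLp φ) := by
    rw [← hcongr _ _ (hP _) hφ h2]
    exact h1.symm
  rw [h3, L2.inner_def]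
  refine integral_congr_ae ?_
  filter_upwards [(hφ.memLp (μ := μ) 2).coeFn_toLp] with x hx
  simp [hx, mul_comm]

/-- A bounded sequence in `L²(D)` converges weakly if it does so on test functions. -/
theorem tendsto_integral_of_forall_test (hD : IsOpen D) {f : ℕ → Euc d → ℝ} {C : ℝ}
    (hf : ∀ n, MemLp (f n) 2 (volume.restrict D)) (hC : ∀ n, l2 (volume.restrict D) (f n) ≤ C)
    (h : ∀ φ, IsTest D φ → Tendsto (fun n => ∫ x in D, f n x * φ x) atTop (𝓝 0))
    {p : Euc d → ℝ} (hp : MemLp p 2 (volume.restrict D)) :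
    Tendsto (fun n => ∫ x in D, f n x * p x) atTop (𝓝 0) := by
  set μ := volume.restrict D
  have hC0 : 0 ≤ C := (l2_nonneg _).trans (hC 0)
  rw [Metric.tendsto_atTop]
  intro ε hε
  obtain ⟨φ, hφ, hlt⟩ := exists_test_l2_sub_lt hD hp (show 0 < ε / (2 * (C + 1)) by positivity)
  obtain ⟨N, hN⟩ := Metric.tendsto_atTop.1 (h φ hφ) (ε / 2) (by positivity)
  refine ⟨N, fun n hn => ?_⟩
  have h1 := hN n hn
  rw [Real.dist_0_eq_abs] at h1 ⊢
  have hφm : MemLp φ 2 μ := hφ.memLp 2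
  have h2 := abs_integral_mul_le (hf n) (hp.sub hφm)
  have h3 : ∫ x, f n x * p x ∂μ = ∫ x, f n x * φ x ∂μ + ∫ x, f n x * (p - φ) x ∂μ := by
    rw [← integral_add (integrable_mul_of_memLp (hf n) hφm)
      (integrable_mul_of_memLp (hf n) (hp.sub hφm))]
    congr 1; ext x; simp; ring
  have h4 : l2 μ (f n) * l2 μ (p - φ) ≤ C * (ε / (2 * (C + 1))) :=
    mul_le_mul (hC n) hlt.le (l2_nonneg _) hC0
  have h5 : C * (ε / (2 * (C + 1))) ≤ ε / 2 := by
    rw [mul_div_assoc', div_le_div_iff₀ (by positivity) (by positivity)]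
    nlinarith
  rw [h3]
  calc _ ≤ |∫ x, f n x * φ x ∂μ| + |∫ x, f n x * (p - φ) x ∂μ| := abs_add_le _ _
    _ < ε / 2 + ε / 2 := by linarith
    _ = ε := by ring

end Test

/-- A bounded sequence in `L²(μ)` has a weakly convergent subsequence. -/
theorem exists_weak_subseq {d : ℕ} {μ : Measure (Euc d)} [SFinite μ] {f : ℕ → Euc d → ℝ} {C : ℝ}
    (hf : ∀ n, MemLp (f n) 2 μ) (hC : ∀ n, l2 μ (f n) ≤ C) :
    ∃ (k : ℕ → ℕ) (g : Euc d → ℝ), StrictMono k ∧ MemLp g 2 μ ∧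
      ∀ p, MemLp p 2 μ →
        Tendsto (fun n => ∫ x, f (k n) x * p x ∂μ) atTop (𝓝 (∫ x, g x * p x ∂μ)) := by
  have : Fact ((1 : ENNReal) ≤ 2) := ⟨by norm_num⟩
  have : Fact ((2 : ENNReal) ≠ ⊤) := ⟨by norm_num⟩
  let ℓ : ℕ → WeakDual ℝ (Lp ℝ 2 μ) := fun n =>
    StrongDual.toWeakDual (toDual ℝ (Lp ℝ 2 μ) ((hf n).toLp (f n)))
  have hmem : ∀ n, ℓ n ∈
      (WeakDual.toStrongDual ⁻¹' Metric.closedBall (0 : StrongDual ℝ (Lp ℝ 2 μ)) C) := by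
    intro n
    simp only [mem_preimage, Metric.mem_closedBall, dist_zero_right]
    change ‖toDual ℝ (Lp ℝ 2 μ) ((hf n).toLp (f n))‖ ≤ C
    rw [LinearIsometryEquiv.norm_map, norm_toLp_eq_l2]
    exact hC n
  obtain ⟨ℓ', -, k, hk, hlim⟩ := WeakDual.isSeqCompact_closedBall ℝ (Lp ℝ 2 μ) 0 C hmem
  set G := (toDual ℝ (Lp ℝ 2 μ)).symm (WeakDual.toStrongDual ℓ') with hG
  refine ⟨k, G, hk, Lp.memLp G, fun p hp => ?_⟩
  have h1 := (WeakDual.eval_continuous (𝕜 := ℝ) (hp.toLp p)).continuousAt.tendsto.comp hlim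
  have h2 : ℓ' (hp.toLp p) = ∫ x, G x * p x ∂μ := by
    have : ℓ' (hp.toLp p) = inner ℝ G (hp.toLp p) := by
      rw [hG, toDual_symm_apply]; rfl
    have h3 : G = (Lp.memLp G).toLp G := (Lp.toLp_coeFn G (Lp.memLp G)).symm
    rw [this, h3, inner_toLp, ← h3]
    simp [mul_comm]
  rw [← h2]
  refine h1.congr fun n => ?_
  change inner ℝ ((hf (k n)).toLp (f (k n))) (hp.toLp p) = _
  rw [inner_toLp]
  simp [mul_comm]

/-! ### Weak gradients -/

/-- `u ∈ H¹(D)` with weak gradient `g`, written as a vector field: both are in `L²(D)`, and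
`∫_D u ∂_v φ = - ∫_D (g · v) φ` for every test function `φ` and every direction `v`. -/
structure HasWeakGrad {d : ℕ} (D : Set (Euc d)) (u : Euc d → ℝ) (g : Euc d → Euc d) : Prop where
  memLp : MemLp u 2 (volume.restrict D)
  memLp_grad : MemLp g 2 (volume.restrict D)
  integral_eq : ∀ φ, IsTest D φ → ∀ v : Euc d,
    ∫ x in D, u x * fderiv ℝ φ x v = - ∫ x in D, inner ℝ (g x) v * φ x

section

variable {d : ℕ} {D : Set (Euc d)} {u w φ : Euc d → ℝ} {g p : Euc d → Euc d}

theorem memLp_inner_const {f : Euc d → Euc d} {μ : Measure (Euc d)} (hf : MemLp f 2 μ)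
    (v : Euc d) : MemLp (fun x => inner ℝ (f x) v) 2 μ := hf.inner_const v

theorem HasWeakGrad.unique (hD : IsOpen D) (h : HasWeakGrad D u g) (h' : HasWeakGrad D u p) :
    g =ᵐ[volume.restrict D] p := by
  have key : ∀ i : Fin d, (fun x => inner ℝ (g x) (EuclideanSpace.single i (1 : ℝ)) -
      inner ℝ (p x) (EuclideanSpace.single i (1 : ℝ))) =ᵐ[volume.restrict D] 0 := by
    intro i
    have h1 := memLp_inner_const h.memLp_grad (EuclideanSpace.single i (1 : ℝ))
    have h2 := memLp_inner_const h'.memLp_grad (EuclideanSpace.single i (1 : ℝ))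
    refine ae_eq_zero_of_integral_test hD (h1.sub h2) fun φ hφ => ?_
    have e1 := h.integral_eq φ hφ (EuclideanSpace.single i (1 : ℝ))
    have e2 := h'.integral_eq φ hφ (EuclideanSpace.single i (1 : ℝ))
    simp only [sub_mul]
    rw [integral_sub (integrable_mul_of_memLp h1 (hφ.memLp 2))
      (integrable_mul_of_memLp h2 (hφ.memLp 2))]
    linarith
  filter_upwards [ae_all_iff.2 key] with x hx
  ext i
  have := hx i
  simp only [EuclideanSpace.inner_single_right, Pi.zero_apply] at this
  simpa [sub_eq_zero] using this

theorem HasWeakGrad.congr_grad (h : HasWeakGrad D u g) (hg : g =ᵐ[volume.restrict D] p) :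
    HasWeakGrad D u p := by
  refine ⟨h.memLp, h.memLp_grad.ae_eq hg, fun φ hφ v => ?_⟩
  rw [h.integral_eq φ hφ v]
  congr 1
  refine integral_congr_ae ?_
  filter_upwards [hg] with x hx
  rw [hx]

theorem HasWeakGrad.congr (h : HasWeakGrad D u g) (hu : u =ᵐ[volume.restrict D] w) :
    HasWeakGrad D w g := by
  refine ⟨h.memLp.ae_eq hu, h.memLp_grad, fun φ hφ v => ?_⟩
  rw [← h.integral_eq φ hφ v]
  refine integral_congr_ae ?_
  filter_upwards [hu] with x hx
  rw [hx]

theorem HasWeakGrad.add (h : HasWeakGrad D u g) (h' : HasWeakGrad D w p) :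
    HasWeakGrad D (fun x => u x + w x) (fun x => g x + p x) := by
  refine ⟨h.memLp.add h'.memLp, h.memLp_grad.add h'.memLp_grad, fun φ hφ v => ?_⟩
  simp only [add_mul, inner_add_left]
  rw [integral_add (integrable_mul_of_memLp h.memLp ((hφ.dirDeriv v).memLp 2))
    (integrable_mul_of_memLp h'.memLp ((hφ.dirDeriv v).memLp 2)),
    integral_add (integrable_mul_of_memLp (memLp_inner_const h.memLp_grad v) (hφ.memLp 2))
    (integrable_mul_of_memLp (memLp_inner_const h'.memLp_grad v) (hφ.memLp 2)),
    h.integral_eq φ hφ v, h'.integral_eq φ hφ v]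
  ring

theorem HasWeakGrad.const_mul (h : HasWeakGrad D u g) (c : ℝ) :
    HasWeakGrad D (fun x => c * u x) (fun x => c • g x) := by
  refine ⟨h.memLp.const_mul c, h.memLp_grad.const_smul c, fun φ hφ v => ?_⟩
  simp only [mul_assoc, inner_smul_left, RCLike.conj_to_real]
  rw [integral_const_mul, integral_const_mul, h.integral_eq φ hφ v]
  ring

theorem HasWeakGrad.sub (h : HasWeakGrad D u g) (h' : HasWeakGrad D w p) :
    HasWeakGrad D (fun x => u x - w x) (fun x => g x - p x) := by
  have := h.add (h'.const_mul (-1))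
  simpa [sub_eq_add_neg] using this

/-- The integral of a directional derivative of a test function vanishes. -/
theorem IsTest.integral_fderiv_eq_zero (hφ : IsTest D φ) (v : Euc d) :
    ∫ x in D, fderiv ℝ φ x v = 0 := by
  rw [setIntegral_eq_integral_of_forall_compl_eq_zero]
  · have := integral_mul_fderiv_eq_neg_fderiv_mul_of_integrable (μ := (volume : Measure (Euc d)))
      (f := fun _ => (1 : ℝ)) (g := φ) (v := v)
      (by simp)
      (by simpa using
        (hφ.dirDeriv v).continuous.integrable_of_hasCompactSupport (hφ.dirDeriv v).compact)
      (by simpa using hφ.continuous.integrable_of_hasCompactSupport hφ.compact)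
      (by intro x; fun_prop) (by intro x _; exact hφ.differentiable x)
    simpa using this
  · intro x hx
    exact image_eq_zero_of_notMem_tsupport (f := fun x => fderiv ℝ φ x v)
      fun hx' => hx ((hφ.dirDeriv v).subset hx')

theorem hasWeakGrad_const (hvol : volume D ≠ ⊤) (c : ℝ) :
    HasWeakGrad D (fun _ => c) (fun _ => 0) := by
  have : IsFiniteMeasure (volume.restrict D) := ⟨by simpa using hvol.lt_top⟩
  refine ⟨memLp_const c, MemLp.zero, fun φ hφ v => ?_⟩
  rw [integral_const_mul, hφ.integral_fderiv_eq_zero v]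
  simp

theorem memLp_smul_of_bound {V : Type*} [NormedAddCommGroup V] [NormedSpace ℝ V]
    {μ : Measure (Euc d)} {ζ : Euc d → ℝ} (hζ : Continuous ζ) {C : ℝ} (hC : ∀ x, |ζ x| ≤ C)
    {f : Euc d → V} (hf : MemLp f 2 μ) : MemLp (fun x => ζ x • f x) 2 μ := by
  refine MemLp.of_le_mul (c := C) hf (hζ.aestronglyMeasurable.smul hf.1)
    (Eventually.of_forall fun x => ?_)
  rw [norm_smul, Real.norm_eq_abs]
  gcongr
  exact hC x

theorem memLp_mul_of_bound {μ : Measure (Euc d)} {ζ : Euc d → ℝ} (hζ : Continuous ζ) {C : ℝ}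
    (hC : ∀ x, |ζ x| ≤ C) {f : Euc d → ℝ} (hf : MemLp f 2 μ) :
    MemLp (fun x => ζ x * f x) 2 μ :=
  memLp_smul_of_bound hζ hC hf

theorem IsTest.exists_bound (hφ : IsTest D φ) : ∃ C, 0 ≤ C ∧ ∀ x, |φ x| ≤ C := by
  obtain ⟨C, hC⟩ := hφ.continuous.bounded_above_of_compact_support hφ.compact
  exact ⟨C, (norm_nonneg _).trans (hC 0), hC⟩

theorem IsTest.contDiff_gradient (hφ : IsTest D φ) : ContDiff ℝ ∞ (gradient φ) := by
  have := hφ.contDiff.fderiv_right (m := ∞) (by simp)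
  exact (toDual ℝ (Euc d)).symm.contDiff.comp this

theorem inner_gradient {f : Euc d → ℝ} (x v : Euc d) :
    inner ℝ (gradient f x) v = fderiv ℝ f x v := by
  rw [gradient, toDual_symm_apply]

theorem norm_gradient {f : Euc d → ℝ} (x : Euc d) : ‖gradient f x‖ = ‖fderiv ℝ f x‖ := by
  rw [gradient, LinearIsometryEquiv.norm_map]

theorem IsTest.hasCompactSupport_gradient (hφ : IsTest D φ) : HasCompactSupport (gradient φ) :=
  (hφ.compact.fderiv ℝ).comp_left (g := (toDual ℝ (Euc d)).symm) (by simp)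

theorem IsTest.exists_gradient_bound (hφ : IsTest D φ) : ∃ C, 0 ≤ C ∧ ∀ x, ‖gradient φ x‖ ≤ C := by
  obtain ⟨C, hC⟩ := hφ.contDiff_gradient.continuous.bounded_above_of_compact_support
    hφ.hasCompactSupport_gradient
  exact ⟨C, (norm_nonneg _).trans (hC 0), hC⟩

theorem memLp_smul_gradient {D' : Set (Euc d)} {μ : Measure (Euc d)} {ζ : Euc d → ℝ}
    (hζ : IsTest D' ζ) (hu : MemLp u 2 μ) : MemLp (fun x => u x • gradient ζ x) 2 μ := by
  obtain ⟨C, hC0, hC⟩ := hζ.exists_gradient_bound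
  refine MemLp.of_le_mul (c := C) hu
    (hu.1.smul hζ.contDiff_gradient.continuous.aestronglyMeasurable)
    (Eventually.of_forall fun x => ?_)
  rw [norm_smul, mul_comm]
  gcongr
  exact hC x

theorem IsTest.memLp_mul {D' : Set (Euc d)} {μ : Measure (Euc d)} {ζ : Euc d → ℝ}
    (hζ : IsTest D' ζ) (hu : MemLp u 2 μ) : MemLp (fun x => ζ x * u x) 2 μ := by
  obtain ⟨C, hC0, hC⟩ := hζ.exists_bound
  exact memLp_mul_of_bound hζ.continuous hC hu

theorem IsTest.memLp_smul {D' : Set (Euc d)} {μ : Measure (Euc d)} {ζ : Euc d → ℝ}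
    (hζ : IsTest D' ζ) (hg : MemLp g 2 μ) : MemLp (fun x => ζ x • g x) 2 μ := by
  obtain ⟨C, hC0, hC⟩ := hζ.exists_bound
  exact memLp_smul_of_bound hζ.continuous hC hg

/-- The Leibniz rule, also used to pass between two domains `D` and `D'` that agree near the
support of the smooth factor. -/
theorem HasWeakGrad.mul_test {D' B : Set (Euc d)} (hBm : MeasurableSet B)
    (hD : D ∩ B = D' ∩ B) {ζ : Euc d → ℝ} (hζ : IsTest B ζ)
    (h : HasWeakGrad D u g) :
    HasWeakGrad D' (fun x => ζ x * u x) (fun x => ζ x • g x + u x • gradient ζ x) := by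
  -- integrals of functions vanishing outside `B`
  have key : ∀ f : Euc d → ℝ, (∀ x ∉ B, f x = 0) → ∫ x in D', f x = ∫ x in D, f x := by
    intro f hf
    have h1 : ∀ S : Set (Euc d), ∫ x in S, f x = ∫ x in S ∩ B, f x := by
      intro S
      have : f = B.indicator f := by
        ext x
        by_cases hx : x ∈ B <;> simp [hx, hf]
      rw [this, setIntegral_indicator hBm, setIntegral_indicator hBm]
      rw [inter_assoc, inter_self]
    rw [h1, h1 D, hD]
  have hmem : ∀ {V : Type} [NormedAddCommGroup V] (f : Euc d → V), (∀ x ∉ B, f x = 0) →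
      MemLp f 2 (volume.restrict D) → MemLp f 2 (volume.restrict D') := by
    intro V _ f hf hm
    have : f = B.indicator f := by
      ext x
      by_cases hx : x ∈ B <;> simp [hx, hf]
    rw [this, memLp_indicator_iff_restrict hBm, Measure.restrict_restrict hBm, inter_comm, ← hD,
      inter_comm, ← Measure.restrict_restrict hBm, ← memLp_indicator_iff_restrict hBm, ← this]
    exact hm
  have hζ0 : ∀ x ∉ B, ζ x = 0 := fun x hx =>
    image_eq_zero_of_notMem_tsupport fun hx' => hx (hζ.subset hx')
  have hζ1 : ∀ x ∉ B, gradient ζ x = 0 := by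
    intro x hx
    have : x ∉ tsupport ζ := fun hx' => hx (hζ.subset hx')
    have h2 : fderiv ℝ ζ x = 0 := by
      have := fun hx' => this (tsupport_fderiv_subset ℝ (f := ζ) hx')
      exact image_eq_zero_of_notMem_tsupport this
    simp [gradient, h2]
  have hm1 := hζ.memLp_mul h.memLp
  have hm2 := (hζ.memLp_smul h.memLp_grad).add (memLp_smul_gradient hζ h.memLp)
  refine ⟨hmem _ (fun x hx => by simp [hζ0 x hx]) hm1,
    hmem _ (fun x hx => by simp [hζ0 x hx, hζ1 x hx]) hm2, fun φ hφ v => ?_⟩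
  rw [key _ (fun x hx => by simp [hζ0 x hx]), key _ (fun x hx => by simp [hζ0 x hx, hζ1 x hx])]
  -- `ζ φ` is a test function in `D`
  have hT : IsTest D (fun x => ζ x * φ x) := by
    refine ⟨hζ.contDiff.mul hφ.contDiff, hφ.compact.mul_left, ?_⟩
    intro x hx
    have h1 : x ∈ B := hζ.subset (tsupport_mul_subset_left hx)
    have h2 : x ∈ D' := hφ.subset (tsupport_mul_subset_right hx)
    exact (hD.symm.subset ⟨h2, h1⟩).1
  have e := h.integral_eq _ hT v
  have hfd : ∀ x, fderiv ℝ (fun x => ζ x * φ x) x v =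
      ζ x * fderiv ℝ φ x v + φ x * inner ℝ (gradient ζ x) v := by
    intro x
    rw [fderiv_fun_mul (hζ.differentiable x) (hφ.differentiable x), inner_gradient]
    simp
  simp only [hfd] at e
  have i1 : Integrable (fun x => ζ x * u x * fderiv ℝ φ x v) (volume.restrict D) :=
    integrable_mul_of_memLp hm1 ((hφ.dirDeriv v).memLp 2)
  have i2 : Integrable (fun x => inner ℝ (u x • gradient ζ x) v * φ x) (volume.restrict D) :=
    integrable_mul_of_memLp (memLp_inner_const (memLp_smul_gradient hζ h.memLp) v) (hφ.memLp 2)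
  have i3 : Integrable (fun x => inner ℝ (ζ x • g x) v * φ x) (volume.restrict D) :=
    integrable_mul_of_memLp (memLp_inner_const (hζ.memLp_smul h.memLp_grad) v) (hφ.memLp 2)
  have e1 : ∫ x in D, u x * (ζ x * fderiv ℝ φ x v + φ x * inner ℝ (gradient ζ x) v) =
      (∫ x in D, ζ x * u x * fderiv ℝ φ x v) + ∫ x in D, inner ℝ (u x • gradient ζ x) v * φ x := by
    rw [← integral_add i1 i2]
    congr 1; ext x; simp only [inner_smul_left, RCLike.conj_to_real]; ring
  have e2 : ∫ x in D, inner ℝ (g x) v * (ζ x * φ x) = ∫ x in D, inner ℝ (ζ x • g x) v * φ x := by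
    congr 1; ext x; simp only [inner_smul_left, RCLike.conj_to_real]; ring
  rw [e1, e2] at e
  simp only [inner_add_left, add_mul]
  rw [integral_add i3 i2]
  linarith

theorem HasWeakGrad.mul_test' {B : Set (Euc d)} {ζ : Euc d → ℝ} (hζ : IsTest B ζ)
    (h : HasWeakGrad D u g) :
    HasWeakGrad D (fun x => ζ x * u x) (fun x => ζ x • g x + u x • gradient ζ x) :=
  h.mul_test MeasurableSet.univ rfl (hζ.mono (subset_univ B))

/-- A directional weak derivative exists as soon as the pairing with derivatives of test functions
is bounded in the `L²` norm. -/
theorem exists_directional_deriv (hu : MemLp u 2 (volume.restrict D)) (v : Euc d) {C : ℝ}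
    (hC : ∀ φ, IsTest D φ → |∫ x in D, u x * fderiv ℝ φ x v| ≤ C * l2 (volume.restrict D) φ) :
    ∃ f, MemLp f 2 (volume.restrict D) ∧
      ∀ φ, IsTest D φ → ∫ x in D, u x * fderiv ℝ φ x v = - ∫ x in D, f x * φ x := by
  obtain ⟨f, hf, h⟩ := exists_l2_repr (D := D) (fun φ => ∫ x in D, u x * fderiv ℝ φ x v)
    (fun φ ψ hφ hψ => by
      rw [← integral_add (integrable_mul_of_memLp hu ((hφ.dirDeriv v).memLp 2))
        (integrable_mul_of_memLp hu ((hψ.dirDeriv v).memLp 2))]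
      congr 1; ext x
      rw [fderiv_fun_add (hφ.differentiable x) (hψ.differentiable x)]
      simp [mul_add])
    (fun c φ hφ => by
      rw [← integral_const_mul]
      congr 1; ext x
      rw [fderiv_const_mul (hφ.differentiable x)]
      simp; ring) hC
  refine ⟨fun x => - f x, hf.neg, fun φ hφ => ?_⟩
  rw [h φ hφ, ← integral_neg]
  congr 1; ext x; ring

/-- A family of partial derivatives gives a weak gradient. -/
theorem hasWeakGrad_of_partial (hu : MemLp u 2 (volume.restrict D)) {f : Fin d → Euc d → ℝ}
    (hf : ∀ i, MemLp (f i) 2 (volume.restrict D))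
    (h : ∀ i φ, IsTest D φ → ∫ x in D, u x * fderiv ℝ φ x (EuclideanSpace.single i 1) =
      - ∫ x in D, f i x * φ x) :
    HasWeakGrad D u (fun x => WithLp.toLp 2 fun i => f i x) := by
  refine ⟨hu, MemLp.of_eval_piLp hf, fun φ hφ v => ?_⟩
  have hv : v = ∑ i, v i • EuclideanSpace.single i (1 : ℝ) := by
    have := (EuclideanSpace.basisFun (Fin d) ℝ).sum_repr v
    simpa using this.symm
  have h1 : ∀ x, u x * fderiv ℝ φ x v =
      ∑ i, v i * (u x * fderiv ℝ φ x (EuclideanSpace.single i 1)) := by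
    intro x
    conv_lhs => rw [hv, map_sum, Finset.mul_sum]
    refine Finset.sum_congr rfl fun i _ => ?_
    rw [map_smul, smul_eq_mul]; ring
  have h2 : ∀ x, inner ℝ (WithLp.toLp 2 fun i => f i x : Euc d) v * φ x =
      ∑ i, v i * (f i x * φ x) := by
    intro x
    rw [PiLp.inner_apply, Finset.sum_mul]
    refine Finset.sum_congr rfl fun i _ => ?_
    simp; ring
  simp only [h1, h2]
  rw [integral_finsetSum _ fun i _ => (integrable_mul_of_memLp hu
      ((hφ.dirDeriv _).memLp 2)).const_mul (v i),
    integral_finsetSum _ fun i _ => (integrable_mul_of_memLp (hf i) (hφ.memLp 2)).const_mul (v i),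
    ← Finset.sum_neg_distrib]
  refine Finset.sum_congr rfl fun i _ => ?_
  rw [integral_const_mul, integral_const_mul, h i φ hφ]
  ring

theorem exists_hasWeakGrad (hu : MemLp u 2 (volume.restrict D)) {C : ℝ}
    (hC : ∀ (i : Fin d) φ, IsTest D φ →
      |∫ x in D, u x * fderiv ℝ φ x (EuclideanSpace.single i 1)| ≤ C * l2 (volume.restrict D) φ) :
    ∃ g, HasWeakGrad D u g := by
  choose f hf h using fun i => exists_directional_deriv hu (EuclideanSpace.single i 1) (hC i)
  exact ⟨_, hasWeakGrad_of_partial hu hf h⟩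

/-- Weak limits of functions with bounded weak gradients have a weak gradient. -/
theorem hasWeakGrad_of_weak_limit {w : ℕ → Euc d → ℝ} {q : ℕ → Euc d → Euc d} {C : ℝ}
    (hw : ∀ n, HasWeakGrad D (w n) (q n)) (hC : ∀ n, l2 (volume.restrict D) (q n) ≤ C)
    (hu : MemLp u 2 (volume.restrict D))
    (hlim : ∀ φ, IsTest D φ → Tendsto (fun n => ∫ x in D, w n x * φ x) atTop
      (𝓝 (∫ x in D, u x * φ x))) :
    ∃ g, HasWeakGrad D u g := by
  refine exists_hasWeakGrad hu (C := C) fun i φ hφ => ?_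
  set v : Euc d := EuclideanSpace.single i 1
  refine le_of_tendsto (hlim _ (hφ.dirDeriv v)).abs (Eventually.of_forall fun n => ?_)
  rw [(hw n).integral_eq φ hφ v, abs_neg]
  refine (abs_integral_mul_le (memLp_inner_const (hw n).memLp_grad v) (hφ.memLp 2)).trans ?_
  gcongr
  · exact l2_nonneg _
  refine le_trans ?_ (hC n)
  refine l2_mono (hw n).memLp_grad (Eventually.of_forall fun x => ?_)
  refine (norm_inner_le_norm _ _).trans ?_
  simp [v]

theorem hasWeakGrad_of_limit {w : ℕ → Euc d → ℝ} {q : ℕ → Euc d → Euc d}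
    (hw : ∀ n, HasWeakGrad D (w n) (q n))
    (hu : MemLp u 2 (volume.restrict D)) (hg : MemLp g 2 (volume.restrict D))
    (hlim : Tendsto (fun n => l2 (volume.restrict D) (fun x => w n x - u x)) atTop (𝓝 0))
    (hlim' : Tendsto (fun n => l2 (volume.restrict D) (fun x => q n x - g x)) atTop (𝓝 0)) :
    HasWeakGrad D u g := by
  refine ⟨hu, hg, fun φ hφ v => ?_⟩
  have key : ∀ (a : ℕ → Euc d → ℝ) (b ψ : Euc d → ℝ), (∀ n, MemLp (a n) 2 (volume.restrict D)) →
      MemLp b 2 (volume.restrict D) → IsTest D ψ →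
      Tendsto (fun n => l2 (volume.restrict D) (fun x => a n x - b x)) atTop (𝓝 0) →
      Tendsto (fun n => ∫ x in D, a n x * ψ x) atTop (𝓝 (∫ x in D, b x * ψ x)) := by
    intro a b ψ ha hb hψ hab
    rw [tendsto_iff_dist_tendsto_zero]
    refine squeeze_zero (fun _ => dist_nonneg) (fun n => ?_)
      (by simpa using hab.mul_const (l2 (volume.restrict D) ψ))
    rw [Real.dist_eq, ← integral_sub (integrable_mul_of_memLp (ha n) (hψ.memLp 2))
      (integrable_mul_of_memLp hb (hψ.memLp 2))]
    simp only [← sub_mul]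
    exact abs_integral_mul_le ((ha n).sub hb) (hψ.memLp 2)
  have h1 := key w u _ (fun n => (hw n).memLp) hu (hφ.dirDeriv v) hlim
  have h2 := key (fun n x => inner ℝ (q n x) v) (fun x => inner ℝ (g x) v) φ
    (fun n => memLp_inner_const (hw n).memLp_grad v) (memLp_inner_const hg v) hφ (by
      refine squeeze_zero (fun _ => l2_nonneg _) (fun n => ?_)
        (by simpa using hlim'.const_mul ‖v‖)
      refine l2_le_of_norm_le (norm_nonneg v) ((hw n).memLp_grad.sub hg)
        (Eventually.of_forall fun x => ?_)
      rw [← inner_sub_left, mul_comm]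
      exact norm_inner_le_norm _ _)
  refine tendsto_nhds_unique h1 ?_
  refine h2.neg.congr fun n => ?_
  rw [(hw n).integral_eq φ hφ v]

end

/-! ### The Sobolev spaces of the statement in terms of weak gradients -/

section

variable {d : ℕ} {Ω : Set (Euc d)} {u w : Euc d → ℝ} {g p : Euc d → Euc d}

theorem HasWeakGrad.isL2WeakDeriv (h : HasWeakGrad Ω u g) (i : Fin d) :
    IsL2WeakDeriv Ω i u (fun x => g x i) := by
  refine ⟨?_, fun φ h1 h2 h3 => ?_⟩
  · simpa [EuclideanSpace.inner_single_right] using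
      memLp_inner_const h.memLp_grad (EuclideanSpace.single i (1 : ℝ))
  · have := h.integral_eq φ ⟨h1, h2, h3⟩ (EuclideanSpace.single i 1)
    simpa [EuclideanSpace.inner_single_right] using this

theorem memH1_iff : MemH1 Ω u ↔ ∃ g, HasWeakGrad Ω u g := by
  constructor
  · rintro ⟨h, h'⟩
    choose f hf using h'
    exact ⟨_, hasWeakGrad_of_partial h (fun i => (hf i).1)
      fun i φ hφ => (hf i).2 φ hφ.contDiff hφ.compact hφ.subset⟩
  · rintro ⟨g, h⟩
    exact ⟨h.memLp, fun i => ⟨_, h.isL2WeakDeriv i⟩⟩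

theorem HasWeakGrad.memH1 (h : HasWeakGrad Ω u g) : MemH1 Ω u := memH1_iff.2 ⟨g, h⟩

theorem isL2WeakDeriv_weakDeriv (h : MemH1 Ω u) (i : Fin d) :
    IsL2WeakDeriv Ω i u (weakDeriv Ω i u) := by
  have := h.2 i
  rw [weakDeriv, dif_pos this]
  exact this.choose_spec

theorem MemH1.hasWeakGrad (h : MemH1 Ω u) :
    HasWeakGrad Ω u (fun x => WithLp.toLp 2 fun i => weakDeriv Ω i u x) :=
  hasWeakGrad_of_partial h.1 (fun i => (isL2WeakDeriv_weakDeriv h i).1)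
    fun i φ hφ => (isL2WeakDeriv_weakDeriv h i).2 φ hφ.contDiff hφ.compact hφ.subset

theorem HasWeakGrad.weakDeriv_ae (hΩ : IsOpen Ω) (h : HasWeakGrad Ω u g) :
    ∀ᵐ x ∂(volume.restrict Ω), ∀ i, weakDeriv Ω i u x = g x i := by
  filter_upwards [h.memH1.hasWeakGrad.unique hΩ h] with x hx i
  rw [← hx]

theorem HasWeakGrad.gradInner_ae (hΩ : IsOpen Ω) (h : HasWeakGrad Ω u g)
    (h' : HasWeakGrad Ω w p) :
    gradInner Ω u w =ᵐ[volume.restrict Ω] fun x => inner ℝ (g x) (p x) := by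
  filter_upwards [h.weakDeriv_ae hΩ, h'.weakDeriv_ae hΩ] with x h1 h2
  simp only [gradInner, h1, h2, PiLp.inner_apply]
  refine Finset.sum_congr rfl fun i _ => ?_
  simp [mul_comm]

theorem HasWeakGrad.integral_gradInner (hΩ : IsOpen Ω) (h : HasWeakGrad Ω u g)
    (h' : HasWeakGrad Ω w p) :
    ∫ x in Ω, gradInner Ω u w x = ∫ x in Ω, inner ℝ (g x) (p x) :=
  integral_congr_ae (h.gradInner_ae hΩ h')

theorem HasWeakGrad.gradNormSq_eq (hΩ : IsOpen Ω) (h : HasWeakGrad Ω u g) :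
    gradNormSq Ω u = l2 (volume.restrict Ω) g ^ 2 := by
  rw [gradNormSq, h.integral_gradInner hΩ h, l2_sq_inner h.memLp_grad]

theorem MemH2.memLp_laplacian (h : MemH2 Ω u) : MemLp (laplacian Ω u) 2 (volume.restrict Ω) := by
  have : laplacian Ω u = fun x => ∑ i, weakDeriv Ω i (weakDeriv Ω i u) x := rfl
  rw [this]
  exact memLp_finsetSum _ fun i _ => (isL2WeakDeriv_weakDeriv (h.2 i) i).1

end

/-! ### Graph domains -/

/-- `γ` is a smooth function with bounded and Lipschitz gradient that does not depend on the
component in the direction of the unit vector `e`. -/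
structure IsGraphFun {d : ℕ} (e : Euc d) (γ : Euc d → ℝ) : Prop where
  norm_eq : ‖e‖ = 1
  contDiff : ContDiff ℝ ∞ γ
  invariant : ∀ (y : Euc d) (t : ℝ), γ (y + t • e) = γ y
  bounded : ∃ L, 0 ≤ L ∧ ∀ x, ‖fderiv ℝ γ x‖ ≤ L
  lipschitz : ∃ L, 0 ≤ L ∧ ∀ x y, ‖fderiv ℝ γ x - fderiv ℝ γ y‖ ≤ L * ‖x - y‖

/-- The region strictly above the graph of `γ` in the direction `e`. -/
def epigraph {d : ℕ} (e : Euc d) (γ : Euc d → ℝ) : Set (Euc d) := {y | γ y < inner ℝ y e}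

section Chart

variable {d : ℕ}

theorem isGraphFun_const {e : Euc d} (he : ‖e‖ = 1) (c : ℝ) : IsGraphFun e (fun _ => c) :=
  ⟨he, contDiff_const, fun _ _ => rfl, ⟨0, le_rfl, by simp⟩, ⟨0, le_rfl, by simp⟩⟩

/-- Away from a ball, a graph function can be modified so that its first and second derivatives
become bounded. -/
theorem exists_isGraphFun_eqOn_ball {e : Euc d} (he : ‖e‖ = 1) {γ : Euc d → ℝ}
    (hγ : ContDiff ℝ ∞ γ) (hinv : ∀ (y : Euc d) (t : ℝ), γ (y + t • e) = γ y) (x₀ : Euc d)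
    {r : ℝ} (hr : 0 < r) :
    ∃ γ', IsGraphFun e γ' ∧ ∀ x ∈ Metric.ball x₀ r, γ' x = γ x := by
  -- the orthogonal projection along `e`
  let P : Euc d →L[ℝ] Euc d :=
    ContinuousLinearMap.id ℝ (Euc d) - (innerSL ℝ e).smulRight e
  have hP : ∀ x, P x = x - inner ℝ e x • e := fun x => by simp [P]
  have hPe : P e = 0 := by rw [hP]; simp [he]
  have hPnorm : ∀ x, ‖P x‖ ≤ ‖x‖ := by
    intro x
    have h1 : ‖P x‖ ^ 2 = ‖x‖ ^ 2 - inner ℝ e x ^ 2 := by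
      rw [hP, norm_sub_sq_real, norm_smul, he, inner_smul_right, real_inner_comm x e]
      simp [sq_abs]; ring
    have : ‖P x‖ ^ 2 ≤ ‖x‖ ^ 2 := by nlinarith [sq_nonneg (inner ℝ e x)]
    exact (sq_le_sq₀ (norm_nonneg _) (norm_nonneg _)).1 this
  let χ : ContDiffBump (P x₀) := ⟨r, 2 * r, hr, by linarith⟩
  let κ : Euc d → ℝ := fun y => χ y * γ y
  have hκ : ContDiff ℝ ∞ κ := χ.contDiff.mul hγ
  have hκc : HasCompactSupport κ := χ.hasCompactSupport.mul_right
  have hκ' : ContDiff ℝ ∞ (fderiv ℝ κ) := hκ.fderiv_right (by simp)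
  obtain ⟨L₁, hL₁⟩ := hκ'.continuous.bounded_above_of_compact_support (hκc.fderiv ℝ)
  obtain ⟨L₂, hL₂⟩ := (hκ'.of_le
    (by simp : (1 : WithTop ℕ∞) ≤ ∞)).lipschitzWith_of_hasCompactSupport
    (hκc.fderiv ℝ) (by simp)
  have hfd : ∀ x, fderiv ℝ (fun x => κ (P x)) x = (fderiv ℝ κ (P x)).comp P := by
    intro x
    have := fderiv_comp (𝕜 := ℝ) (g := κ) (f := P) x (hκ.differentiable (by simp) _)
      P.differentiableAt
    simpa [Function.comp_def] using this
  have hPop : ‖P‖ ≤ 1 := P.opNorm_le_bound zero_le_one (by simpa using hPnorm)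
  have hL₁0 : 0 ≤ L₁ := (norm_nonneg _).trans (hL₁ 0)
  refine ⟨fun x => κ (P x), ⟨he, hκ.comp P.contDiff, fun y t => ?_, ⟨L₁, hL₁0, fun x => ?_⟩,
    ⟨L₂, L₂.2, fun x y => ?_⟩⟩, fun x hx => ?_⟩
  · simp [map_add, hPe]
  · rw [hfd]
    refine (ContinuousLinearMap.opNorm_comp_le _ _).trans ?_
    calc _ ≤ L₁ * 1 := mul_le_mul (hL₁ _) hPop (norm_nonneg _) hL₁0
      _ = L₁ := mul_one _
  · rw [hfd, hfd, ← ContinuousLinearMap.sub_comp]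
    refine (ContinuousLinearMap.opNorm_comp_le _ _).trans ?_
    have h1 := hL₂.norm_sub_le (P x) (P y)
    have h2 : ‖P x - P y‖ ≤ ‖x - y‖ := by rw [← map_sub]; exact hPnorm _
    calc _ ≤ (L₂ * ‖P x - P y‖) * 1 := mul_le_mul h1 hPop (norm_nonneg _) (by positivity)
      _ ≤ L₂ * ‖x - y‖ := by rw [mul_one]; gcongr
  · have h1 : χ (P x) = 1 := by
      apply χ.one_of_mem_closedBall
      rw [Metric.mem_closedBall, dist_eq_norm, ← map_sub]
      rw [Metric.mem_ball, dist_eq_norm] at hx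
      exact (hPnorm _).trans hx.le
    have h2 : γ (P x) = γ x := by
      rw [hP, sub_eq_add_neg, ← neg_smul, hinv]
    simp only [κ, h1, h2, one_mul]

/-- Near every point of its closure, a smooth bounded domain is a graph domain. For interior
points, the graph is a hyperplane far away. -/
theorem IsSmoothBoundedDomain.exists_chart {Ω : Set (Euc d)} (hd : 1 ≤ d)
    (hΩ : IsSmoothBoundedDomain Ω) {x₀ : Euc d} (hx₀ : x₀ ∈ closure Ω) :
    ∃ (e : Euc d) (γ : Euc d → ℝ) (r : ℝ), 0 < r ∧ IsGraphFun e γ ∧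
      Ω ∩ Metric.ball x₀ r = epigraph e γ ∩ Metric.ball x₀ r := by
  by_cases hx : x₀ ∈ Ω
  · obtain ⟨r, hr, hball⟩ := Metric.isOpen_iff.1 hΩ.isOpen x₀ hx
    let e : Euc d := EuclideanSpace.single ⟨0, hd⟩ 1
    have he : ‖e‖ = 1 := by simp [e]
    refine ⟨e, fun _ => inner ℝ x₀ e - r, r, hr, isGraphFun_const he _, ?_⟩
    rw [inter_eq_right.2 hball, eq_comm, inter_eq_right]
    intro y hy
    have h1 : |inner ℝ (y - x₀) e| ≤ ‖y - x₀‖ := by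
      have := abs_real_inner_le_norm (y - x₀) e
      rwa [he, mul_one] at this
    rw [Metric.mem_ball, dist_eq_norm] at hy
    have h2 := (abs_le.1 h1).1
    rw [inner_sub_left] at h2
    change inner ℝ x₀ e - r < inner ℝ y e
    linarith
  · have hfr : x₀ ∈ frontier Ω := ⟨hx₀, by rwa [hΩ.isOpen.interior_eq]⟩
    obtain ⟨e, r, γ, he, hr, hγ, hinv, hball⟩ := hΩ.smooth x₀ hfr
    obtain ⟨γ', hγ', heq⟩ := exists_isGraphFun_eqOn_ball he hγ hinv x₀ hr
    refine ⟨e, γ', r, hr, hγ', ?_⟩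
    rw [hball]
    ext y
    simp only [epigraph, mem_inter_iff, mem_ofPred_eq]
    refine and_congr_left fun hy => ?_
    rw [heq y hy]

end Chart

/-! ### Shears and their flows -/

section Shear

variable {d : ℕ} {e τ : Euc d} {γ : Euc d → ℝ}

/-- The derivative of the shear differs from the identity by a map of rank one, so that its
determinant is `1 + ∂_e q = s = ±1`. -/
theorem image_shear_volume {q : Euc d → ℝ} (hq : Differentiable ℝ q) {s : ℝ} (hs : s * s = 1)
    (hqe : ∀ (y : Euc d) (t : ℝ), q (y + t • e) = q y + (s - 1) * t) {A : Set (Euc d)}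
    (hA : MeasurableSet A) : volume ((fun x => x + q x • e) '' A) = volume A := by
  have hinj : Function.Injective (fun x : Euc d => x + q x • e) := by
    intro x y hxy
    simp only at hxy
    have h1 : q (x + q x • e) = q (y + q y • e) := by rw [hxy]
    rw [hqe, hqe] at h1
    have h2 : q x = q y := by
      have : s * q x = s * q y := by linarith
      calc q x = s * (s * q x) := by rw [← mul_assoc, hs, one_mul]
        _ = s * (s * q y) := by rw [this]
        _ = q y := by rw [← mul_assoc, hs, one_mul]
    rw [h2] at hxy
    exact add_right_cancel hxy
  have hder : ∀ x, HasFDerivAt (fun x : Euc d => x + q x • e)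
      (ContinuousLinearMap.id ℝ (Euc d) + (fderiv ℝ q x).smulRight e) x := fun x =>
    (hasFDerivAt_id x).add ((hq x).hasFDerivAt.smul_const e)
  have hqe' : ∀ x, fderiv ℝ q x e = s - 1 := by
    intro x
    have h1 : HasDerivAt (fun t : ℝ => q (x + t • e)) (fderiv ℝ q x e) 0 := by
      have h2 : HasFDerivAt q (fderiv ℝ q x) (x + (0 : ℝ) • e) := by
        simpa using (hq x).hasFDerivAt
      have h3 : HasDerivAt (fun t : ℝ => x + t • e) e 0 := by
        simpa using ((hasDerivAt_id (0 : ℝ)).smul_const e).const_add x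
      exact h2.comp_hasDerivAt 0 h3
    have h4 : HasDerivAt (fun t : ℝ => q (x + t • e)) (s - 1) 0 := by
      simp only [hqe]
      simpa using ((hasDerivAt_id (0 : ℝ)).const_mul (s - 1)).const_add (q x)
    exact h1.unique h4
  have hdet : ∀ x, |(ContinuousLinearMap.id ℝ (Euc d) + (fderiv ℝ q x).smulRight e).det| = 1 := by
    intro x
    have h1 : ((ContinuousLinearMap.id ℝ (Euc d) + (fderiv ℝ q x).smulRight e :
        Euc d →L[ℝ] Euc d) : Euc d →ₗ[ℝ] Euc d) =
        LinearMap.transvection (fderiv ℝ q x : Module.Dual ℝ (Euc d)) e := by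
      ext y
      simp [LinearMap.transvection.apply]
    rw [ContinuousLinearMap.det, h1, LinearMap.transvection.det]
    have : (1 : ℝ) + (fderiv ℝ q x : Module.Dual ℝ (Euc d)) e = s := by
      have := hqe' x
      simp only [ContinuousLinearMap.coe_coe]
      rw [this]; ring
    rw [this]
    have h2 : |s| * |s| = 1 := by rw [← abs_mul, hs, abs_one]
    nlinarith [abs_nonneg s]
  rw [← lintegral_abs_det_fderiv_eq_addHaar_image volume hA
    (fun x _ => (hder x).hasFDerivWithinAt) hinj.injOn]
  simp [hdet]

/-- A shear `x ↦ x + q(x) e` preserves the volume if `q` does not depend on the `e`-component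
(`s = 1`), and so does a reflection along `e` (`s = -1`). -/
theorem measurePreserving_shear {q : Euc d → ℝ} (hq : Differentiable ℝ q) {s : ℝ} (hs : s * s = 1)
    (hqe : ∀ (y : Euc d) (t : ℝ), q (y + t • e) = q y + (s - 1) * t) :
    MeasurePreserving (fun x => x + q x • e) (volume : Measure (Euc d)) volume := by
  have hcont : Continuous (fun x => x + q x • e) := by
    have := hq.continuous
    fun_prop
  refine ⟨hcont.measurable, ?_⟩
  ext A hA
  rw [Measure.map_apply hcont.measurable hA]
  -- the inverse map has the same form
  have hpre : (fun x => x + q x • e) ⁻¹' A = (fun x => x + (- s * q x) • e) '' A := by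
    ext x
    constructor
    · intro hx
      refine ⟨_, hx, ?_⟩
      simp only [hqe]
      have : -s * (q x + (s - 1) * q x) = - q x := by linear_combination (-q x) * hs
      rw [this]; module
    · rintro ⟨y, hy, rfl⟩
      simp only [mem_preimage, hqe]
      have : q y + (s - 1) * (-s * q y) = s * q y := by linear_combination (-q y) * hs
      rw [this]
      convert hy using 1
      module
  rw [hpre]
  refine image_shear_volume (hq.const_mul _) hs (fun y t => ?_) hA
  rw [hqe]
  linear_combination (-t) * hs

/-- The volume preserving flow `x ↦ x + hτ + (γ(x + hτ) - γ(x)) e`, the translation by `hτ`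
conjugated by the map that flattens the graph of `γ`. -/
def flow (γ : Euc d → ℝ) (e τ : Euc d) (h : ℝ) (x : Euc d) : Euc d :=
  x + h • τ + (γ (x + h • τ) - γ x) • e

/-- The vector field that generates `flow γ e τ`. -/
def flowField (γ : Euc d → ℝ) (e τ : Euc d) (x : Euc d) : Euc d := τ + fderiv ℝ γ x τ • e

theorem IsGraphFun.differentiable (hγ : IsGraphFun e γ) : Differentiable ℝ γ :=
  hγ.contDiff.differentiable (by simp)

theorem IsGraphFun.fderiv_invariant (hγ : IsGraphFun e γ) (y : Euc d) (t : ℝ) :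
    fderiv ℝ γ (y + t • e) = fderiv ℝ γ y := by
  rw [← fderiv_comp_add_right]
  simp only [hγ.invariant]

theorem fderiv_eq_zero_of_invariant {f : Euc d → ℝ} (hf : Differentiable ℝ f)
    (hinv : ∀ (y : Euc d) (t : ℝ), f (y + t • e) = f y) (x : Euc d) : fderiv ℝ f x e = 0 := by
  have h1 : HasDerivAt (fun t : ℝ => f (x + t • e)) (fderiv ℝ f x e) 0 := by
    have h2 : HasFDerivAt f (fderiv ℝ f x) (x + (0 : ℝ) • e) := by
      simpa using (hf x).hasFDerivAt
    have h3 : HasDerivAt (fun t : ℝ => x + t • e) e 0 := by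
      simpa using ((hasDerivAt_id (0 : ℝ)).smul_const e).const_add x
    exact h2.comp_hasDerivAt 0 h3
  simp only [hinv] at h1
  exact h1.unique (hasDerivAt_const _ _)

theorem IsGraphFun.abs_sub_le (hγ : IsGraphFun e γ) {L : ℝ} (hL : ∀ x, ‖fderiv ℝ γ x‖ ≤ L)
    (x y : Euc d) : |γ x - γ y| ≤ L * ‖x - y‖ :=
  Convex.norm_image_sub_le_of_norm_fderiv_le (𝕜 := ℝ) (s := univ)
    (fun x _ => hγ.differentiable x) (fun x _ => hL x) convex_univ trivial trivial

theorem flow_zero (x : Euc d) : flow γ e τ 0 x = x := by simp [flow]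

theorem IsGraphFun.flow_flow (hγ : IsGraphFun e γ) (s t : ℝ) (x : Euc d) :
    flow γ e τ s (flow γ e τ t x) = flow γ e τ (s + t) x := by
  have h1 : γ (flow γ e τ t x + s • τ) = γ (x + (s + t) • τ) := by
    rw [flow, show x + t • τ + (γ (x + t • τ) - γ x) • e + s • τ =
      (x + (s + t) • τ) + (γ (x + t • τ) - γ x) • e by module, hγ.invariant]
  have h2 : γ (flow γ e τ t x) = γ (x + t • τ) := by rw [flow, hγ.invariant]
  rw [flow, h1, h2, flow, flow]
  module

theorem IsGraphFun.continuous_flow (hγ : IsGraphFun e γ) (h : ℝ) : Continuous (flow γ e τ h) := by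
  have := hγ.contDiff.continuous
  unfold flow
  fun_prop

theorem IsGraphFun.contDiff_flow (hγ : IsGraphFun e γ) (h : ℝ) : ContDiff ℝ ∞ (flow γ e τ h) := by
  have h0 := hγ.contDiff
  have h1 : ContDiff ℝ ∞ (fun x : Euc d => x + h • τ) := contDiff_id.add contDiff_const
  exact h1.add (((h0.comp h1).sub h0).smul contDiff_const)

/-- The flow as a homeomorphism. -/
def IsGraphFun.flowHomeo (hγ : IsGraphFun e γ) (τ : Euc d) (h : ℝ) : Euc d ≃ₜ Euc d where
  toFun := flow γ e τ h
  invFun := flow γ e τ (-h)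
  left_inv x := by rw [hγ.flow_flow]; simp [flow_zero]
  right_inv x := by rw [hγ.flow_flow]; simp [flow_zero]
  continuous_toFun := hγ.continuous_flow h
  continuous_invFun := hγ.continuous_flow (-h)

theorem IsGraphFun.flow_neg_flow (hγ : IsGraphFun e γ) (h : ℝ) (x : Euc d) :
    flow γ e τ (-h) (flow γ e τ h x) = x := (hγ.flowHomeo τ h).left_inv x

theorem IsGraphFun.flow_flow_neg (hγ : IsGraphFun e γ) (h : ℝ) (x : Euc d) :
    flow γ e τ h (flow γ e τ (-h) x) = x := (hγ.flowHomeo τ h).right_inv x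

theorem IsGraphFun.measurePreserving_flow (hγ : IsGraphFun e γ) (h : ℝ) :
    MeasurePreserving (flow γ e τ h) (volume : Measure (Euc d)) volume := by
  have h1 : MeasurePreserving (fun x => x + (γ (x + h • τ) - γ x) • e)
      (volume : Measure (Euc d)) volume := by
    refine measurePreserving_shear (s := 1) ?_ (by norm_num) fun y t => ?_
    · have := hγ.differentiable
      fun_prop
    · rw [show y + t • e + h • τ = (y + h • τ) + t • e by module, hγ.invariant, hγ.invariant]
      ring
  have h2 := (measurePreserving_add_right (volume : Measure (Euc d)) (h • τ)).comp h1
  convert h2 using 1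
  ext1 x
  simp only [flow, Function.comp]
  module

theorem IsGraphFun.fderiv_flow (hγ : IsGraphFun e γ) (h : ℝ) (x : Euc d) :
    fderiv ℝ γ (flow γ e τ h x) = fderiv ℝ γ (x + h • τ) := by
  rw [flow, hγ.fderiv_invariant]

theorem IsGraphFun.hasDerivAt_flow (hγ : IsGraphFun e γ) (s : ℝ) (x : Euc d) :
    HasDerivAt (fun s => flow γ e τ s x) (flowField γ e τ (flow γ e τ s x)) s := by
  have h1 : HasDerivAt (fun s : ℝ => x + s • τ) τ s := by
    simpa using ((hasDerivAt_id s).smul_const τ).const_add x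
  have h2 : HasDerivAt (fun s : ℝ => γ (x + s • τ)) (fderiv ℝ γ (x + s • τ) τ) s :=
    (hγ.differentiable _).hasFDerivAt.comp_hasDerivAt s h1
  rw [flowField, hγ.fderiv_flow]
  exact h1.add ((h2.sub_const (γ x)).smul_const e)

theorem IsGraphFun.norm_flowField_le (hγ : IsGraphFun e γ) {L : ℝ} (hL : ∀ x, ‖fderiv ℝ γ x‖ ≤ L)
    (x : Euc d) : ‖flowField γ e τ x‖ ≤ (1 + L) * ‖τ‖ := by
  have h1 := (fderiv ℝ γ x).le_opNorm τ
  have h2 : ‖fderiv ℝ γ x‖ * ‖τ‖ ≤ L * ‖τ‖ := by gcongr; exact hL x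
  calc _ ≤ ‖τ‖ + ‖fderiv ℝ γ x τ • e‖ := norm_add_le _ _
    _ ≤ _ := by rw [norm_smul, hγ.norm_eq]; linarith

theorem IsGraphFun.norm_flow_sub_le (hγ : IsGraphFun e γ) {L : ℝ} (hL : ∀ x, ‖fderiv ℝ γ x‖ ≤ L)
    (h : ℝ) (x : Euc d) : ‖flow γ e τ h x - x‖ ≤ |h| * ((1 + L) * ‖τ‖) := by
  have h1 : flow γ e τ h x - x = h • τ + (γ (x + h • τ) - γ x) • e := by
    rw [flow]; module
  have h2 := hγ.abs_sub_le hL (x + h • τ) x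
  rw [add_sub_cancel_left, norm_smul, Real.norm_eq_abs] at h2
  rw [h1]
  calc _ ≤ ‖h • τ‖ + ‖(γ (x + h • τ) - γ x) • e‖ := norm_add_le _ _
    _ ≤ _ := by
      rw [norm_smul, norm_smul, hγ.norm_eq, Real.norm_eq_abs, Real.norm_eq_abs]
      linarith

/-- `D` is invariant under the flow. -/
def FlowInvariant (γ : Euc d → ℝ) (e τ : Euc d) (D : Set (Euc d)) : Prop :=
  ∀ h x, flow γ e τ h x ∈ D ↔ x ∈ D

theorem flowInvariant_univ : FlowInvariant γ e τ univ := fun _ _ => Iff.rfl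

/-- Graph domains are invariant under the flows in tangential directions. -/
theorem IsGraphFun.flowInvariant_epigraph (hγ : IsGraphFun e γ) (hτ : inner ℝ τ e = 0) :
    FlowInvariant γ e τ (epigraph e γ) := by
  intro h x
  have h1 : γ (flow γ e τ h x) = γ (x + h • τ) := by rw [flow, hγ.invariant]
  have h2 : inner ℝ (flow γ e τ h x) e = inner ℝ x e + γ (x + h • τ) - γ x := by
    rw [flow, inner_add_left, inner_add_left, inner_smul_left, inner_smul_left, hτ,
      real_inner_self_eq_norm_sq, hγ.norm_eq]
    simp; ring
  simp only [epigraph, mem_ofPred_eq, h1, h2]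
  constructor <;> intro <;> linarith

variable {D : Set (Euc d)}

theorem IsGraphFun.measurePreserving_flow_restrict (hγ : IsGraphFun e γ)
    (hD : FlowInvariant γ e τ D) (h : ℝ) :
    MeasurePreserving (flow γ e τ h) (volume.restrict D) (volume.restrict D) := by
  have h1 := (hγ.measurePreserving_flow (τ := τ) h).restrict_preimage_emb
    (hγ.flowHomeo τ h).measurableEmbedding D
  have h2 : flow γ e τ h ⁻¹' D = D := by ext x; exact hD h x
  rwa [h2] at h1

theorem IsGraphFun.integral_comp_flow (hγ : IsGraphFun e γ) (hD : FlowInvariant γ e τ D) (h : ℝ)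
    (f : Euc d → ℝ) : ∫ x in D, f (flow γ e τ h x) = ∫ x in D, f x :=
  (hγ.measurePreserving_flow_restrict hD h).integral_comp
    (hγ.flowHomeo τ h).measurableEmbedding f

theorem IsGraphFun.isTest_comp_flow (hγ : IsGraphFun e γ) (hD : FlowInvariant γ e τ D)
    {φ : Euc d → ℝ}
    (hφ : IsTest D φ) (h : ℝ) : IsTest D (fun x => φ (flow γ e τ h x)) := by
  refine ⟨hφ.contDiff.comp (hγ.contDiff_flow h),
    hφ.compact.comp_homeomorph (hγ.flowHomeo τ h), ?_⟩
  have h1 : tsupport (fun x => φ (flow γ e τ h x)) ⊆ flow γ e τ h ⁻¹' tsupport φ :=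
    closure_minimal (fun x hx => subset_tsupport φ hx)
      ((isClosed_tsupport φ).preimage (hγ.continuous_flow h))
  intro x hx
  exact (hD h x).1 (hφ.subset (h1 hx))

/-- The chain rule for the composition of an `H¹` function with the flow. -/
theorem HasWeakGrad.comp_flow {u : Euc d → ℝ} {g : Euc d → Euc d} (hγ : IsGraphFun e γ)
    (hD : FlowInvariant γ e τ D) (hu : HasWeakGrad D u g) (h : ℝ) :
    HasWeakGrad D (fun x => u (flow γ e τ h x)) (fun x => g (flow γ e τ h x) +
      inner ℝ (g (flow γ e τ h x)) e • (gradient γ (x + h • τ) - gradient γ x)) := by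
  have hmp := hγ.measurePreserving_flow_restrict hD h
  obtain ⟨L, hL0, hL⟩ := hγ.bounded
  have hgc : Continuous (gradient γ) :=
    (toDual ℝ (Euc d)).symm.continuous.comp (hγ.contDiff.continuous_fderiv (by simp))
  have hm1 : MemLp (fun x => g (flow γ e τ h x)) 2 (volume.restrict D) :=
    hu.memLp_grad.comp_measurePreserving hmp
  have hm2 : MemLp (fun x => inner ℝ (g (flow γ e τ h x)) e •
      (gradient γ (x + h • τ) - gradient γ x)) 2 (volume.restrict D) := by
    refine MemLp.of_le_mul (c := 2 * L) hm1 ((memLp_inner_const hm1 e).1.smul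
      (by fun_prop :
        Continuous fun x => gradient γ (x + h • τ) - gradient γ x).aestronglyMeasurable)
      (Eventually.of_forall fun x => ?_)
    rw [norm_smul, mul_comm]
    refine mul_le_mul ?_ ?_ (norm_nonneg _) (by positivity)
    · refine (norm_sub_le _ _).trans ?_
      rw [norm_gradient, norm_gradient]
      linarith [hL x, hL (x + h • τ)]
    · refine (norm_inner_le_norm _ _).trans ?_
      rw [hγ.norm_eq, mul_one]
  refine ⟨hu.memLp.comp_measurePreserving hmp, hm1.add hm2, fun φ hφ v => ?_⟩
  -- transport the test function by the inverse flow
  set ψ : Euc d → ℝ := fun y => φ (flow γ e τ (-h) y) with hψdef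
  have hψ : IsTest D ψ := hγ.isTest_comp_flow hD hφ (-h)
  have hφψ : φ = fun x => ψ (flow γ e τ h x) := by
    ext x; rw [hψdef]; simp only; rw [hγ.flow_neg_flow]
  let c : Euc d → ℝ := fun y => fderiv ℝ γ y v - fderiv ℝ γ (y - h • τ) v
  have hγ' : ContDiff ℝ ∞ (fderiv ℝ γ) := hγ.contDiff.fderiv_right (by simp)
  have hc : ContDiff ℝ ∞ c :=
    (hγ'.clm_apply contDiff_const).sub
      ((hγ'.comp (contDiff_id.sub contDiff_const)).clm_apply contDiff_const)
  have hce : ∀ y, fderiv ℝ c y e = 0 := by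
    refine fderiv_eq_zero_of_invariant (hc.differentiable (by simp)) fun y t => ?_
    simp only [c]
    rw [show y + t • e - h • τ = (y - h • τ) + t • e by module, hγ.fderiv_invariant,
      hγ.fderiv_invariant]
  have hcflow : ∀ x, c (flow γ e τ h x) = inner ℝ (gradient γ (x + h • τ) - gradient γ x) v := by
    intro x
    have : flow γ e τ h x - h • τ = x + (γ (x + h • τ) - γ x) • e := by rw [flow]; module
    simp only [c]
    rw [hγ.fderiv_flow, this, hγ.fderiv_invariant, inner_sub_left, inner_gradient, inner_gradient]
  have hcψ : IsTest D (fun y => c y * ψ y) := hψ.mul_left hc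
  have hder : ∀ x, fderiv ℝ φ x v = fderiv ℝ ψ (flow γ e τ h x) v +
      fderiv ℝ (fun y => c y * ψ y) (flow γ e τ h x) e := by
    intro x
    have h1 : HasFDerivAt (fun x : Euc d => x + h • τ) (ContinuousLinearMap.id ℝ (Euc d)) x :=
      (hasFDerivAt_id x).add_const _
    have h2 : HasFDerivAt (fun x : Euc d => γ (x + h • τ)) (fderiv ℝ γ (x + h • τ)) x :=
      (hγ.differentiable (x + h • τ)).hasFDerivAt.comp x h1
    have h3 : HasFDerivAt (flow γ e τ h) (ContinuousLinearMap.id ℝ (Euc d) +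
        (fderiv ℝ γ (x + h • τ) - fderiv ℝ γ x).smulRight e) x :=
      h1.add ((h2.sub (hγ.differentiable x).hasFDerivAt).smul_const e)
    have h4 := (hψ.differentiable (flow γ e τ h x)).hasFDerivAt.comp x h3
    rw [show φ = ψ ∘ flow γ e τ h from hφψ, h4.fderiv,
      fderiv_fun_mul (hc.differentiable (by simp) _) (hψ.differentiable _)]
    have h6 : c (flow γ e τ h x) = fderiv ℝ γ (x + h • τ) v - fderiv ℝ γ x v := by
      rw [hcflow, inner_sub_left, inner_gradient, inner_gradient]
    simp [hce, h6]
  have i1 := integrable_mul_of_memLp hu.memLp ((hψ.dirDeriv v).memLp 2)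
  have i2 := integrable_mul_of_memLp hu.memLp ((hcψ.dirDeriv e).memLp 2)
  have i3 := integrable_mul_of_memLp (memLp_inner_const hu.memLp_grad v) (hψ.memLp 2)
  have i4 := integrable_mul_of_memLp (memLp_inner_const hu.memLp_grad e) (hcψ.memLp 2)
  calc ∫ x in D, u (flow γ e τ h x) * fderiv ℝ φ x v
      = ∫ x in D, u x * (fderiv ℝ ψ x v + fderiv ℝ (fun y => c y * ψ y) x e) := by
        refine Eq.trans ?_ (hγ.integral_comp_flow hD h _)
        simp only [hder]
    _ = - ∫ x in D, (inner ℝ (g x) v * ψ x + inner ℝ (g x) e * (c x * ψ x)) := by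
        simp only [mul_add]
        rw [integral_add i1 i2, integral_add i3 i4, hu.integral_eq ψ hψ v, hu.integral_eq _ hcψ e]
        ring
    _ = _ := by
        congr 1
        refine (hγ.integral_comp_flow hD h _).symm.trans ?_
        congr 1
        ext x
        have : ψ (flow γ e τ h x) = φ x := (congrFun hφψ x).symm
        rw [this, hcflow, inner_add_left, inner_smul_left]
        simp only [RCLike.conj_to_real]
        ring

/-- The derivative of the pairing with a test function that is transported by the flow. -/
theorem IsGraphFun.hasDerivAt_integral_flow {u φ : Euc d → ℝ} (hγ : IsGraphFun e γ)
    (hu : MemLp u 2 (volume.restrict D)) (hφ : IsTest D φ) (s₀ : ℝ) :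
    HasDerivAt (fun s => ∫ x in D, u x * φ (flow γ e τ s x))
      (∫ x in D, u x * fderiv ℝ φ (flow γ e τ s₀ x) (flowField γ e τ (flow γ e τ s₀ x))) s₀ := by
  obtain ⟨L, hL0, hL⟩ := hγ.bounded
  obtain ⟨C, hC0, hC⟩ := hφ.exists_gradient_bound
  obtain ⟨R, hR⟩ := hφ.compact.isCompact.isBounded.subset_closedBall 0
  set R' := R + (|s₀| + 1) * ((1 + L) * ‖τ‖)
  set K := Metric.closedBall (0 : Euc d) R'
  have hφc := hφ.continuous
  have hfc : ∀ s, Continuous (flow γ e τ s) := fun s => hγ.continuous_flow s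
  have hφ'c : Continuous (fderiv ℝ φ) := hφ.contDiff.continuous_fderiv (by simp)
  have hFc : Continuous (flowField γ e τ) := by
    have := hγ.contDiff.continuous_fderiv (by simp : (∞ : WithTop ℕ∞) ≠ 0)
    unfold flowField
    fun_prop
  have hball : Metric.ball s₀ 1 ∈ 𝓝 s₀ := Metric.ball_mem_nhds _ one_pos
  -- off `K`, nothing is left for the times considered
  have hK : ∀ s ∈ Metric.ball s₀ 1, ∀ x ∉ K, flow γ e τ s x ∉ tsupport φ := by
    intro s hs x hx hmem
    apply hx
    have h1 := hR hmem
    simp only [Metric.mem_closedBall, dist_zero_right, K] at h1 ⊢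
    have h2 := hγ.norm_flow_sub_le (τ := τ) hL s x
    have h3 : |s| ≤ |s₀| + 1 := by
      rw [Metric.mem_ball, Real.dist_eq] at hs
      have := abs_sub_abs_le_abs_sub s s₀
      linarith
    have h4 : |s| * ((1 + L) * ‖τ‖) ≤ (|s₀| + 1) * ((1 + L) * ‖τ‖) := by gcongr
    have h5 : ‖x‖ ≤ ‖flow γ e τ s x‖ + ‖flow γ e τ s x - x‖ := by
      have := norm_sub_le (flow γ e τ s x) (flow γ e τ s x - x)
      rwa [sub_sub_cancel] at this
    linarith
  let bound : Euc d → ℝ := fun x => ‖u x‖ * K.indicator (fun _ => C * ((1 + L) * ‖τ‖)) x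
  have hboundi : Integrable bound (volume.restrict D) := by
    refine integrable_mul_of_memLp hu.norm ?_
    refine (memLp_indicator_const 2 measurableSet_closedBall _ (Or.inr ?_))
    exact ((Measure.restrict_apply_le _ _).trans_lt measure_closedBall_lt_top).ne
  have hmemφ : MemLp (fun x => φ (flow γ e τ s₀ x)) 2 (volume.restrict D) :=
    ((hφ.memLp (μ := volume) 2).comp_measurePreserving (hγ.measurePreserving_flow s₀)).restrict D
  refine (hasDerivAt_integral_of_dominated_loc_of_deriv_le (bound := bound)
    (F := fun s x => u x * φ (flow γ e τ s x))
    (F' := fun s x => u x * fderiv ℝ φ (flow γ e τ s x) (flowField γ e τ (flow γ e τ s x))) hball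
    (Eventually.of_forall fun s => ?_) (integrable_mul_of_memLp hu hmemφ) ?_
    (Eventually.of_forall fun x s hs => ?_) hboundi
    (Eventually.of_forall fun x s hs => ?_)).2
  · exact hu.1.mul (hφc.comp (hfc s)).aestronglyMeasurable
  · refine hu.1.mul (Continuous.aestronglyMeasurable ?_)
    exact (hφ'c.comp (hfc s₀)).clm_apply (hFc.comp (hfc s₀))
  · by_cases hx : x ∈ K
    · simp only [bound, indicator_of_mem hx]
      rw [norm_mul]
      gcongr
      refine (ContinuousLinearMap.le_opNorm _ _).trans ?_
      refine mul_le_mul ?_ (hγ.norm_flowField_le hL _) (norm_nonneg _) hC0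
      rw [← norm_gradient]; exact hC _
    · have h1 : fderiv ℝ φ (flow γ e τ s x) = 0 :=
        image_eq_zero_of_notMem_tsupport fun h => hK s hs x hx (tsupport_fderiv_subset ℝ h)
      simp [h1, bound, hx]
  · exact ((hφ.differentiable _).hasFDerivAt.comp_hasDerivAt s (hγ.hasDerivAt_flow s x)).const_mul _

theorem IsGraphFun.continuous_flowField (hγ : IsGraphFun e γ) : Continuous (flowField γ e τ) := by
  have := hγ.contDiff.continuous_fderiv (by simp : (∞ : WithTop ℕ∞) ≠ 0)
  unfold flowField
  fun_prop

theorem IsGraphFun.memLp_inner_flowField {g : Euc d → Euc d} (hγ : IsGraphFun e γ)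
    {μ : Measure (Euc d)} (hg : MemLp g 2 μ) :
    MemLp (fun x => inner ℝ (g x) (flowField γ e τ x)) 2 μ := by
  obtain ⟨L, hL0, hL⟩ := hγ.bounded
  refine MemLp.of_le_mul (c := (1 + L) * ‖τ‖) hg
    (hg.1.inner hγ.continuous_flowField.aestronglyMeasurable) (Eventually.of_forall fun x => ?_)
  refine (norm_inner_le_norm _ _).trans ?_
  rw [mul_comm]
  gcongr
  exact hγ.norm_flowField_le hL x

/-- The generator of the flow is divergence free, so it integrates by parts without extra terms. -/
theorem HasWeakGrad.integral_flowField {u φ : Euc d → ℝ} {g : Euc d → Euc d}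
    (hγ : IsGraphFun e γ) (hu : HasWeakGrad D u g) (hφ : IsTest D φ) :
    ∫ x in D, u x * fderiv ℝ φ x (flowField γ e τ x) =
      - ∫ x in D, inner ℝ (g x) (flowField γ e τ x) * φ x := by
  have hγ' : ContDiff ℝ ∞ (fderiv ℝ γ) := hγ.contDiff.fderiv_right (by simp)
  have hc : ContDiff ℝ ∞ (fun x => fderiv ℝ γ x τ) := hγ'.clm_apply contDiff_const
  have hce : ∀ y, fderiv ℝ (fun x => fderiv ℝ γ x τ) y e = 0 := by
    refine fderiv_eq_zero_of_invariant (hc.differentiable (by simp)) fun y t => ?_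
    rw [hγ.fderiv_invariant]
  have hcφ : IsTest D (fun x => fderiv ℝ γ x τ * φ x) := hφ.mul_left hc
  have h1 : ∀ x, u x * fderiv ℝ φ x (flowField γ e τ x) = u x * fderiv ℝ φ x τ +
      u x * fderiv ℝ (fun x => fderiv ℝ γ x τ * φ x) x e := by
    intro x
    rw [fderiv_fun_mul (hc.differentiable (by simp) _) (hφ.differentiable _)]
    simp [flowField, hce, mul_add]
  have h2 : ∀ x, inner ℝ (g x) (flowField γ e τ x) * φ x = inner ℝ (g x) τ * φ x +
      inner ℝ (g x) e * (fderiv ℝ γ x τ * φ x) := by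
    intro x
    rw [flowField, inner_add_right, inner_smul_right]; ring
  simp only [h1, h2]
  rw [integral_add (integrable_mul_of_memLp hu.memLp ((hφ.dirDeriv τ).memLp 2))
    (integrable_mul_of_memLp hu.memLp ((hcφ.dirDeriv e).memLp 2)),
    integral_add (integrable_mul_of_memLp (memLp_inner_const hu.memLp_grad τ) (hφ.memLp 2))
    (integrable_mul_of_memLp (memLp_inner_const hu.memLp_grad e) (hcφ.memLp 2)),
    hu.integral_eq φ hφ τ, hu.integral_eq _ hcφ e]
  ring

/-- The generator of the flow is invariant under the flow. -/
theorem IsGraphFun.fderiv_comp_flow (hγ : IsGraphFun e γ) {φ : Euc d → ℝ} (hφ : IsTest D φ)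
    (s : ℝ) (x : Euc d) :
    fderiv ℝ (fun y => φ (flow γ e τ s y)) x (flowField γ e τ x) =
      fderiv ℝ φ (flow γ e τ s x) (flowField γ e τ (flow γ e τ s x)) := by
  -- both sides are the time derivative of `φ` along the trajectory of `x` at time `s`
  have h1 : HasDerivAt (fun t => φ (flow γ e τ s (flow γ e τ t x)))
      (fderiv ℝ (fun y => φ (flow γ e τ s y)) x (flowField γ e τ x)) 0 := by
    have h0 : DifferentiableAt ℝ (fun y => φ (flow γ e τ s y)) x :=
      (hφ.contDiff.comp (hγ.contDiff_flow s)).differentiable (by simp) x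
    have h2 := hγ.hasDerivAt_flow (τ := τ) 0 x
    rw [flow_zero] at h2
    have h3 : HasFDerivAt (fun y => φ (flow γ e τ s y))
      (fderiv ℝ (fun y => φ (flow γ e τ s y)) x) (flow γ e τ 0 x) := by
      rw [flow_zero]; exact h0.hasFDerivAt
    exact HasFDerivAt.comp_hasDerivAt (f := fun t => flow γ e τ t x) 0 h3 h2
  have h2 : HasDerivAt (fun t => φ (flow γ e τ s (flow γ e τ t x)))
      (fderiv ℝ φ (flow γ e τ s x) (flowField γ e τ (flow γ e τ s x))) 0 := by
    simp only [hγ.flow_flow]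
    have h3 := (hφ.differentiable _).hasFDerivAt.comp_hasDerivAt s (hγ.hasDerivAt_flow (τ := τ) s x)
    have h4 : HasDerivAt (fun t : ℝ => s + t) 1 0 := (hasDerivAt_id 0).const_add s
    have h5 : HasDerivAt (φ ∘ fun s => flow γ e τ s x)
      (fderiv ℝ φ (flow γ e τ s x) (flowField γ e τ (flow γ e τ s x))) (s + 0) := by
      rw [add_zero]; exact h3
    simpa [Function.comp_def] using h5.scomp (0 : ℝ) h4
  exact h1.unique h2

/-- Differences along the flow are controlled by the derivative along its generator. -/
theorem HasWeakGrad.l2_comp_flow_sub_le {u : Euc d → ℝ} {g : Euc d → Euc d} (hDo : IsOpen D)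
    (hγ : IsGraphFun e γ) (hD : FlowInvariant γ e τ D) (hu : HasWeakGrad D u g) (h : ℝ) :
    l2 (volume.restrict D) (fun x => u (flow γ e τ h x) - u x) ≤
      |h| * l2 (volume.restrict D) (fun x => inner ℝ (g x) (flowField γ e τ x)) := by
  have hmp := hγ.measurePreserving_flow_restrict hD h
  have hum : MemLp (fun x => u (flow γ e τ h x)) 2 (volume.restrict D) :=
    hu.memLp.comp_measurePreserving hmp
  set A := l2 (volume.restrict D) (fun x => inner ℝ (g x) (flowField γ e τ x))
  have hA : 0 ≤ A := l2_nonneg _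
  refine l2_le_of_forall_test hDo (hum.sub hu.memLp) (by positivity) fun φ hφ => ?_
  have hmem : ∀ s, MemLp (fun x => φ (flow γ e τ s x)) 2 (volume.restrict D) := fun s =>
    (hφ.memLp 2).comp_measurePreserving (hγ.measurePreserving_flow_restrict hD s)
  set f : ℝ → ℝ := fun s => ∫ x in D, u x * φ (flow γ e τ s x) with hf
  have e1 : ∫ x in D, (u (flow γ e τ h x) - u x) * φ x = f (-h) - f 0 := by
    simp only [sub_mul, hf, flow_zero]
    rw [integral_sub (integrable_mul_of_memLp hum (hφ.memLp 2))
      (integrable_mul_of_memLp hu.memLp (hφ.memLp 2))]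
    congr 1
    rw [← hγ.integral_comp_flow hD h (fun x => u x * φ (flow γ e τ (-h) x))]
    simp only [hγ.flow_neg_flow]
  have e2 : ∀ s, HasDerivAt f (- ∫ x in D, inner ℝ (g x) (flowField γ e τ x) *
      φ (flow γ e τ s x)) s := by
    intro s
    rw [← hu.integral_flowField hγ (hγ.isTest_comp_flow hD hφ s)]
    simp only [hγ.fderiv_comp_flow hφ]
    exact hγ.hasDerivAt_integral_flow hu.memLp hφ s
  have e3 : ∀ s, ‖- ∫ x in D, inner ℝ (g x) (flowField γ e τ x) * φ (flow γ e τ s x)‖ ≤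
      A * l2 (volume.restrict D) φ := by
    intro s
    rw [norm_neg, Real.norm_eq_abs]
    refine (abs_integral_mul_le (hγ.memLp_inner_flowField hu.memLp_grad) (hmem s)).trans ?_
    rw [l2_comp_measurePreserving (hγ.measurePreserving_flow_restrict hD s) (hφ.memLp 2)]
  have e4 := Convex.norm_image_sub_le_of_norm_hasDerivWithin_le (s := univ) (f := f)
    (fun s _ => (e2 s).hasDerivWithinAt) (fun s _ => e3 s) convex_univ (mem_univ 0) (mem_univ (-h))
  change |∫ x in D, (u (flow γ e τ h x) - u x) * φ x| ≤ _
  rw [e1]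
  rw [Real.norm_eq_abs] at e4
  refine e4.trans (le_of_eq ?_)
  simp; ring

end Shear

/-! ### Extension by reflection -/

section Reflect

variable {d : ℕ} {e : Euc d} {γ : Euc d → ℝ}

/-- The volume preserving reflection across the graph of `γ` in the direction `e`. -/
def reflection (e : Euc d) (γ : Euc d → ℝ) (x : Euc d) : Euc d :=
  x + (2 * (γ x - inner ℝ x e)) • e

/-- The height above the graph of `γ`. -/
def height (e : Euc d) (γ : Euc d → ℝ) (x : Euc d) : ℝ := inner ℝ x e - γ x

/-- The gradient of the height above the graph of `γ`, an inner normal field. -/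
def normalField (e : Euc d) (γ : Euc d → ℝ) (x : Euc d) : Euc d := e - gradient γ x

theorem mem_epigraph_iff {x : Euc d} : x ∈ epigraph e γ ↔ 0 < height e γ x := by
  simp [epigraph, height]

theorem IsGraphFun.inner_self (hγ : IsGraphFun e γ) : inner ℝ e e = (1 : ℝ) := by
  rw [real_inner_self_eq_norm_sq, hγ.norm_eq, one_pow]

theorem IsGraphFun.height_reflection (hγ : IsGraphFun e γ) (x : Euc d) :
    height e γ (reflection e γ x) = - height e γ x := by
  rw [height, height, reflection, hγ.invariant, inner_add_left, inner_smul_left, hγ.inner_self]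
  simp; ring

theorem IsGraphFun.reflection_reflection (hγ : IsGraphFun e γ) (x : Euc d) :
    reflection e γ (reflection e γ x) = x := by
  have h := hγ.height_reflection x
  have h1 : ∀ y, reflection e γ y = y - (2 * height e γ y) • e := by
    intro y; rw [reflection, height]; module
  rw [h1 (reflection e γ x), h, h1 x]
  module

theorem IsGraphFun.contDiff_height (hγ : IsGraphFun e γ) : ContDiff ℝ ∞ (height e γ) :=
  (contDiff_id.inner ℝ contDiff_const).sub hγ.contDiff

theorem IsGraphFun.isOpen_epigraph (hγ : IsGraphFun e γ) : IsOpen (epigraph e γ) := by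
  have : epigraph e γ = height e γ ⁻¹' Ioi 0 := by ext x; exact mem_epigraph_iff
  rw [this]
  exact isOpen_Ioi.preimage hγ.contDiff_height.continuous

theorem IsGraphFun.contDiff_reflection (hγ : IsGraphFun e γ) : ContDiff ℝ ∞ (reflection e γ) :=
  contDiff_id.add ((contDiff_const.mul
    (hγ.contDiff.sub (contDiff_id.inner ℝ contDiff_const))).smul contDiff_const)

/-- The reflection as a homeomorphism. -/
def IsGraphFun.reflectionHomeo (hγ : IsGraphFun e γ) : Euc d ≃ₜ Euc d where
  toFun := reflection e γ
  invFun := reflection e γ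
  left_inv := hγ.reflection_reflection
  right_inv := hγ.reflection_reflection
  continuous_toFun := hγ.contDiff_reflection.continuous
  continuous_invFun := hγ.contDiff_reflection.continuous

theorem IsGraphFun.measurePreserving_reflection (hγ : IsGraphFun e γ) :
    MeasurePreserving (reflection e γ) (volume : Measure (Euc d)) volume := by
  refine measurePreserving_shear (q := fun x => 2 * (γ x - inner ℝ x e)) (s := -1) ?_
    (by norm_num) fun y t => ?_
  · exact (hγ.differentiable.sub (differentiable_id.inner ℝ (differentiable_const e))).const_mul 2
  · rw [hγ.invariant, inner_add_left, inner_smul_left, hγ.inner_self]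
    simp; ring

theorem IsGraphFun.integral_comp_reflection (hγ : IsGraphFun e γ) (f : Euc d → ℝ) :
    ∫ x, f (reflection e γ x) = ∫ x, f x :=
  hγ.measurePreserving_reflection.integral_comp hγ.reflectionHomeo.measurableEmbedding f

theorem IsGraphFun.hasFDerivAt_height (hγ : IsGraphFun e γ) (x : Euc d) :
    HasFDerivAt (height e γ) (innerSL ℝ e - fderiv ℝ γ x) x := by
  have h1 : HasFDerivAt (fun x : Euc d => inner ℝ x e) (innerSL ℝ e) x := by
    have := (innerSL ℝ e).hasFDerivAt (x := x)
    refine this.congr_of_eventuallyEq (Eventually.of_forall fun y => ?_)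
    simp [real_inner_comm]
  exact h1.sub (hγ.differentiable x).hasFDerivAt

theorem inner_normalField (x v : Euc d) :
    inner ℝ (normalField e γ x) v = inner ℝ e v - fderiv ℝ γ x v := by
  rw [normalField, inner_sub_left, inner_gradient]

theorem IsGraphFun.contDiff_normalField (hγ : IsGraphFun e γ) :
    ContDiff ℝ ∞ (normalField e γ) :=
  contDiff_const.sub ((toDual ℝ (Euc d)).symm.contDiff.comp
    (hγ.contDiff.fderiv_right (m := ∞) (by simp)))

theorem IsGraphFun.norm_normalField_le (hγ : IsGraphFun e γ) {L : ℝ}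
    (hL : ∀ x, ‖fderiv ℝ γ x‖ ≤ L) (x : Euc d) : ‖normalField e γ x‖ ≤ 1 + L := by
  refine (norm_sub_le _ _).trans ?_
  rw [hγ.norm_eq, norm_gradient]
  linarith [hL x]

theorem IsGraphFun.isTest_comp_reflection (hγ : IsGraphFun e γ) {φ : Euc d → ℝ}
    (hφ : IsTest univ φ) : IsTest univ (fun x => φ (reflection e γ x)) :=
  ⟨hφ.contDiff.comp hγ.contDiff_reflection, hφ.compact.comp_homeomorph hγ.reflectionHomeo,
    subset_univ _⟩

/-- The derivative of a test function at a reflected point, in terms of derivatives of the reflected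
test function. -/
theorem IsGraphFun.fderiv_reflection (hγ : IsGraphFun e γ) {φ : Euc d → ℝ} (hφ : IsTest univ φ)
    (v x : Euc d) :
    fderiv ℝ φ (reflection e γ x) v = fderiv ℝ (fun y => φ (reflection e γ y)) x v -
      2 * fderiv ℝ (fun y => inner ℝ (normalField e γ y) v * φ (reflection e γ y)) x e := by
  have h3 : HasFDerivAt (reflection e γ) (ContinuousLinearMap.id ℝ (Euc d) +
      ((-2 : ℝ) • (innerSL ℝ e - fderiv ℝ γ x)).smulRight e) x := by
    have h := (hasFDerivAt_id x).add (((hγ.hasFDerivAt_height x).const_mul (-2)).smul_const e)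
    refine h.congr_of_eventuallyEq (Eventually.of_forall fun y => ?_)
    simp only [reflection, height, id, Pi.add_apply]
    module
  have h4 := (hφ.differentiable (reflection e γ x)).hasFDerivAt.comp x h3
  have h5 : HasFDerivAt (fun y => φ (reflection e γ y)) _ x := h4
  have hn : Differentiable ℝ (fun y => inner ℝ (normalField e γ y) v) :=
    (hγ.contDiff_normalField.inner ℝ contDiff_const).differentiable (by simp)
  have hne : ∀ y, fderiv ℝ (fun y => inner ℝ (normalField e γ y) v) y e = 0 := by
    refine fderiv_eq_zero_of_invariant hn fun y t => ?_
    rw [inner_normalField, inner_normalField, hγ.fderiv_invariant]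
  have hγe : fderiv ℝ γ x e = 0 := fderiv_eq_zero_of_invariant hγ.differentiable hγ.invariant x
  rw [fderiv_fun_mul (hn x) h5.differentiableAt, h5.fderiv]
  simp only [add_apply, smul_apply, hne, smul_eq_mul, mul_zero, add_zero]
  simp [inner_normalField, hγe, hγ.norm_eq]
  ring

theorem exists_smoothTransition_deriv_bound :
    ∃ C, 0 ≤ C ∧ (∀ t, |deriv Real.smoothTransition t| ≤ C) ∧
      ∀ t, 1 < t → deriv Real.smoothTransition t = 0 := by
  have h1 : ∀ t, 1 < t → deriv Real.smoothTransition t = 0 := by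
    intro t ht
    have : Real.smoothTransition =ᶠ[𝓝 t] fun _ => 1 := by
      filter_upwards [Ioi_mem_nhds ht] with s hs
      exact Real.smoothTransition.one_of_one_le (le_of_lt hs)
    rw [this.deriv_eq, deriv_const]
  have h0 : ∀ t, t < 0 → deriv Real.smoothTransition t = 0 := by
    intro t ht
    have : Real.smoothTransition =ᶠ[𝓝 t] fun _ => 0 := by
      filter_upwards [Iio_mem_nhds ht] with s hs
      exact Real.smoothTransition.zero_of_nonpos (le_of_lt hs)
    rw [this.deriv_eq, deriv_const]
  have hc : Continuous (deriv Real.smoothTransition) :=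
    (Real.smoothTransition.contDiff (n := 1)).continuous_deriv le_rfl
  obtain ⟨C, hC⟩ := (isCompact_Icc (a := (0 : ℝ)) (b := 1)).exists_bound_of_continuousOn
    hc.continuousOn
  have hC0 : 0 ≤ C := (norm_nonneg _).trans (hC 0 (by simp))
  refine ⟨C, hC0, fun t => ?_, h1⟩
  rcases lt_or_ge t 0 with h | h
  · simp [h0 t h, hC0]
  rcases lt_or_ge 1 t with h' | h'
  · simp [h1 t h', hC0]
  exact hC t ⟨h, h'⟩

/-- Integration by parts in a graph domain against test functions that do not vanish on the
boundary, in a combination in which the boundary terms cancel. -/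
theorem HasWeakGrad.integral_reflection {u φ : Euc d → ℝ} {g : Euc d → Euc d}
    (hγ : IsGraphFun e γ) (hu : HasWeakGrad (epigraph e γ) u g) (hφ : IsTest univ φ) (v : Euc d) :
    ∫ x in epigraph e γ, u x * (fderiv ℝ φ x v + fderiv ℝ φ (reflection e γ x) v) =
      - ∫ x in epigraph e γ, (inner ℝ (g x) v * (φ x + φ (reflection e γ x)) -
        2 * (inner ℝ (g x) e * (inner ℝ (normalField e γ x) v * φ (reflection e γ x)))) := by
  set G := epigraph e γ
  set ψ : Euc d → ℝ := fun x => φ (reflection e γ x) with hψdef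
  have hψ : IsTest univ ψ := hγ.isTest_comp_reflection hφ
  set n : Euc d → ℝ := fun x => inner ℝ (normalField e γ x) v with hndef
  have hn : ContDiff ℝ ∞ n := hγ.contDiff_normalField.inner ℝ contDiff_const
  set A : Euc d → ℝ := fun x => φ x + ψ x with hAdef
  set B : Euc d → ℝ := fun x => n x * ψ x with hBdef
  have hA : IsTest univ A := hφ.add hψ
  have hB : IsTest univ B := hψ.mul_left hn
  obtain ⟨L, hL0, hL⟩ := hγ.bounded
  obtain ⟨C, hC0, hC⟩ := hφ.exists_gradient_bound
  obtain ⟨Cs, hCs0, hCs, hCs1⟩ := exists_smoothTransition_deriv_bound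
  -- cutoff near the boundary
  let θ : ℕ → Euc d → ℝ := fun m x => Real.smoothTransition ((m + 1) * height e γ x - 1)
  let θ' : ℕ → Euc d → ℝ := fun m x =>
    (m + 1) * deriv Real.smoothTransition ((m + 1) * height e γ x - 1)
  have hθ : ∀ m, ContDiff ℝ ∞ (θ m) := fun m =>
    Real.smoothTransition.contDiff.comp ((contDiff_const.mul hγ.contDiff_height).sub contDiff_const)
  have hθ1 : ∀ m x, ‖θ m x‖ ≤ 1 := fun m x => by
    rw [Real.norm_eq_abs, abs_of_nonneg (Real.smoothTransition.nonneg _)]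
    exact Real.smoothTransition.le_one _
  have hθ'c : ∀ m, Continuous (θ' m) := by
    intro m
    have h1 : Continuous (deriv Real.smoothTransition) :=
      (Real.smoothTransition.contDiff (n := 1)).continuous_deriv le_rfl
    have h2 := hγ.contDiff_height.continuous
    fun_prop
  have hθd : ∀ m x w, fderiv ℝ (θ m) x w = θ' m x * inner ℝ (normalField e γ x) w := by
    intro m x w
    have h1 : HasFDerivAt (fun x => ((m : ℝ) + 1) * height e γ x - 1)
        (((m : ℝ) + 1) • (innerSL ℝ e - fderiv ℝ γ x)) x :=
      ((hγ.hasFDerivAt_height x).const_mul _).sub_const 1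
    have h2 := ((Real.smoothTransition.contDiff (n := 1)).differentiable (by simp)
      (((m : ℝ) + 1) * height e γ x - 1)).hasDerivAt.comp_hasFDerivAt x h1
    have h3 : fderiv ℝ (θ m) x = _ := h2.fderiv
    rw [h3, inner_normalField]
    simp [θ']; ring
  have hsupp : ∀ m, tsupport (θ m) ⊆ G := by
    intro m
    have h1 : tsupport (θ m) ⊆ {x | 1 ≤ ((m : ℝ) + 1) * height e γ x} := by
      refine closure_minimal (fun x hx => ?_) ?_
      · by_contra hlt
        simp only [mem_ofPred_eq, not_le] at hlt
        exact hx (Real.smoothTransition.zero_of_nonpos (by linarith))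
      · exact isClosed_le continuous_const (continuous_const.mul hγ.contDiff_height.continuous)
    intro x hx
    have h2 : (1 : ℝ) ≤ ((m : ℝ) + 1) * height e γ x := h1 hx
    refine mem_epigraph_iff.2 ?_
    by_contra! hle
    nlinarith [(Nat.cast_nonneg m : (0 : ℝ) ≤ m)]
  have hθtest : ∀ m f, IsTest univ f → IsTest G (fun x => θ m x * f x) := fun m f hf =>
    ⟨(hθ m).mul hf.contDiff, hf.compact.mul_left, tsupport_mul_subset_left.trans (hsupp m)⟩
  -- on `G` the cutoff is eventually trivial
  have hev : ∀ x ∈ G, ∀ᶠ m : ℕ in atTop, θ m x = 1 ∧ θ' m x = 0 := by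
    intro x hx
    have hx' := mem_epigraph_iff.1 hx
    obtain ⟨N, hN⟩ := exists_nat_gt (2 / height e γ x)
    filter_upwards [eventually_ge_atTop N] with m hm
    have h1 : (2 : ℝ) < ((m : ℝ) + 1) * height e γ x := by
      rw [div_lt_iff₀ hx'] at hN
      have : (N : ℝ) ≤ m := by exact_mod_cast hm
      nlinarith
    exact ⟨Real.smoothTransition.one_of_one_le (by linarith),
      by simp only [θ']; rw [hCs1 _ (by linarith), mul_zero]⟩
  let H : Euc d → ℝ := fun x => fderiv ℝ A x v + (-2) * fderiv ℝ B x e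
  have hH : IsTest univ H := (hA.dirDeriv v).add ((hB.dirDeriv e).const_mul (-2))
  let Q : Euc d → ℝ := fun x => inner ℝ (g x) v * A x - 2 * (inner ℝ (g x) e * B x)
  have i1 := integrable_mul_of_memLp hu.memLp (hH.memLp 2)
  have iA := integrable_mul_of_memLp (memLp_inner_const hu.memLp_grad v) (hA.memLp 2)
  have iB := integrable_mul_of_memLp (memLp_inner_const hu.memLp_grad e) (hB.memLp 2)
  have i2 : Integrable Q (volume.restrict G) := iA.sub (iB.const_mul 2)
  let K := tsupport φ ∪ tsupport ψ
  have hK : IsCompact K := hφ.compact.isCompact.union hψ.compact.isCompact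
  let bound : Euc d → ℝ := fun x => ‖u x‖ * K.indicator (fun _ => 4 * Cs * C * ((1 + L) * ‖v‖)) x
  have hbound : Integrable bound (volume.restrict G) := by
    refine integrable_mul_of_memLp hu.memLp.norm ?_
    refine memLp_indicator_const 2 hK.measurableSet _ (Or.inr ?_)
    exact ((Measure.restrict_apply_le _ _).trans_lt hK.measure_lt_top).ne
  let P : ℕ → Euc d → ℝ := fun m x => u x * (θ' m x * n x * (φ x - ψ x))
  have hPb : ∀ m, ∀ x ∈ G, ‖P m x‖ ≤ bound x := by
    intro m x hx
    have hx' := mem_epigraph_iff.1 hx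
    by_cases hxK : x ∈ K
    · simp only [P, bound, indicator_of_mem hxK]
      rw [norm_mul]
      gcongr
      have h1 : |φ x - ψ x| ≤ C * (2 * height e γ x) := by
        have h2 : ‖φ x - ψ x‖ ≤ C * ‖x - reflection e γ x‖ :=
          Convex.norm_image_sub_le_of_norm_fderiv_le (𝕜 := ℝ) (s := univ)
            (fun x _ => hφ.differentiable x) (fun x _ => by rw [← norm_gradient]; exact hC x)
            convex_univ trivial trivial
        have h3 : x - reflection e γ x = (2 * height e γ x) • e := by
          rw [reflection, height]; module
        rw [h3, norm_smul, hγ.norm_eq, mul_one, Real.norm_eq_abs, Real.norm_eq_abs,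
          abs_of_pos (by linarith : 0 < 2 * height e γ x)] at h2
        exact h2
      have h4 : |n x| ≤ (1 + L) * ‖v‖ := by
        refine (abs_real_inner_le_norm _ _).trans ?_
        gcongr
        exact hγ.norm_normalField_le hL x
      have h5 : |θ' m x| * |φ x - ψ x| ≤ 4 * Cs * C := by
        rcases lt_or_ge 2 (((m : ℝ) + 1) * height e γ x) with hlt | hge
        · simp only [θ']
          rw [hCs1 _ (by linarith), mul_zero, abs_zero, zero_mul]
          positivity
        · have h6 : |θ' m x| ≤ (m + 1) * Cs := by
            simp only [θ']
            rw [abs_mul, abs_of_pos (by positivity : (0 : ℝ) < m + 1)]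
            gcongr
            exact hCs _
          calc |θ' m x| * |φ x - ψ x| ≤ ((m + 1) * Cs) * (C * (2 * height e γ x)) := by gcongr
            _ = (2 * Cs * C) * (((m : ℝ) + 1) * height e γ x) := by ring
            _ ≤ (2 * Cs * C) * 2 := by gcongr
            _ = _ := by ring
      rw [Real.norm_eq_abs, abs_mul, abs_mul]
      calc |θ' m x| * |n x| * |φ x - ψ x| = (|θ' m x| * |φ x - ψ x|) * |n x| := by ring
        _ ≤ (4 * Cs * C) * ((1 + L) * ‖v‖) := by gcongr
    · have h1 : φ x = 0 := image_eq_zero_of_notMem_tsupport fun h => hxK (Or.inl h)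
      have h2 : ψ x = 0 := image_eq_zero_of_notMem_tsupport fun h => hxK (Or.inr h)
      simp [P, bound, h1, h2, hxK]
  have hGm : MeasurableSet G := hγ.isOpen_epigraph.measurableSet
  have hPm : ∀ m, AEStronglyMeasurable (P m) (volume.restrict G) := fun m =>
    hu.memLp.1.mul (((hθ'c m).mul hn.continuous).mul
      (hφ.continuous.sub hψ.continuous)).aestronglyMeasurable
  have hPi : ∀ m, Integrable (P m) (volume.restrict G) := fun m =>
    hbound.mono' (hPm m) ((ae_restrict_iff' hGm).2 (Eventually.of_forall (hPb m)))
  have hθi : ∀ m {f : Euc d → ℝ}, Integrable f (volume.restrict G) →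
      Integrable (fun x => θ m x * f x) (volume.restrict G) := fun m f hf =>
    hf.bdd_mul (c := 1) (hθ m).continuous.aestronglyMeasurable (Eventually.of_forall (hθ1 m))
  have hθlim : ∀ {f : Euc d → ℝ}, Integrable f (volume.restrict G) →
      Tendsto (fun m => ∫ x in G, θ m x * f x) atTop (𝓝 (∫ x in G, f x)) := by
    intro f hf
    refine tendsto_integral_of_dominated_convergence (fun x => ‖f x‖)
      (fun m => (hθi m hf).1) hf.norm (fun m => Eventually.of_forall fun x => ?_)
      ((ae_restrict_iff' hGm).2 (Eventually.of_forall fun x hx => ?_))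
    · rw [norm_mul]
      exact mul_le_of_le_one_left (norm_nonneg _) (hθ1 m x)
    · refine tendsto_const_nhds.congr' ?_
      filter_upwards [hev x hx] with m hm
      rw [hm.1, one_mul]
  have hPlim : Tendsto (fun m => ∫ x in G, P m x) atTop (𝓝 0) := by
    rw [← integral_zero (Euc d) ℝ (μ := volume.restrict G)]
    refine tendsto_integral_of_dominated_convergence bound hPm hbound
      (fun m => (ae_restrict_iff' hGm).2 (Eventually.of_forall (hPb m)))
      ((ae_restrict_iff' hGm).2 (Eventually.of_forall fun x hx => ?_))
    refine tendsto_const_nhds.congr' ?_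
    filter_upwards [hev x hx] with m hm
    simp [P, hm.2]
  have hmain : ∀ m, (∫ x in G, θ m x * (u x * H x)) + ∫ x in G, P m x =
      - ∫ x in G, θ m x * Q x := by
    intro m
    have e1 := hu.integral_eq _ (hθtest m A hA) v
    have e2 := hu.integral_eq _ (hθtest m B hB) e
    have j1 := integrable_mul_of_memLp hu.memLp (((hθtest m A hA).dirDeriv v).memLp 2)
    have j2 := integrable_mul_of_memLp hu.memLp (((hθtest m B hB).dirDeriv e).memLp 2)
    have j3 := integrable_mul_of_memLp (memLp_inner_const hu.memLp_grad v)
      ((hθtest m A hA).memLp 2)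
    have j4 := integrable_mul_of_memLp (memLp_inner_const hu.memLp_grad e)
      ((hθtest m B hB).memLp 2)
    have hne : ∀ x, inner ℝ (normalField e γ x) e = (1 : ℝ) := by
      intro x
      rw [inner_normalField, hγ.inner_self,
        fderiv_eq_zero_of_invariant hγ.differentiable hγ.invariant, sub_zero]
    calc (∫ x in G, θ m x * (u x * H x)) + ∫ x in G, P m x
        = ∫ x in G, (u x * fderiv ℝ (fun x => θ m x * A x) x v -
          2 * (u x * fderiv ℝ (fun x => θ m x * B x) x e)) := by
          rw [← integral_add (hθi m i1) (hPi m)]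
          congr 1; ext x
          rw [fderiv_fun_mul ((hθ m).differentiable (by simp) x) (hA.differentiable x),
            fderiv_fun_mul ((hθ m).differentiable (by simp) x) (hB.differentiable x)]
          simp only [add_apply, smul_apply, smul_eq_mul,
            hθd, hne, P, H]
          simp only [hAdef, hBdef, hndef]
          ring
      _ = - ∫ x in G, (inner ℝ (g x) v * (θ m x * A x) -
          2 * (inner ℝ (g x) e * (θ m x * B x))) := by
          rw [integral_sub j1 (j2.const_mul 2), integral_sub j3 (j4.const_mul 2),
            integral_const_mul, integral_const_mul, e1, e2]
          ring
      _ = _ := by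
          congr 2; ext x
          simp only [Q]
          ring
  have h1 := (hθlim i1).add hPlim
  rw [add_zero] at h1
  have h2 := (hθlim i2).neg
  have h3 := tendsto_nhds_unique (h1.congr hmain) h2
  calc _ = ∫ x in G, u x * H x := by
        congr 1; ext x
        rw [hγ.fderiv_reflection hφ]
        simp only [H, hAdef]
        rw [fderiv_fun_add (hφ.differentiable x) (hψ.differentiable x)]
        simp only [add_apply, hψdef, hBdef, hndef]
        ring
    _ = _ := h3

/-- The extension of a function on the graph domain to the whole space by reflection. -/
def reflExt {V : Type*} [AddCommMonoid V] (e : Euc d) (γ : Euc d → ℝ) (f : Euc d → V) (x : Euc d) :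
    V := (epigraph e γ).indicator f x + (epigraph e γ).indicator f (reflection e γ x)

theorem IsGraphFun.memLp_indicator {V : Type*} [NormedAddCommGroup V] (hγ : IsGraphFun e γ)
    {f : Euc d → V} (hf : MemLp f 2 (volume.restrict (epigraph e γ))) :
    MemLp ((epigraph e γ).indicator f) 2 volume :=
  (memLp_indicator_iff_restrict hγ.isOpen_epigraph.measurableSet).2 hf

theorem IsGraphFun.l2_indicator {V : Type*} [NormedAddCommGroup V] (hγ : IsGraphFun e γ)
    (f : Euc d → V) : l2 volume ((epigraph e γ).indicator f) =
      l2 (volume.restrict (epigraph e γ)) f := by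
  rw [l2, l2, eLpNorm_indicator_eq_eLpNorm_restrict hγ.isOpen_epigraph.measurableSet]

theorem IsGraphFun.integral_reflExt_mul (hγ : IsGraphFun e γ) {f ρ : Euc d → ℝ}
    (hf : MemLp f 2 (volume.restrict (epigraph e γ))) (hρ : MemLp ρ 2 volume) :
    ∫ x, reflExt e γ f x * ρ x = ∫ x in epigraph e γ, f x * (ρ x + ρ (reflection e γ x)) := by
  have hm := hγ.memLp_indicator hf
  have hm' : MemLp (fun x => (epigraph e γ).indicator f (reflection e γ x)) 2 volume :=
    hm.comp_measurePreserving hγ.measurePreserving_reflection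
  have hρ' : MemLp (fun x => ρ (reflection e γ x)) 2 volume :=
    hρ.comp_measurePreserving hγ.measurePreserving_reflection
  have h1 : ∫ x, (epigraph e γ).indicator f (reflection e γ x) * ρ x =
      ∫ x, (epigraph e γ).indicator f x * ρ (reflection e γ x) := by
    rw [← hγ.integral_comp_reflection]
    simp only [hγ.reflection_reflection]
  simp only [reflExt, add_mul]
  rw [integral_add (integrable_mul_of_memLp hm hρ) (integrable_mul_of_memLp hm' hρ), h1,
    ← integral_add (integrable_mul_of_memLp hm hρ) (integrable_mul_of_memLp hm hρ'),
    ← integral_indicator hγ.isOpen_epigraph.measurableSet]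
  congr 1; ext x
  by_cases hx : x ∈ epigraph e γ <;> simp [hx, mul_add]

/-- The weak gradient of the extension by reflection. -/
theorem HasWeakGrad.reflExt {u : Euc d → ℝ} {g : Euc d → Euc d}
    (hγ : IsGraphFun e γ) (hu : HasWeakGrad (epigraph e γ) u g) :
    HasWeakGrad univ (reflExt e γ u) (fun x => PhaseField.reflExt e γ g x -
      (2 * inner ℝ ((epigraph e γ).indicator g (reflection e γ x)) e) • normalField e γ x) := by
  obtain ⟨L, hL0, hL⟩ := hγ.bounded
  have hmu := hγ.memLp_indicator hu.memLp
  have hmu' := hmu.comp_measurePreserving hγ.measurePreserving_reflection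
  have hmg := hγ.memLp_indicator hu.memLp_grad
  have hmg' := hmg.comp_measurePreserving hγ.measurePreserving_reflection
  have hm3 : MemLp (fun x => (2 * inner ℝ ((epigraph e γ).indicator g (reflection e γ x)) e) •
      normalField e γ x) 2 volume := by
    refine MemLp.of_le_mul (c := 2 * (1 + L)) hmg'
      (((memLp_inner_const hmg' e).1.const_mul 2).smul
        hγ.contDiff_normalField.continuous.aestronglyMeasurable) (Eventually.of_forall fun x => ?_)
    rw [norm_smul, norm_mul]
    have h1 : ‖inner ℝ ((epigraph e γ).indicator g (reflection e γ x)) e‖ ≤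
        ‖(epigraph e γ).indicator g (reflection e γ x)‖ := by
      refine (norm_inner_le_norm _ _).trans ?_
      rw [hγ.norm_eq, mul_one]
    have h2 := hγ.norm_normalField_le hL x
    calc _ ≤ ‖(2 : ℝ)‖ * ‖(epigraph e γ).indicator g (reflection e γ x)‖ * (1 + L) := by gcongr
      _ = _ := by simp only [Real.norm_ofNat, Function.comp]; ring
  refine ⟨by rw [Measure.restrict_univ]; exact hmu.add hmu',
    by rw [Measure.restrict_univ]; exact (hmg.add hmg').sub hm3, fun φ hφ v => ?_⟩
  have hψ := hγ.isTest_comp_reflection hφ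
  have hn : ContDiff ℝ ∞ (fun x => inner ℝ (normalField e γ x) v) :=
    hγ.contDiff_normalField.inner ℝ contDiff_const
  have hnφ : IsTest univ (fun x => inner ℝ (normalField e γ x) v * φ x) := hφ.mul_left hn
  have hninv : ∀ x, inner ℝ (normalField e γ (reflection e γ x)) v =
      inner ℝ (normalField e γ x) v := by
    intro x
    rw [inner_normalField, inner_normalField, reflection, hγ.fderiv_invariant]
  simp only [Measure.restrict_univ]
  rw [hγ.integral_reflExt_mul hu.memLp ((hφ.dirDeriv v).memLp 2), hu.integral_reflection hγ hφ v]
  congr 1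
  have hgv := memLp_inner_const hu.memLp_grad v
  have hge := memLp_inner_const hu.memLp_grad e
  have hmge := hγ.memLp_indicator hge
  have hmge' := hmge.comp_measurePreserving hγ.measurePreserving_reflection
  have hmgv := hγ.memLp_indicator hgv
  have hmgv' := hmgv.comp_measurePreserving hγ.measurePreserving_reflection
  have hind : ∀ w x, (epigraph e γ).indicator (fun x => inner ℝ (g x) w) x =
      inner ℝ ((epigraph e γ).indicator g x) w := by
    intro w x
    by_cases hx : x ∈ epigraph e γ <;> simp [hx]
  have e1 := hγ.integral_reflExt_mul hgv (hφ.memLp 2)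
  have e2 : ∫ x, (epigraph e γ).indicator (fun x => inner ℝ (g x) e) (reflection e γ x) *
      (inner ℝ (normalField e γ x) v * φ x) =
      ∫ x in epigraph e γ, inner ℝ (g x) e *
        (inner ℝ (normalField e γ x) v * φ (reflection e γ x)) := by
    rw [← hγ.integral_comp_reflection, ← integral_indicator hγ.isOpen_epigraph.measurableSet]
    simp only [hγ.reflection_reflection, hninv]
    congr 1; ext x
    by_cases hx : x ∈ epigraph e γ <;> simp [hx]
  rw [integral_sub (integrable_mul_of_memLp hgv ((hφ.add hψ).memLp 2))
    ((integrable_mul_of_memLp hge ((hψ.mul_left hn).memLp 2)).const_mul 2), integral_const_mul,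
    ← e1, ← e2, ← integral_const_mul, ← integral_sub]
  · congr 1; ext x
    simp only [PhaseField.reflExt, hind, inner_sub_left, inner_add_left, inner_smul_left,
      RCLike.conj_to_real]
    ring
  · simp only [PhaseField.reflExt, add_mul]
    exact (integrable_mul_of_memLp hmgv (hφ.memLp 2)).add
      (integrable_mul_of_memLp hmgv' (hφ.memLp 2))
  · exact (integrable_mul_of_memLp hmge' (hnφ.memLp 2)).const_mul 2

end Reflect

/-! ### Local extension to the whole space -/

section Extension

variable {d : ℕ}

theorem exists_test_eq_one (x₀ : Euc d) {r : ℝ} (hr : 0 < r) :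
    ∃ ζ, IsTest (Metric.ball x₀ r) ζ ∧ (∀ x ∈ Metric.ball x₀ (r / 2), ζ x = 1) := by
  let ζ : ContDiffBump x₀ := ⟨r / 2, 3 * r / 4, by positivity, by linarith⟩
  refine ⟨ζ, ⟨ζ.contDiff, ζ.hasCompactSupport, ?_⟩,
    fun x hx => ζ.one_of_mem_closedBall (Metric.ball_subset_closedBall hx)⟩
  rw [ζ.tsupport_eq]
  exact Metric.closedBall_subset_ball (by change 3 * r / 4 < r; linarith)

theorem restrict_indicator_congr {D D' B : Set (Euc d)} (hB : MeasurableSet B)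
    (hD : D ∩ B = D' ∩ B) : (volume.restrict D).restrict B = (volume.restrict D').restrict B := by
  rw [Measure.restrict_restrict hB, Measure.restrict_restrict hB, inter_comm, hD, inter_comm]

theorem l2_restrict_congr {V : Type*} [NormedAddCommGroup V] {D D' B : Set (Euc d)}
    (hB : MeasurableSet B) (hD : D ∩ B = D' ∩ B) {f : Euc d → V} (hf : ∀ x ∉ B, f x = 0) :
    l2 (volume.restrict D) f = l2 (volume.restrict D') f := by
  have h : f = B.indicator f := by
    ext x
    by_cases hx : x ∈ B <;> simp [hx, hf]
  rw [l2, l2, h, eLpNorm_indicator_eq_eLpNorm_restrict hB, eLpNorm_indicator_eq_eLpNorm_restrict hB,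
    restrict_indicator_congr hB hD]

theorem integral_restrict_congr {D D' B : Set (Euc d)}
    (hB : MeasurableSet B) (hD : D ∩ B = D' ∩ B) {f : Euc d → ℝ} (hf : ∀ x ∉ B, f x = 0) :
    ∫ x in D, f x = ∫ x in D', f x := by
  have h : f = B.indicator f := by
    ext x
    by_cases hx : x ∈ B <;> simp [hx, hf]
  rw [h, integral_indicator hB, integral_indicator hB, restrict_indicator_congr hB hD]

theorem IsTest.eq_zero {B : Set (Euc d)} {ζ : Euc d → ℝ} (hζ : IsTest B ζ) {x : Euc d}
    (hx : x ∉ B) : ζ x = 0 :=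
  image_eq_zero_of_notMem_tsupport fun h => hx (hζ.subset h)

theorem IsTest.gradient_eq_zero {B : Set (Euc d)} {ζ : Euc d → ℝ} (hζ : IsTest B ζ) {x : Euc d}
    (hx : x ∉ B) : gradient ζ x = 0 := by
  have h2 : fderiv ℝ ζ x = 0 :=
    image_eq_zero_of_notMem_tsupport fun h => hx (hζ.subset (tsupport_fderiv_subset ℝ (f := ζ) h))
  simp [gradient, h2]

/-- Multiplication by a test function is bounded in `L²` and in `H¹`. -/
theorem IsTest.exists_mul_bound {B : Set (Euc d)} {ζ : Euc d → ℝ} (hζ : IsTest B ζ) :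
    ∃ C, 0 ≤ C ∧ ∀ (μ : Measure (Euc d)) (u : Euc d → ℝ) (g : Euc d → Euc d), MemLp u 2 μ →
      MemLp g 2 μ → l2 μ (fun x => ζ x * u x) ≤ C * l2 μ u ∧
      l2 μ (fun x => ζ x • g x + u x • gradient ζ x) ≤ C * (l2 μ u + l2 μ g) := by
  obtain ⟨C₁, h1, hC₁⟩ := hζ.exists_bound
  obtain ⟨C₂, h2, hC₂⟩ := hζ.exists_gradient_bound
  refine ⟨C₁ + C₂, by positivity, fun μ u g hu hg => ?_⟩
  have e1 : l2 μ (fun x => ζ x * u x) ≤ C₁ * l2 μ u :=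
    l2_le_of_norm_le h1 hu (Eventually.of_forall fun x => by
      rw [norm_mul]; gcongr; exact hC₁ x)
  have e2 : l2 μ (fun x => ζ x • g x) ≤ C₁ * l2 μ g :=
    l2_le_of_norm_le h1 hg (Eventually.of_forall fun x => by
      rw [norm_smul]; gcongr; exact hC₁ x)
  have e3 : l2 μ (fun x => u x • gradient ζ x) ≤ C₂ * l2 μ u :=
    l2_le_of_norm_le h2 hu (Eventually.of_forall fun x => by
      rw [norm_smul, mul_comm]; gcongr; exact hC₂ x)
  have n1 := l2_nonneg (μ := μ) u
  have n2 := l2_nonneg (μ := μ) g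
  refine ⟨by nlinarith, ?_⟩
  have := l2_add_le (hζ.memLp_smul hg) (memLp_smul_gradient hζ hu)
  nlinarith

variable {e : Euc d} {γ : Euc d → ℝ}

theorem IsGraphFun.l2_reflExt_le {V : Type*} [NormedAddCommGroup V] (hγ : IsGraphFun e γ)
    {f : Euc d → V} (hf : MemLp f 2 (volume.restrict (epigraph e γ))) :
    l2 volume (reflExt e γ f) ≤ 2 * l2 (volume.restrict (epigraph e γ)) f := by
  have hm := hγ.memLp_indicator hf
  have h1 := l2_add_le hm (hm.comp_measurePreserving hγ.measurePreserving_reflection)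
  have h2 := l2_comp_measurePreserving hγ.measurePreserving_reflection hm
  rw [hγ.l2_indicator] at h2
  calc _ ≤ _ := h1
    _ = _ := by rw [hγ.l2_indicator]; simp only [Function.comp_def]; rw [h2]; ring

/-- Near every point of the closure of a smooth bounded domain, `H¹` functions extend to compactly
supported `H¹` functions on the whole space. The extension `T` is bounded in `H¹`, and testing
`T u` against `ρ` amounts to testing `u` against some `ρ'`, so that `T` preserves weak limits. -/
theorem IsSmoothBoundedDomain.exists_extension {Ω : Set (Euc d)} (hd : 1 ≤ d)
    (hΩ : IsSmoothBoundedDomain Ω) {x₀ : Euc d} (hx₀ : x₀ ∈ closure Ω) :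
    ∃ (r R C : ℝ) (T : (Euc d → ℝ) → Euc d → ℝ), 0 < r ∧ 0 ≤ C ∧
      (∀ u, ∀ x ∈ Ω ∩ Metric.ball x₀ r, T u x = u x) ∧
      (∀ ρ, MemLp ρ 2 volume → ∃ ρ', MemLp ρ' 2 (volume.restrict Ω) ∧
        ∀ u, MemLp u 2 (volume.restrict Ω) → ∫ x, T u x * ρ x = ∫ x in Ω, u x * ρ' x) ∧
      ∀ u g, HasWeakGrad Ω u g → ∃ q, HasWeakGrad univ (T u) q ∧
        (∀ x ∉ Metric.closedBall x₀ R, T u x = 0 ∧ q x = 0) ∧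
        l2 volume (T u) ≤ C * (l2 (volume.restrict Ω) u + l2 (volume.restrict Ω) g) ∧
        l2 volume q ≤ C * (l2 (volume.restrict Ω) u + l2 (volume.restrict Ω) g) := by
  obtain ⟨e, γ, r, hr, hγ, hball⟩ := hΩ.exists_chart hd hx₀
  set G := epigraph e γ
  set B := Metric.ball x₀ r
  have hB : MeasurableSet B := measurableSet_ball
  obtain ⟨ζ, hζ, hζ1⟩ := exists_test_eq_one x₀ hr
  obtain ⟨η, hη, hη1⟩ := exists_test_eq_one x₀ hr
  obtain ⟨Cζ, hCζ0, hCζ⟩ := hζ.exists_mul_bound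
  obtain ⟨Cη, hCη0, hCη⟩ := hη.exists_mul_bound
  obtain ⟨L, hL0, hL⟩ := hγ.bounded
  set C₁ := 2 + 2 * (1 + L)
  refine ⟨r / 2, r, 2 * Cη * C₁ * (2 * Cζ), fun u x => η x * reflExt e γ (fun x => ζ x * u x) x,
    by positivity, by positivity, ?_, ?_, ?_⟩
  · rintro u x ⟨hx1, hx2⟩
    have hxB : x ∈ B := Metric.ball_subset_ball (by linarith) hx2
    have hxG : x ∈ G := (hball.subset ⟨hx1, hxB⟩).1
    have hxG' : reflection e γ x ∉ G := by
      rw [mem_epigraph_iff, hγ.height_reflection]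
      have := mem_epigraph_iff.1 hxG
      linarith
    simp only [hη1 x hx2, one_mul, reflExt]
    rw [indicator_of_mem hxG, indicator_of_notMem hxG', hζ1 x hx2]
    simp
  · intro ρ hρ
    have hηρ := hη.memLp_mul hρ
    have hηρ' : MemLp (fun x => η (reflection e γ x) * ρ (reflection e γ x)) 2 volume :=
      hηρ.comp_measurePreserving hγ.measurePreserving_reflection
    refine ⟨fun x => ζ x * (η x * ρ x + η (reflection e γ x) * ρ (reflection e γ x)),
      (hζ.memLp_mul (hηρ.add hηρ')).restrict _, fun u hu => ?_⟩
    have hζu : MemLp (fun x => ζ x * u x) 2 (volume.restrict G) := by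
      have h1 : (fun x => ζ x * u x) = B.indicator (fun x => ζ x * u x) := by
        ext x
        by_cases hx : x ∈ B
        · simp [hx]
        · simp [hx, hζ.eq_zero hx]
      have h2 := hζ.memLp_mul hu
      rw [h1, memLp_indicator_iff_restrict hB] at h2 ⊢
      rwa [← restrict_indicator_congr hB hball]
    calc ∫ x, η x * reflExt e γ (fun x => ζ x * u x) x * ρ x
        = ∫ x, reflExt e γ (fun x => ζ x * u x) x * (η x * ρ x) := by congr 1; ext x; ring
      _ = ∫ x in G, ζ x * u x * (η x * ρ x + η (reflection e γ x) * ρ (reflection e γ x)) :=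
        hγ.integral_reflExt_mul hζu hηρ
      _ = ∫ x in Ω, ζ x * u x * (η x * ρ x + η (reflection e γ x) * ρ (reflection e γ x)) :=
        integral_restrict_congr hB hball.symm fun x hx => by simp [hζ.eq_zero hx]
      _ = _ := by congr 1; ext x; ring
  · intro u g hu
    set p : Euc d → Euc d := fun x => ζ x • g x + u x • gradient ζ x
    have hU : HasWeakGrad G (fun x => ζ x * u x) p := hu.mul_test hB hball hζ
    have hE := hU.reflExt hγ
    have hF := hE.mul_test' hη
    refine ⟨_, hF, fun x hx => ?_, ?_⟩
    · have hxB : x ∉ B := fun h => hx (Metric.ball_subset_closedBall h)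
      simp [hη.eq_zero hxB, hη.gradient_eq_zero hxB]
    have hb1 := (hCζ _ u g hu.memLp hu.memLp_grad)
    have hc1 : l2 (volume.restrict Ω) (fun x => ζ x * u x) =
        l2 (volume.restrict G) (fun x => ζ x * u x) :=
      l2_restrict_congr hB hball fun x hx => by simp [hζ.eq_zero hx]
    have hc2 : l2 (volume.restrict Ω) p = l2 (volume.restrict G) p :=
      l2_restrict_congr hB hball fun x hx => by
        simp [p, hζ.eq_zero hx, hζ.gradient_eq_zero hx]
    rw [hc1, hc2] at hb1
    obtain ⟨hb1, hb2⟩ := hb1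
    have hEm := hE.memLp
    have hEg := hE.memLp_grad
    rw [Measure.restrict_univ] at hEm hEg
    have hb3 := hγ.l2_reflExt_le hU.memLp
    have hb4 : l2 volume (fun x => reflExt e γ p x -
        (2 * inner ℝ (G.indicator p (reflection e γ x)) e) • normalField e γ x) ≤
        C₁ * l2 (volume.restrict G) p := by
      have hm := hγ.memLp_indicator hU.memLp_grad
      have hm' : MemLp (fun x => G.indicator p (reflection e γ x)) 2 volume :=
        hm.comp_measurePreserving hγ.measurePreserving_reflection
      have h1 : MemLp (reflExt e γ p) 2 volume := hm.add hm'
      have h2 : ∀ x, ‖(2 * inner ℝ (G.indicator p (reflection e γ x)) e) • normalField e γ x‖ ≤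
          2 * (1 + L) * ‖G.indicator p (reflection e γ x)‖ := by
        intro x
        rw [norm_smul, norm_mul]
        have h1 : ‖inner ℝ (G.indicator p (reflection e γ x)) e‖ ≤
            ‖G.indicator p (reflection e γ x)‖ := by
          refine (norm_inner_le_norm _ _).trans ?_
          rw [hγ.norm_eq, mul_one]
        have h2 := hγ.norm_normalField_le hL x
        calc _ ≤ ‖(2 : ℝ)‖ * ‖G.indicator p (reflection e γ x)‖ * (1 + L) := by gcongr
          _ = _ := by simp only [Real.norm_ofNat]; ring
      have h3 : MemLp (fun x => (2 * inner ℝ (G.indicator p (reflection e γ x)) e) •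
          normalField e γ x) 2 volume :=
        MemLp.of_le_mul (c := 2 * (1 + L)) hm' (((memLp_inner_const hm' e).1.const_mul 2).smul
          hγ.contDiff_normalField.continuous.aestronglyMeasurable) (Eventually.of_forall h2)
      have h4 := l2_le_of_norm_le (by positivity) hm' (Eventually.of_forall h2)
      rw [l2_comp_measurePreserving hγ.measurePreserving_reflection hm, hγ.l2_indicator] at h4
      calc _ ≤ _ := l2_sub_le h1 h3
        _ ≤ 2 * l2 (volume.restrict G) p + 2 * (1 + L) * l2 (volume.restrict G) p :=
          add_le_add (hγ.l2_reflExt_le hU.memLp_grad) h4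
        _ = _ := by simp only [C₁]; ring
    have hb5 := hCη _ _ _ hEm hEg
    set a := l2 (volume.restrict Ω) u
    set b := l2 (volume.restrict Ω) g
    have na : 0 ≤ a := l2_nonneg _
    have nb : 0 ≤ b := l2_nonneg _
    have hC₁ : 2 ≤ C₁ := by simp only [C₁]; linarith
    have k1 : l2 (volume.restrict G) (fun x => ζ x * u x) ≤ Cζ * (a + b) := by nlinarith
    have k2 : l2 volume (reflExt e γ (fun x => ζ x * u x)) ≤ C₁ * (Cζ * (a + b)) := by
      exact hb3.trans (mul_le_mul hC₁ k1 (l2_nonneg _) (by positivity))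
    have k3 := hb4.trans (by gcongr : _ ≤ C₁ * (Cζ * (a + b)))
    have hpos : 0 ≤ Cη * (C₁ * (Cζ * (a + b))) := by positivity
    refine ⟨hb5.1.trans ?_, hb5.2.trans ?_⟩
    · calc _ ≤ Cη * (C₁ * (Cζ * (a + b))) := by gcongr
        _ ≤ 4 * (Cη * (C₁ * (Cζ * (a + b)))) := by linarith
        _ = _ := by ring
    · calc _ ≤ Cη * (C₁ * (Cζ * (a + b)) + C₁ * (Cζ * (a + b))) := by gcongr
        _ ≤ 4 * (Cη * (C₁ * (Cζ * (a + b)))) := by linarith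
        _ = _ := by ring

end Extension

/-! ### Mollification -/

section Mollify

variable {d : ℕ} {f w : Euc d → ℝ} {q : Euc d → Euc d}

/-- The bump function around the origin with radius `ε`. -/
def stdBump (d : ℕ) (ε : ℝ) (hε : 0 < ε) : ContDiffBump (0 : Euc d) :=
  ⟨ε / 2, ε, by positivity, by linarith⟩

/-- The mollification of `f`. -/
def moll (b : ContDiffBump (0 : Euc d)) (f : Euc d → ℝ) : Euc d → ℝ :=
  convolution (b.normed volume) f (ContinuousLinearMap.lsmul ℝ ℝ) volume

variable (b : ContDiffBump (0 : Euc d))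

theorem moll_apply (x : Euc d) : moll b f x = ∫ t, b.normed volume t * f (x - t) := rfl

theorem moll_eq_swap (x : Euc d) : moll b f x = ∫ y, b.normed volume (x - y) * f y :=
  convolution_eq_swap _

theorem contDiff_moll (hf : LocallyIntegrable f volume) : ContDiff ℝ ∞ (moll b f) :=
  b.hasCompactSupport_normed.contDiff_convolution_left _ b.contDiff_normed hf

theorem moll_eq_zero {x₀ : Euc d} {R : ℝ} (hf : ∀ x ∉ Metric.closedBall x₀ R, f x = 0) {x : Euc d}
    (hx : x ∉ Metric.closedBall x₀ (R + b.rOut)) : moll b f x = 0 := by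
  rw [moll_apply, ← integral_zero (Euc d) ℝ]
  congr 1; ext t
  by_cases ht : t ∈ Metric.closedBall (0 : Euc d) b.rOut
  · rw [hf, mul_zero]
    intro hmem
    apply hx
    rw [Metric.mem_closedBall] at hmem ht ⊢
    have h1 : dist x (x - t) = dist t 0 := by simp [dist_eq_norm]
    linarith [dist_triangle x (x - t) x₀]
  · have : b.normed volume t = 0 := by
      apply image_eq_zero_of_notMem_tsupport
      rwa [b.tsupport_normed_eq]
    rw [this, zero_mul]

theorem hasCompactSupport_moll {x₀ : Euc d} {R : ℝ}
    (hf : ∀ x ∉ Metric.closedBall x₀ R, f x = 0) : HasCompactSupport (moll b f) :=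
  HasCompactSupport.intro (isCompact_closedBall x₀ (R + b.rOut)) fun _ hx => moll_eq_zero b hf hx

theorem isTest_moll {x₀ : Euc d} {R : ℝ} (hfi : LocallyIntegrable f volume)
    (hf : ∀ x ∉ Metric.closedBall x₀ R, f x = 0) : IsTest univ (moll b f) :=
  ⟨contDiff_moll b hfi, hasCompactSupport_moll b hf, subset_univ _⟩

theorem integrable_of_memLp_two {x₀ : Euc d} {R : ℝ} (hfm : MemLp f 2 volume)
    (hf : ∀ x ∉ Metric.closedBall x₀ R, f x = 0) : Integrable f volume := by
  have h1 : f = (Metric.closedBall x₀ R).indicator f := by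
    ext x
    by_cases hx : x ∈ Metric.closedBall x₀ R
    · simp [hx]
    · simp [hx, hf x hx]
  rw [h1, integrable_indicator_iff measurableSet_closedBall]
  have : IsFiniteMeasure (volume.restrict (Metric.closedBall x₀ R)) :=
    ⟨by simpa using measure_closedBall_lt_top⟩
  exact (hfm.restrict _).integrable (by norm_num)

theorem integral_moll_mul {φ : Euc d → ℝ} (hfi : Integrable f volume) (hφ : IsTest univ φ) :
    ∫ x, moll b f x * φ x = ∫ t, b.normed volume t * ∫ x, f (x - t) * φ x := by
  obtain ⟨C, hC0, hC⟩ := hφ.exists_bound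
  have h1 : Integrable (fun p : Euc d × Euc d => b.normed volume p.2 * f (p.1 - p.2))
      (volume.prod volume) :=
    Integrable.convolution_integrand (ContinuousLinearMap.lsmul ℝ ℝ)
      (b.contDiff_normed (n := 0).continuous.integrable_of_hasCompactSupport
        b.hasCompactSupport_normed) hfi
  have h2 : Integrable (fun p : Euc d × Euc d => (b.normed volume p.2 * f (p.1 - p.2)) * φ p.1)
      (volume.prod volume) :=
    h1.mul_bdd (c := C) (hφ.continuous.comp continuous_fst).aestronglyMeasurable
      (Eventually.of_forall fun p => hC _)
  calc ∫ x, moll b f x * φ x = ∫ x, ∫ t, (b.normed volume t * f (x - t)) * φ x := by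
        congr 1; ext x
        rw [moll_apply, ← integral_mul_const]
    _ = ∫ t, ∫ x, (b.normed volume t * f (x - t)) * φ x := integral_integral_swap h2
    _ = _ := by
        congr 1; ext t
        rw [← integral_const_mul]
        congr 1; ext x; ring

theorem measurePreserving_sub_right (t : Euc d) :
    MeasurePreserving (fun x : Euc d => x - t) volume volume := by
  simpa [sub_eq_add_neg] using measurePreserving_add_right (volume : Measure (Euc d)) (-t)

theorem abs_integral_normed_mul_le {F : Euc d → ℝ} {C : ℝ}
    (hF : ∀ t ∈ Metric.closedBall (0 : Euc d) b.rOut, |F t| ≤ C) :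
    |∫ t, b.normed volume t * F t| ≤ C := by
  have hi : Integrable (b.normed (volume : Measure (Euc d))) volume :=
    (b.contDiff_normed (n := 0)).continuous.integrable_of_hasCompactSupport
      b.hasCompactSupport_normed
  have h1 : ‖∫ t, b.normed volume t * F t‖ ≤ ∫ t, b.normed volume t * C := by
    refine norm_integral_le_of_norm_le (hi.mul_const C) (Eventually.of_forall fun t => ?_)
    rw [norm_mul, Real.norm_of_nonneg (b.nonneg_normed t)]
    by_cases ht : t ∈ Metric.closedBall (0 : Euc d) b.rOut
    · exact mul_le_mul_of_nonneg_left (hF t ht) (b.nonneg_normed t)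
    · have : b.normed (volume : Measure (Euc d)) t = 0 := by
        apply image_eq_zero_of_notMem_tsupport
        rwa [b.tsupport_normed_eq]
      simp [this]
  rwa [integral_mul_const, b.integral_normed, one_mul] at h1

/-- Mollification does not increase the `L²` norm. -/
theorem l2_moll_le {x₀ : Euc d} {R : ℝ} (hfm : MemLp f 2 volume)
    (hf : ∀ x ∉ Metric.closedBall x₀ R, f x = 0) : l2 volume (moll b f) ≤ l2 volume f := by
  have hfi := integrable_of_memLp_two hfm hf
  have hm : MemLp (moll b f) 2 volume := (isTest_moll b hfi.locallyIntegrable hf).memLp 2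
  have := l2_le_of_forall_test (D := univ) (f := moll b f) isOpen_univ (by simpa using hm)
    (C := l2 volume f) (l2_nonneg _) fun φ hφ => ?_
  · simpa using this
  simp only [Measure.restrict_univ]
  rw [integral_moll_mul b hfi hφ]
  refine abs_integral_normed_mul_le b fun t _ => ?_
  refine (abs_integral_mul_le (hfm.comp_measurePreserving (measurePreserving_sub_right t))
    (hφ.memLp 2)).trans (le_of_eq ?_)
  congr 1
  exact l2_comp_measurePreserving (measurePreserving_sub_right t) hfm

theorem HasWeakGrad.l2_translate_sub_le (hd : 1 ≤ d) (hw : HasWeakGrad univ w q) (t : Euc d) :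
    l2 volume (fun x => w (x - t) - w x) ≤ ‖t‖ * l2 volume q := by
  have he : ‖(EuclideanSpace.single ⟨0, hd⟩ 1 : Euc d)‖ = 1 := by simp
  have hq := hw.memLp_grad
  have := hw.l2_comp_flow_sub_le (τ := -t) isOpen_univ (isGraphFun_const he 0)
    flowInvariant_univ 1
  simp only [flow, Measure.restrict_univ, flowField] at this hq
  simp only [one_smul, sub_self, zero_smul, add_zero, abs_one, one_mul, ← sub_eq_add_neg,
    fderiv_fun_const, Pi.zero_apply, zero_apply] at this
  refine this.trans (l2_le_of_norm_le (norm_nonneg t) hq (Eventually.of_forall fun x => ?_))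
  refine (norm_inner_le_norm _ _).trans ?_
  rw [norm_neg, mul_comm]

/-- The mollification error is controlled by the gradient. -/
theorem HasWeakGrad.l2_moll_sub_le (hd : 1 ≤ d) {x₀ : Euc d} {R : ℝ} (hw : HasWeakGrad univ w q)
    (hw0 : ∀ x ∉ Metric.closedBall x₀ R, w x = 0) :
    l2 volume (fun x => moll b w x - w x) ≤ b.rOut * l2 volume q := by
  have hwm : MemLp w 2 volume := by simpa using hw.memLp
  have hwi := integrable_of_memLp_two hwm hw0
  have hm : MemLp (moll b w) 2 volume := (isTest_moll b hwi.locallyIntegrable hw0).memLp 2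
  have hr := b.rOut_pos.le
  have hq0 : 0 ≤ l2 volume q := l2_nonneg _
  have := l2_le_of_forall_test (D := univ) (f := fun x => moll b w x - w x) isOpen_univ
    (by rw [Measure.restrict_univ]; exact hm.sub hwm) (C := b.rOut * l2 volume q)
    (by positivity) fun φ hφ => ?_
  · simpa using this
  simp only [Measure.restrict_univ]
  have hφm : MemLp φ 2 volume := hφ.memLp 2
  have htm : ∀ t, MemLp (fun x => w (x - t)) 2 volume := fun t =>
    hwm.comp_measurePreserving (measurePreserving_sub_right t)
  have hki : Integrable (b.normed (volume : Measure (Euc d))) volume :=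
    (b.contDiff_normed (n := 0)).continuous.integrable_of_hasCompactSupport
      b.hasCompactSupport_normed
  have e1 : ∫ x, (moll b w x - w x) * φ x =
      ∫ t, b.normed volume t * ∫ x, (w (x - t) - w x) * φ x := by
    have h1 : ∀ t, ∫ x, (w (x - t) - w x) * φ x =
        (∫ x, w (x - t) * φ x) - ∫ x, w x * φ x := by
      intro t
      rw [← integral_sub (integrable_mul_of_memLp (htm t) hφm) (integrable_mul_of_memLp hwm hφm)]
      simp only [sub_mul]
    have h2 : Integrable (fun t => b.normed volume t * ∫ x, w (x - t) * φ x) volume := by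
      have hc : Continuous (fun t => ∫ x, w (x - t) * φ x) := by
        have h3 : (fun t => ∫ x, w (x - t) * φ x) = fun t => ∫ y, w y * φ (y + t) := by
          ext t
          rw [← integral_sub_right_eq_self (fun y => w y * φ (y + t)) t]
          simp
        rw [h3]
        obtain ⟨C, hC0, hC⟩ := hφ.exists_bound
        refine continuous_of_dominated (bound := fun y => ‖w y‖ * C) (fun t => ?_) (fun t => ?_)
          (hwi.norm.mul_const C) (Eventually.of_forall fun y => ?_)
        · exact hwi.1.mul (hφ.continuous.comp (by fun_prop)).aestronglyMeasurable
        · refine Eventually.of_forall fun y => ?_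
          rw [norm_mul]
          gcongr
          exact hC _
        · have := hφ.continuous
          fun_prop
      exact ((b.contDiff_normed (n := 0)).continuous.mul hc).integrable_of_hasCompactSupport
        b.hasCompactSupport_normed.mul_right
    simp only [h1, mul_sub]
    rw [integral_sub h2 (hki.mul_const _), integral_mul_const, b.integral_normed, one_mul,
      ← integral_moll_mul b hwi hφ, ← integral_sub (integrable_mul_of_memLp hm hφm)
      (integrable_mul_of_memLp hwm hφm)]
    simp only [sub_mul]
  rw [e1]
  refine abs_integral_normed_mul_le b fun t ht => ?_
  refine (abs_integral_mul_le ((htm t).sub hwm) hφm).trans ?_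
  gcongr
  · exact l2_nonneg _
  refine (hw.l2_translate_sub_le hd t).trans ?_
  gcongr
  simpa using ht

theorem isTest_normed_sub (x : Euc d) : IsTest univ (fun y => b.normed volume (x - y)) := by
  refine ⟨b.contDiff_normed.comp (contDiff_const.sub contDiff_id), ?_, subset_univ _⟩
  exact b.hasCompactSupport_normed.comp_homeomorph (Homeomorph.subLeft x)

/-- Derivatives of the mollification are mollifications of the weak derivatives. -/
theorem HasWeakGrad.fderiv_moll (hw : HasWeakGrad univ w q) (hwi : LocallyIntegrable w volume)
    (x v : Euc d) : fderiv ℝ (moll b w) x v = moll b (fun y => inner ℝ (q y) v) x := by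
  have hk1 : ContDiff ℝ 1 (b.normed (volume : Measure (Euc d))) := b.contDiff_normed
  have h1 := b.hasCompactSupport_normed.hasFDerivAt_convolution_left
    (ContinuousLinearMap.lsmul ℝ ℝ) hk1 hwi x
  have h2 : fderiv ℝ (moll b w) x = _ := h1.fderiv
  rw [h2, convolution_eq_swap, ContinuousLinearMap.integral_apply]
  · have h3 := hw.integral_eq _ (isTest_normed_sub b x) v
    simp only [Measure.restrict_univ] at h3
    have h4 : ∀ y, fderiv ℝ (fun y => b.normed volume (x - y)) y v =
        - fderiv ℝ (b.normed volume) (x - y) v := by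
      intro y
      have h5 : HasFDerivAt (fun y : Euc d => x - y) (-ContinuousLinearMap.id ℝ (Euc d)) y :=
        (hasFDerivAt_id y).const_sub x
      have h6 := ((hk1.differentiable (by simp)) (x - y)).hasFDerivAt.comp y h5
      have h7 : fderiv ℝ (fun y => b.normed volume (x - y)) y = _ := h6.fderiv
      rw [h7]; simp
    simp only [h4, mul_neg, integral_neg, neg_inj] at h3
    rw [moll_eq_swap]
    calc _ = ∫ y, w y * fderiv ℝ (b.normed volume) (x - y) v := by
          congr 1; ext y
          simp [ContinuousLinearMap.precompL_apply, mul_comm]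
      _ = _ := h3
      _ = _ := by congr 1; ext y; ring
  · have h5 := (HasCompactSupport.convolutionExists_left
      (ContinuousLinearMap.precompL (Euc d) (ContinuousLinearMap.lsmul ℝ ℝ))
      (b.hasCompactSupport_normed.fderiv ℝ) (hk1.continuous_fderiv (by simp)) hwi x).integrable_swap
    exact h5

end Mollify

/-! ### The Sobolev inequality -/

section Sobolev

variable {d : ℕ}

theorem eLpNorm_le_eLpNorm_two_mul {V : Type*} [NormedAddCommGroup V] {f : Euc d → V}
    (hf : AEStronglyMeasurable f volume) {K : Set (Euc d)} (hK : ∀ x ∉ K, f x = 0)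
    {p : ENNReal} (hp : p ≤ 2) :
    eLpNorm f p volume ≤ eLpNorm f 2 volume * volume K ^ (1 / p.toReal - 1 / 2) := by
  have hs : Function.support f ⊆ K := fun x hx => by
    by_contra h
    exact hx (hK x h)
  rw [← eLpNorm_restrict_eq_of_support_subset (p := p) (μ := volume) hs,
    ← eLpNorm_restrict_eq_of_support_subset (p := 2) (μ := volume) hs]
  simpa using eLpNorm_le_eLpNorm_mul_rpow_measure_univ hp hf.restrict (μ := volume.restrict K)

/-- The case of dimension one, where the Gagliardo–Nirenberg–Sobolev inequality does not apply and
the fundamental theorem of calculus bounds the supremum. -/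
theorem eLpNorm_six_le_one_dim (x₀ : Euc 1) (R : ℝ) :
    ∃ C : ENNReal, C ≠ ⊤ ∧ ∀ u : Euc 1 → ℝ, ContDiff ℝ 1 u →
      Function.support u ⊆ Metric.closedBall x₀ R → eLpNorm u 6 volume ≤
        C * eLpNorm (fderiv ℝ u) 2 volume := by
  set K := Metric.closedBall x₀ R
  have hK : volume K ≠ ⊤ := measure_closedBall_lt_top.ne
  refine ⟨volume K ^ (6 : ℝ)⁻¹ * volume K ^ (1 / 1 - 1 / 2 : ℝ), ?_, fun u hu hsupp => ?_⟩
  · exact ENNReal.mul_ne_top (ENNReal.rpow_ne_top_of_nonneg (by norm_num) hK)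
      (ENNReal.rpow_ne_top_of_nonneg (by norm_num) hK)
  have hcs : HasCompactSupport u :=
    HasCompactSupport.of_support_subset_isCompact (isCompact_closedBall x₀ R) hsupp
  have hfs : Function.support (fderiv ℝ u) ⊆ K := by
    refine (support_fderiv_subset ℝ).trans ?_
    exact closure_minimal hsupp Metric.isClosed_closedBall
  have hmp : MeasurePreserving (fun t : ℝ => (WithLp.toLp 2 (fun _ => t) : Euc 1)) volume
      volume := by
    have h1 := (volume_preserving_funUnique (Fin 1) ℝ).symm
    have h2 := (EuclideanSpace.volume_preserving_symm_measurableEquiv_toLp (Fin 1)).symm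
    exact h2.comp h1
  let c : ℝ → Euc 1 := fun t => WithLp.toLp 2 (fun _ => t)
  have hc : ∀ t, c t = t • EuclideanSpace.single 0 1 := by
    intro t; ext i; fin_cases i; simp [c]
  have hcd : ContDiff ℝ 1 c := by
    have : c = fun t => t • EuclideanSpace.single 0 1 := funext hc
    rw [this]
    exact contDiff_id.smul contDiff_const
  have hcder : ∀ t, HasDerivAt c (EuclideanSpace.single 0 1) t := by
    intro t
    have : c = fun t => t • EuclideanSpace.single 0 1 := funext hc
    rw [this]
    simpa using (hasDerivAt_id t).smul_const (EuclideanSpace.single (0 : Fin 1) (1 : ℝ))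
  have hcs' : HasCompactSupport (fun t => u (c t)) := by
    refine HasCompactSupport.of_support_subset_isCompact
      (Metric.isCompact_of_isClosed_isBounded (s := c ⁻¹' K) ?_ ?_) fun t ht => hsupp ht
    · exact Metric.isClosed_closedBall.preimage hcd.continuous
    · have hiso : Isometry c := by
        refine Isometry.of_dist_eq fun s t => ?_
        rw [hc, hc, dist_eq_norm, ← sub_smul, norm_smul]
        simp [Real.dist_eq]
      exact (hiso.antilipschitz.isBounded_preimage Metric.isBounded_closedBall)
  have hsup : ∀ x, ‖u x‖ₑ ≤ eLpNorm (fderiv ℝ u) 1 volume := by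
    intro x
    have hx : x = c (x 0) := by
      ext i; fin_cases i; simp [c]
    rw [hx]
    refine (HasCompactSupport.enorm_le_lintegral_Ici_deriv (f := fun t => u (c t))
      (hu.comp hcd) hcs' (x 0)).trans ?_
    refine (setLIntegral_le_lintegral _ _).trans ?_
    rw [eLpNorm_one_eq_lintegral_enorm,
      ← hmp.lintegral_comp_emb (MeasurableEquiv.measurableEmbedding
        (((MeasurableEquiv.funUnique (Fin 1) ℝ).symm).trans (MeasurableEquiv.toLp 2 (Fin 1 → ℝ))))]
    refine lintegral_mono fun t => ?_
    have h1 := ((hu.differentiable (by simp)) (c t)).hasFDerivAt.comp_hasDerivAt t (hcder t)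
    have h2 : deriv (fun t => u (c t)) t = _ := h1.deriv
    rw [h2, enorm_le_iff_norm_le]
    refine (ContinuousLinearMap.le_opNorm _ _).trans ?_
    simp [c]
  have h1 : eLpNorm (fderiv ℝ u) 1 volume ≤
      eLpNorm (fderiv ℝ u) 2 volume * volume K ^ (1 / 1 - 1 / 2 : ℝ) := by
    simpa using eLpNorm_le_eLpNorm_two_mul (hu.continuous_fderiv (by simp)).aestronglyMeasurable
      (K := K) (fun x hx => by_contra fun h => hx (hfs h)) (p := 1) (by norm_num)
  by_cases htop : eLpNorm (fderiv ℝ u) 1 volume = ⊤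
  · rw [htop, top_le_iff] at h1
    have : eLpNorm (fderiv ℝ u) 2 volume = ⊤ := by
      by_contra hne
      exact ENNReal.mul_ne_top hne (ENNReal.rpow_ne_top_of_nonneg (by norm_num) hK) h1
    exfalso
    exact ((hu.continuous_fderiv (by simp)).memLp_of_hasCompactSupport
      (hcs.fderiv ℝ) (μ := volume) (p := 2)).2.ne this
  have h2 : eLpNorm u 6 volume ≤ volume K ^ (6 : ℝ)⁻¹ * eLpNorm (fderiv ℝ u) 1 volume := by
    rw [← eLpNorm_restrict_eq_of_support_subset hsupp]
    have := eLpNorm_le_of_ae_bound (p := 6) (μ := volume.restrict K) (f := u)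
      (C := (eLpNorm (fderiv ℝ u) 1 volume).toReal) (Eventually.of_forall fun x => by
        have := ENNReal.toReal_mono htop (hsup x)
        simpa using this)
    rw [ENNReal.ofReal_toReal htop] at this
    simpa using this
  calc _ ≤ _ := h2
    _ ≤ volume K ^ (6 : ℝ)⁻¹ *
        (eLpNorm (fderiv ℝ u) 2 volume * volume K ^ (1 / 1 - 1 / 2 : ℝ)) := by gcongr
    _ = _ := by ring

/-- The Gagliardo–Nirenberg–Sobolev inequality in dimension at most three, for functions supported
in a fixed ball. In dimension two it is applied with the exponent `3/2 < 2`. -/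
theorem exists_eLpNorm_six_le (hd1 : 1 ≤ d) (hd3 : d ≤ 3) (x₀ : Euc d) (R : ℝ) :
    ∃ C : ENNReal, C ≠ ⊤ ∧ ∀ u : Euc d → ℝ, ContDiff ℝ 1 u →
      Function.support u ⊆ Metric.closedBall x₀ R → eLpNorm u 6 volume ≤
        C * eLpNorm (fderiv ℝ u) 2 volume := by
  rcases Nat.lt_or_ge d 2 with h | h2
  · obtain rfl : d = 1 := by omega
    exact eLpNorm_six_le_one_dim x₀ R
  set K := Metric.closedBall x₀ R
  have hK : volume K ≠ ⊤ := measure_closedBall_lt_top.ne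
  have key : ∀ p : NNReal, 1 ≤ p → p ≤ 2 → p < d → (p : ℝ)⁻¹ - (d : ℝ)⁻¹ ≤ (6 : ℝ)⁻¹ →
      ∃ C : ENNReal, C ≠ ⊤ ∧ ∀ u : Euc d → ℝ, ContDiff ℝ 1 u →
      Function.support u ⊆ K → eLpNorm u 6 volume ≤ C * eLpNorm (fderiv ℝ u) 2 volume := by
    intro p hp1 hp2 hpd hpq
    have hpos : (0 : ℝ) < p := lt_of_lt_of_le one_pos (by exact_mod_cast hp1)
    refine ⟨eLpNormLESNormFDerivOfLeConst ℝ volume K p 6 *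
      volume K ^ (1 / (p : ℝ) - 1 / 2 : ℝ), ?_, fun u hu hsupp => ?_⟩
    · refine ENNReal.mul_ne_top ENNReal.coe_ne_top (ENNReal.rpow_ne_top_of_nonneg ?_ hK)
      have : (p : ℝ) ≤ 2 := by exact_mod_cast hp2
      have := one_div_le_one_div_of_le hpos this
      linarith
    have hfs : Function.support (fderiv ℝ u) ⊆ K :=
      (support_fderiv_subset ℝ).trans (closure_minimal hsupp Metric.isClosed_closedBall)
    have h1 := eLpNorm_le_eLpNorm_fderiv_of_le (μ := volume) hu hsupp (p := p) (q := 6) hp1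
      (by simpa using hpd) (by simpa using hpq) Metric.isBounded_closedBall
    have h2 : eLpNorm (fderiv ℝ u) p volume ≤
        eLpNorm (fderiv ℝ u) 2 volume * volume K ^ (1 / (p : ℝ) - 1 / 2 : ℝ) := by
      simpa using eLpNorm_le_eLpNorm_two_mul (hu.continuous_fderiv (by simp)).aestronglyMeasurable
        (K := K) (fun x hx => by_contra fun h => hx (hfs h)) (p := p) (by exact_mod_cast hp2)
    calc eLpNorm u 6 volume ≤ _ := by simpa using h1
      _ ≤ eLpNormLESNormFDerivOfLeConst ℝ volume K p 6 *
        (eLpNorm (fderiv ℝ u) 2 volume * volume K ^ (1 / (p : ℝ) - 1 / 2 : ℝ)) := by gcongr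
      _ = _ := by ring
  have h23 : d = 2 ∨ d = 3 := by omega
  rcases h23 with rfl | rfl
  · refine key (3 / 2) ?_ ?_ ?_ ?_
    · rw [← NNReal.coe_le_coe]; push_cast; norm_num
    · rw [← NNReal.coe_le_coe]; push_cast; norm_num
    · rw [← NNReal.coe_lt_coe]; push_cast; norm_num
    · push_cast; norm_num
  · refine key 2 ?_ ?_ ?_ ?_
    · norm_num
    · norm_num
    · norm_num
    · push_cast; norm_num

/-- Compactly supported `H¹` functions on `ℝ^d`, `d ≤ 3`, are in `L⁶`. -/
theorem HasWeakGrad.memLp_six_of_compact (hd1 : 1 ≤ d) (hd3 : d ≤ 3) {w : Euc d → ℝ}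
    {q : Euc d → Euc d} (hw : HasWeakGrad univ w q) {x₀ : Euc d} {R : ℝ}
    (h0 : ∀ x ∉ Metric.closedBall x₀ R, w x = 0 ∧ q x = 0) : MemLp w 6 volume := by
  have hwm : MemLp w 2 volume := by simpa using hw.memLp
  have hqm : MemLp q 2 volume := by simpa using hw.memLp_grad
  have hw0 : ∀ x ∉ Metric.closedBall x₀ R, w x = 0 := fun x hx => (h0 x hx).1
  have hwi := (integrable_of_memLp_two hwm hw0).locallyIntegrable
  let b : ℕ → ContDiffBump (0 : Euc d) := fun n => stdBump d (1 / ((n : ℝ) + 1)) (by positivity)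
  have hb1 : ∀ n, (b n).rOut ≤ 1 := by
    intro n
    change 1 / ((n : ℝ) + 1) ≤ 1
    rw [div_le_one (by positivity)]
    linarith [(Nat.cast_nonneg n : (0 : ℝ) ≤ n)]
  obtain ⟨C, hC, hGNS⟩ := exists_eLpNorm_six_le hd1 hd3 x₀ (R + 1)
  refine ⟨hwm.1, ?_⟩
  -- the gradients of the mollifications are bounded
  have hbound : ∀ n, eLpNorm (fderiv ℝ (moll (b n) w)) 2 volume ≤
      ∑ i : Fin d, eLpNorm (fun x => inner ℝ (q x) (EuclideanSpace.single i 1)) 2 volume := by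
    intro n
    let v : Fin d → Euc d := fun i => EuclideanSpace.single i 1
    have h1 : ∀ x, ‖fderiv ℝ (moll (b n) w) x‖ ≤
        ∑ i, ‖moll (b n) (fun y => inner ℝ (q y) (v i)) x‖ := by
      intro x
      refine ContinuousLinearMap.opNorm_le_bound _ (by positivity) fun y => ?_
      have hy : y = ∑ i, y i • v i := by
        have := (EuclideanSpace.basisFun (Fin d) ℝ).sum_repr y
        simpa using this.symm
      conv_lhs => rw [hy, map_sum]
      refine (norm_sum_le _ _).trans ?_
      rw [Finset.sum_mul]
      refine Finset.sum_le_sum fun i _ => ?_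
      rw [map_smul, norm_smul, hw.fderiv_moll (b n) hwi, mul_comm]
      gcongr
      exact PiLp.norm_apply_le y i
    have hfm : ∀ i, MemLp (fun x => inner ℝ (q x) (v i)) 2 volume := fun i =>
      memLp_inner_const hqm (v i)
    have hf0 : ∀ i, ∀ x ∉ Metric.closedBall x₀ R, inner ℝ (q x) (v i) = 0 := fun i x hx => by
      rw [(h0 x hx).2, inner_zero_left]
    have hmm : ∀ i, MemLp (moll (b n) (fun y => inner ℝ (q y) (v i))) 2 volume := fun i =>
      (isTest_moll (b n) (integrable_of_memLp_two (hfm i) (hf0 i)).locallyIntegrable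
        (hf0 i)).memLp 2
    calc eLpNorm (fderiv ℝ (moll (b n) w)) 2 volume
        ≤ eLpNorm (fun x => ∑ i, ‖moll (b n) (fun y => inner ℝ (q y) (v i)) x‖) 2 volume :=
          eLpNorm_mono_real h1
      _ ≤ ∑ i, eLpNorm (fun x => ‖moll (b n) (fun y => inner ℝ (q y) (v i)) x‖) 2 volume := by
          have := eLpNorm_sum_le (p := 2) (μ := volume) (s := Finset.univ)
            (f := fun i x => ‖moll (b n) (fun y => inner ℝ (q y) (v i)) x‖)
            (fun i _ => (hmm i).1.norm) (by norm_num)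
          refine le_trans (le_of_eq ?_) this
          congr 1; ext x; simp
      _ ≤ _ := by
          refine Finset.sum_le_sum fun i _ => ?_
          rw [eLpNorm_norm]
          have := l2_moll_le (b n) (hfm i) (hf0 i)
          rwa [l2, l2, ENNReal.toReal_le_toReal (hmm i).2.ne (hfm i).2.ne] at this
  have hlim : ∀ᵐ x ∂(volume : Measure (Euc d)),
      Tendsto (fun n => moll (b n) w x) atTop (𝓝 (w x)) := by
    refine ContDiffBump.ae_convolution_tendsto_right_of_locallyIntegrable (K := 2) ?_
      (Eventually.of_forall fun n => ?_) hwi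
    · exact tendsto_one_div_add_atTop_nhds_zero_nat
    · change 1 / ((n : ℝ) + 1) ≤ 2 * (1 / ((n : ℝ) + 1) / 2)
      linarith
  refine (Lp.eLpNorm_lim_le_liminf_eLpNorm
    (fun n => (contDiff_moll (b n) hwi).continuous.aestronglyMeasurable) w hlim).trans_lt ?_
  refine lt_of_le_of_lt (b := C * ∑ i : Fin d,
    eLpNorm (fun x => inner ℝ (q x) (EuclideanSpace.single i 1)) 2 volume) ?_ ?_
  · refine liminf_le_of_frequently_le' (Frequently.of_forall fun n => ?_)
    refine (hGNS _ ((contDiff_moll (b n) hwi).of_le (by simp)) ?_).trans (by gcongr; exact hbound n)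
    intro x hx
    by_contra hx'
    refine hx (moll_eq_zero (b n) hw0 fun hmem => hx' ?_)
    exact Metric.closedBall_subset_closedBall (by linarith [hb1 n]) hmem
  · refine ENNReal.mul_lt_top hC.lt_top (ENNReal.sum_lt_top.2 fun i _ => ?_)
    exact (memLp_inner_const hqm _).2

/-- **Sobolev embedding** `H¹(Ω) ⊆ L⁶(Ω)` for smooth bounded domains in dimension at most three. -/
theorem HasWeakGrad.memLp_six {Ω : Set (Euc d)} (hd1 : 1 ≤ d) (hd3 : d ≤ 3)
    (hΩ : IsSmoothBoundedDomain Ω) {u : Euc d → ℝ} {g : Euc d → Euc d}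
    (hu : HasWeakGrad Ω u g) : MemLp u 6 (volume.restrict Ω) := by
  have hcomp : IsCompact (closure Ω) := hΩ.isBounded.isCompact_closure
  have key : eLpNorm u 6 (volume.restrict (Ω ∩ closure Ω)) < ⊤ := by
    refine hcomp.induction_on (p := fun s => eLpNorm u 6 (volume.restrict (Ω ∩ s)) < ⊤) ?_ ?_ ?_ ?_
    · simp
    · intro s t hst ht
      exact (eLpNorm_mono_measure u (Measure.restrict_mono
        (inter_subset_inter_right _ hst) le_rfl)).trans_lt ht
    · intro s t hs ht
      rw [inter_union_distrib_left]
      refine (eLpNorm_mono_measure u (Measure.restrict_union_le _ _)).trans_lt ?_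
      rw [eLpNorm_lt_top_iff_lintegral_rpow_enorm_lt_top (by norm_num) (by norm_num)] at hs ht ⊢
      rw [lintegral_add_measure]
      exact ENNReal.add_lt_top.2 ⟨hs, ht⟩
    · intro x₀ hx₀
      obtain ⟨r, R, C, T, hr, -, hT, -, hgrad⟩ := hΩ.exists_extension hd1 hx₀
      refine ⟨Metric.ball x₀ r, mem_nhdsWithin_of_mem_nhds (Metric.ball_mem_nhds _ hr), ?_⟩
      obtain ⟨q, hq, h0, -⟩ := hgrad u g hu
      have h1 := hq.memLp_six_of_compact hd1 hd3 h0
      have h2 : eLpNorm u 6 (volume.restrict (Ω ∩ Metric.ball x₀ r)) =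
          eLpNorm (T u) 6 (volume.restrict (Ω ∩ Metric.ball x₀ r)) := by
        refine eLpNorm_congr_ae ((ae_restrict_iff' (hΩ.isOpen.inter
          Metric.isOpen_ball).measurableSet).2 (Eventually.of_forall fun x hx => ?_))
        exact (hT u x hx).symm
      rw [h2]
      exact (h1.restrict _).2
  rw [inter_eq_left.2 subset_closure] at key
  exact ⟨hu.memLp.1, key⟩

end Sobolev

/-! ### The Rellich theorem and the Poincaré inequality -/

section Rellich

variable {d : ℕ}

/-- Mollifications turn weak convergence into strong convergence. -/
theorem tendsto_l2_moll (b : ContDiffBump (0 : Euc d)) {w : ℕ → Euc d → ℝ} {x₀ : Euc d} {R C : ℝ}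
    (hw : ∀ n, MemLp (w n) 2 volume) (hC : ∀ n, l2 volume (w n) ≤ C)
    (h0 : ∀ n, ∀ x ∉ Metric.closedBall x₀ R, w n x = 0)
    (hlim : ∀ ρ, MemLp ρ 2 volume → Tendsto (fun n => ∫ x, w n x * ρ x) atTop (𝓝 0)) :
    Tendsto (fun n => l2 volume (moll b (w n))) atTop (𝓝 0) := by
  have hk : ∀ x, IsTest univ (fun y => b.normed volume (x - y)) := isTest_normed_sub b
  have hkm : MemLp (b.normed (volume : Measure (Euc d))) 2 volume :=
    (b.contDiff_normed (n := 0)).continuous.memLp_of_hasCompactSupport b.hasCompactSupport_normed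
  have heq : ∀ n x, moll b (w n) x = ∫ y, w n y * b.normed volume (x - y) := by
    intro n x
    rw [moll_eq_swap]
    congr 1; ext y; ring
  have hpt : ∀ x, Tendsto (fun n => moll b (w n) x) atTop (𝓝 0) := by
    intro x
    simp only [heq]
    exact hlim _ ((hk x).memLp 2)
  have hC0 : 0 ≤ C := (l2_nonneg _).trans (hC 0)
  set A := C * l2 volume (b.normed (volume : Measure (Euc d)))
  have hA : 0 ≤ A := mul_nonneg hC0 (l2_nonneg _)
  have hbd : ∀ n x, |moll b (w n) x| ≤ A := by
    intro n x
    rw [heq]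
    refine (abs_integral_mul_le (hw n) ((hk x).memLp 2)).trans ?_
    have h1 : l2 volume (fun y => b.normed volume (x - y)) =
        l2 volume (b.normed (volume : Measure (Euc d))) :=
      l2_comp_measurePreserving (Measure.measurePreserving_sub_left volume x) hkm
    rw [h1]
    exact mul_le_mul_of_nonneg_right (hC n) (l2_nonneg _)
  have hmt : ∀ n, IsTest univ (moll b (w n)) := fun n =>
    isTest_moll b (integrable_of_memLp_two (hw n) (h0 n)).locallyIntegrable (h0 n)
  have hsq : Tendsto (fun n => ∫ x, ‖moll b (w n) x‖ ^ 2) atTop (𝓝 0) := by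
    rw [← integral_zero (Euc d) ℝ (μ := volume)]
    set K := Metric.closedBall x₀ (R + b.rOut)
    refine tendsto_integral_of_dominated_convergence (K.indicator fun _ => A ^ 2)
      (fun n => ((hmt n).continuous.norm.pow 2).aestronglyMeasurable) ?_
      (fun n => Eventually.of_forall fun x => ?_) (Eventually.of_forall fun x => ?_)
    · rw [integrable_indicator_iff measurableSet_closedBall]
      exact integrableOn_const measure_closedBall_lt_top.ne
    · by_cases hx : x ∈ K
      · rw [indicator_of_mem hx, norm_pow, norm_norm]
        exact pow_le_pow_left₀ (norm_nonneg _) (hbd n x) 2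
      · rw [moll_eq_zero b (h0 n) hx, indicator_of_notMem hx]
        simp
    · have := ((hpt x).norm.pow 2)
      simpa using this
  have h2 : ∀ n, l2 volume (moll b (w n)) = Real.sqrt (∫ x, ‖moll b (w n) x‖ ^ 2) := by
    intro n
    rw [← l2_sq ((hmt n).memLp 2), Real.sqrt_sq (l2_nonneg _)]
  simp only [h2]
  have h3 := (Real.continuous_sqrt.tendsto 0).comp hsq
  rw [Real.sqrt_zero] at h3
  exact h3

/-- Compactness of bounded sequences in `H¹(ℝ^d)` with supports in a fixed ball. -/
theorem tendsto_l2_of_weak (hd : 1 ≤ d) {w : ℕ → Euc d → ℝ} {q : ℕ → Euc d → Euc d} {x₀ : Euc d}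
    {R C : ℝ} (hw : ∀ n, HasWeakGrad univ (w n) (q n)) (hC : ∀ n, l2 volume (w n) ≤ C)
    (hC' : ∀ n, l2 volume (q n) ≤ C) (h0 : ∀ n, ∀ x ∉ Metric.closedBall x₀ R, w n x = 0)
    (hlim : ∀ ρ, MemLp ρ 2 volume → Tendsto (fun n => ∫ x, w n x * ρ x) atTop (𝓝 0)) :
    Tendsto (fun n => l2 volume (w n)) atTop (𝓝 0) := by
  have hwm : ∀ n, MemLp (w n) 2 volume := fun n => by simpa using (hw n).memLp
  have hC0 : 0 ≤ C := (l2_nonneg _).trans (hC 0)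
  rw [Metric.tendsto_atTop]
  intro ε hε
  let b := stdBump d (ε / (2 * (C + 1))) (by positivity)
  obtain ⟨N, hN⟩ := Metric.tendsto_atTop.1 (tendsto_l2_moll b hwm hC h0 hlim) (ε / 2)
    (by positivity)
  refine ⟨N, fun n hn => ?_⟩
  have h1 := hN n hn
  rw [Real.dist_0_eq_abs, abs_of_nonneg (l2_nonneg _)] at h1 ⊢
  have h2 := (hw n).l2_moll_sub_le b hd (h0 n)
  have hm : MemLp (moll b (w n)) 2 volume :=
    (isTest_moll b (integrable_of_memLp_two (hwm n) (h0 n)).locallyIntegrable (h0 n)).memLp 2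
  have h3 : l2 volume (w n) ≤ l2 volume (moll b (w n)) +
      l2 volume (fun x => moll b (w n) x - w n x) := by
    have h4 := l2_sub_le hm (hm.sub (hwm n))
    have h5 : (fun x => moll b (w n) x - (moll b (w n) - w n) x) = w n := by
      funext x
      simp
    rw [h5] at h4
    exact h4
  have h4 : b.rOut * l2 volume (q n) ≤ ε / 2 := by
    have : b.rOut = ε / (2 * (C + 1)) := rfl
    rw [this]
    calc _ ≤ ε / (2 * (C + 1)) * C := by gcongr; exact hC' n
      _ ≤ ε / 2 := by
        rw [div_mul_eq_mul_div, div_le_div_iff₀ (by positivity) (by positivity)]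
        nlinarith
  linarith

theorem l2_restrict_union_le {A B : Set (Euc d)} {f : Euc d → ℝ}
    (hA : MemLp f 2 (volume.restrict A)) (hB : MemLp f 2 (volume.restrict B)) :
    l2 (volume.restrict (A ∪ B)) f ≤ l2 (volume.restrict A) f + l2 (volume.restrict B) f := by
  have hle := Measure.restrict_union_le (μ := (volume : Measure (Euc d))) A B
  have i1 := integrable_norm_sq hA
  have i2 := integrable_norm_sq hB
  have hm : MemLp f 2 (volume.restrict (A ∪ B)) := by
    refine ⟨(aestronglyMeasurable_union_iff).2 ⟨hA.1, hB.1⟩,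
      (eLpNorm_mono_measure f hle).trans_lt ?_⟩
    have h1 := hA.2
    have h2 := hB.2
    rw [eLpNorm_lt_top_iff_lintegral_rpow_enorm_lt_top (by norm_num) (by norm_num)] at h1 h2 ⊢
    rw [lintegral_add_measure]
    exact ENNReal.add_lt_top.2 ⟨h1, h2⟩
  have n1 := l2_nonneg (μ := volume.restrict A) f
  have n2 := l2_nonneg (μ := volume.restrict B) f
  rw [l2_le_iff_sq hm (by positivity)]
  calc _ ≤ ∫ x, ‖f x‖ ^ 2 ∂(volume.restrict A + volume.restrict B) :=
        integral_mono_measure hle (Eventually.of_forall fun x => by positivity)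
          (i1.add_measure i2)
    _ = l2 (volume.restrict A) f ^ 2 + l2 (volume.restrict B) f ^ 2 := by
        rw [integral_add_measure i1 i2, l2_sq hA, l2_sq hB]
    _ ≤ _ := by nlinarith

variable {Ω : Set (Euc d)}

/-- Bounded weak null sequences in `H¹(Ω)` converge to zero in `L²(Ω)`. -/
theorem IsSmoothBoundedDomain.tendsto_l2_of_weak (hd : 1 ≤ d) (hΩ : IsSmoothBoundedDomain Ω)
    {z : ℕ → Euc d → ℝ} {g : ℕ → Euc d → Euc d} {C : ℝ} (hz : ∀ n, HasWeakGrad Ω (z n) (g n))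
    (hC : ∀ n, l2 (volume.restrict Ω) (z n) + l2 (volume.restrict Ω) (g n) ≤ C)
    (hlim : ∀ ρ, MemLp ρ 2 (volume.restrict Ω) →
      Tendsto (fun n => ∫ x in Ω, z n x * ρ x) atTop (𝓝 0)) :
    Tendsto (fun n => l2 (volume.restrict Ω) (z n)) atTop (𝓝 0) := by
  have hcomp : IsCompact (closure Ω) := hΩ.isBounded.isCompact_closure
  have hmono : ∀ n (s : Set (Euc d)), MemLp (z n) 2 (volume.restrict (Ω ∩ s)) := fun n s =>
    (hz n).memLp.mono_measure (Measure.restrict_mono inter_subset_left le_rfl)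
  have key : Tendsto (fun n => l2 (volume.restrict (Ω ∩ closure Ω)) (z n)) atTop (𝓝 0) := by
    refine hcomp.induction_on
      (p := fun s => Tendsto (fun n => l2 (volume.restrict (Ω ∩ s)) (z n)) atTop (𝓝 0)) ?_ ?_ ?_ ?_
    · simp [l2]
    · intro s t hst ht
      exact squeeze_zero (fun n => l2_nonneg _) (fun n => l2_mono_measure
        (Measure.restrict_mono (inter_subset_inter_right _ hst) le_rfl) (hmono n t)) ht
    · intro s t hs ht
      rw [inter_union_distrib_left]
      exact squeeze_zero (fun n => l2_nonneg _)
        (fun n => l2_restrict_union_le (hmono n s) (hmono n t)) (by simpa using hs.add ht)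
    · intro x₀ hx₀
      obtain ⟨r, R, C', T, hr, hC', hT, hdual, hgrad⟩ := hΩ.exists_extension hd hx₀
      refine ⟨Metric.ball x₀ r, mem_nhdsWithin_of_mem_nhds (Metric.ball_mem_nhds _ hr), ?_⟩
      choose q hq h0 h1 h2 using fun n => hgrad (z n) (g n) (hz n)
      have hb : ∀ n, C' * (l2 (volume.restrict Ω) (z n) + l2 (volume.restrict Ω) (g n)) ≤ C' * C :=
        fun n => mul_le_mul_of_nonneg_left (hC n) hC'
      have hlim' := PhaseField.tendsto_l2_of_weak hd hq (fun n => (h1 n).trans (hb n))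
        (fun n => (h2 n).trans (hb n)) (fun n x hx => (h0 n x hx).1) (fun ρ hρ => by
          obtain ⟨ρ', hρ', he⟩ := hdual ρ hρ
          refine (hlim ρ' hρ').congr fun n => ?_
          rw [he _ (hz n).memLp])
      refine squeeze_zero (fun n => l2_nonneg _) (fun n => ?_) hlim'
      have e : l2 (volume.restrict (Ω ∩ Metric.ball x₀ r)) (z n) =
          l2 (volume.restrict (Ω ∩ Metric.ball x₀ r)) (T (z n)) := by
        refine l2_congr ((ae_restrict_iff' (hΩ.isOpen.inter
          Metric.isOpen_ball).measurableSet).2 (Eventually.of_forall fun x hx => ?_))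
        exact (hT (z n) x hx).symm
      rw [e]
      exact l2_mono_measure Measure.restrict_le_self (by simpa using (hq n).memLp)
  rwa [inter_eq_left.2 subset_closure] at key

theorem inner_eq_sum (x y : Euc d) : inner ℝ x y = ∑ i, x i * y i := by
  rw [PiLp.inner_apply]
  refine Finset.sum_congr rfl fun i _ => ?_
  simp [mul_comm]

theorem memLp_apply {f : Euc d → Euc d} {μ : Measure (Euc d)} (hf : MemLp f 2 μ) (i : Fin d) :
    MemLp (fun x => f x i) 2 μ := by
  simpa [EuclideanSpace.inner_single_right] using memLp_inner_const hf (EuclideanSpace.single i 1)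

/-- **Rellich's theorem**: a bounded sequence in `H¹(Ω)` has a subsequence that converges in `L²(Ω)`
and whose gradients converge weakly. -/
theorem IsSmoothBoundedDomain.rellich (hd : 1 ≤ d) (hΩ : IsSmoothBoundedDomain Ω)
    {u : ℕ → Euc d → ℝ} {g : ℕ → Euc d → Euc d} {C : ℝ} (hu : ∀ n, HasWeakGrad Ω (u n) (g n))
    (hC : ∀ n, l2 (volume.restrict Ω) (u n) ≤ C) (hC' : ∀ n, l2 (volume.restrict Ω) (g n) ≤ C) :
    ∃ (k : ℕ → ℕ) (v : Euc d → ℝ) (p : Euc d → Euc d), StrictMono k ∧ HasWeakGrad Ω v p ∧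
      Tendsto (fun n => l2 (volume.restrict Ω) (fun x => u (k n) x - v x)) atTop (𝓝 0) ∧
      ∀ f : Euc d → Euc d, MemLp f 2 (volume.restrict Ω) →
        Tendsto (fun n => ∫ x in Ω, inner ℝ (g (k n) x - p x) (f x)) atTop (𝓝 0) := by
  obtain ⟨k, v, hk, hv, hweak⟩ := exists_weak_subseq (fun n => (hu n).memLp) hC
  obtain ⟨p, hp⟩ := hasWeakGrad_of_weak_limit (fun n => hu (k n)) (fun n => hC' (k n)) hv
    (fun φ hφ => hweak φ (hφ.memLp 2))
  have hz : ∀ n, HasWeakGrad Ω (fun x => u (k n) x - v x) (fun x => g (k n) x - p x) := fun n =>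
    (hu (k n)).sub hp
  have hb1 : ∀ n, l2 (volume.restrict Ω) (fun x => u (k n) x - v x) ≤
      C + l2 (volume.restrict Ω) v := fun n =>
    (l2_sub_le (hu _).memLp hv).trans (by gcongr; exact hC _)
  have hb2 : ∀ n, l2 (volume.restrict Ω) (fun x => g (k n) x - p x) ≤
      C + l2 (volume.restrict Ω) p := fun n =>
    (l2_sub_le (hu _).memLp_grad hp.memLp_grad).trans (by gcongr; exact hC' _)
  have hw0 : ∀ ρ, MemLp ρ 2 (volume.restrict Ω) →
      Tendsto (fun n => ∫ x in Ω, (u (k n) x - v x) * ρ x) atTop (𝓝 0) := by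
    intro ρ hρ
    have := (hweak ρ hρ).sub_const (∫ x in Ω, v x * ρ x)
    rw [sub_self] at this
    refine this.congr fun n => ?_
    rw [← integral_sub (integrable_mul_of_memLp (hu _).memLp hρ) (integrable_mul_of_memLp hv hρ)]
    simp only [sub_mul]
  refine ⟨k, v, p, hk, hp, hΩ.tendsto_l2_of_weak hd hz (fun n => add_le_add (hb1 n) (hb2 n)) hw0,
    fun f hf => ?_⟩
  have hcomp : ∀ i, Tendsto (fun n => ∫ x in Ω, (g (k n) x - p x) i * f x i) atTop (𝓝 0) := by
    intro i
    refine tendsto_integral_of_forall_test hΩ.isOpen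
      (f := fun n x => (g (k n) x - p x) i) (C := C + l2 (volume.restrict Ω) p)
      (fun n => memLp_apply (hz n).memLp_grad i)
      (fun n => (l2_mono (hz n).memLp_grad (Eventually.of_forall fun x =>
        PiLp.norm_apply_le _ i)).trans (hb2 n)) (fun φ hφ => ?_) (memLp_apply hf i)
    have h1 := (hw0 _ ((hφ.dirDeriv (EuclideanSpace.single i 1)).memLp 2)).neg
    rw [neg_zero] at h1
    refine h1.congr fun n => ?_
    rw [(hz n).integral_eq φ hφ, neg_neg]
    simp [EuclideanSpace.inner_single_right]
  have hsum := tendsto_finsetSum Finset.univ fun i _ => hcomp i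
  simp only [Finset.sum_const_zero] at hsum
  refine hsum.congr fun n => ?_
  rw [← integral_finsetSum _ fun i _ =>
    integrable_mul_of_memLp (memLp_apply (hz n).memLp_grad i) (memLp_apply hf i)]
  simp only [inner_eq_sum]

/-- A function with vanishing weak gradient is locally constant. -/
theorem HasWeakGrad.exists_const_near (hΩo : IsOpen Ω) {u : Euc d → ℝ}
    (hu : HasWeakGrad Ω u (fun _ => 0)) {x₀ : Euc d} (hx₀ : x₀ ∈ Ω) :
    ∃ c r, 0 < r ∧ ∀ᵐ x, x ∈ Metric.ball x₀ r → u x = c := by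
  obtain ⟨r, hr, hball⟩ := Metric.isOpen_iff.1 hΩo x₀ hx₀
  obtain ⟨ζ, hζ, hζ1⟩ := exists_test_eq_one x₀ hr
  have hw : HasWeakGrad univ (fun x => ζ x * u x)
      (fun x => ζ x • (0 : Euc d) + u x • gradient ζ x) :=
    hu.mul_test (B := Metric.ball x₀ r) measurableSet_ball
      (by rw [inter_eq_right.2 hball, univ_inter]) hζ
  set w : Euc d → ℝ := fun x => ζ x * u x
  have hw0 : ∀ x ∉ Metric.closedBall x₀ r, w x = 0 := fun x hx => by
    simp [w, hζ.eq_zero fun h => hx (Metric.ball_subset_closedBall h)]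
  have hwi : LocallyIntegrable w volume :=
    (integrable_of_memLp_two (by simpa using hw.memLp) hw0).locallyIntegrable
  have hgrad0 : ∀ x ∈ Metric.ball x₀ (r / 2), gradient ζ x = 0 := by
    intro x hx
    have : ζ =ᶠ[𝓝 x] fun _ => 1 := by
      filter_upwards [Metric.isOpen_ball.mem_nhds hx] with y hy
      exact hζ1 y hy
    simp [gradient, this.fderiv_eq]
  let b : ℕ → ContDiffBump (0 : Euc d) := fun n => stdBump d (1 / ((n : ℝ) + 1)) (by positivity)
  have hrOut : Tendsto (fun n => (b n).rOut) atTop (𝓝 0) := tendsto_one_div_add_atTop_nhds_zero_nat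
  have hlim : ∀ᵐ x ∂(volume : Measure (Euc d)),
      Tendsto (fun n => moll (b n) w x) atTop (𝓝 (w x)) := by
    refine ContDiffBump.ae_convolution_tendsto_right_of_locallyIntegrable (K := 2) hrOut
      (Eventually.of_forall fun n => ?_) hwi
    change 1 / ((n : ℝ) + 1) ≤ 2 * (1 / ((n : ℝ) + 1) / 2)
    linarith
  -- the mollifications are constant near `x₀`
  have hconst : ∀ᶠ n in atTop, ∀ x ∈ Metric.ball x₀ (r / 4), ∀ y ∈ Metric.ball x₀ (r / 4),
      moll (b n) w x = moll (b n) w y := by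
    filter_upwards [hrOut.eventually (gt_mem_nhds (show (0 : ℝ) < r / 4 by positivity))] with n hn
    have hder : ∀ x ∈ Metric.ball x₀ (r / 4), fderiv ℝ (moll (b n) w) x = 0 := by
      intro x hx
      ext v
      rw [hw.fderiv_moll (b n) hwi, moll_apply, zero_apply, ← integral_zero (Euc d) ℝ]
      congr 1; ext t
      by_cases ht : t ∈ Metric.closedBall (0 : Euc d) (b n).rOut
      · have : x - t ∈ Metric.ball x₀ (r / 2) := by
          rw [Metric.mem_ball] at hx ⊢
          rw [Metric.mem_closedBall] at ht
          have h1 : dist (x - t) x = dist t 0 := by simp [dist_eq_norm]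
          linarith [dist_triangle (x - t) x x₀]
        simp [hgrad0 _ this]
      · have : (b n).normed volume t = 0 := by
          apply image_eq_zero_of_notMem_tsupport
          rwa [(b n).tsupport_normed_eq]
        rw [this, zero_mul]
    intro x hx y hy
    have hdiff : Differentiable ℝ (moll (b n) w) :=
      (contDiff_moll (b n) hwi).differentiable (by simp)
    have := Convex.norm_image_sub_le_of_norm_fderiv_le (𝕜 := ℝ) (f := moll (b n) w) (C := 0)
      (s := Metric.ball x₀ (r / 4)) (fun x _ => hdiff x) (fun x hx => by rw [hder x hx, norm_zero])
      (convex_ball _ _) hy hx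
    rw [zero_mul, norm_le_zero_iff, sub_eq_zero] at this
    exact this
  -- a point near `x₀` where the mollifications converge
  obtain ⟨x₁, hx₁, hx₁lim⟩ : ∃ x₁ ∈ Metric.ball x₀ (r / 4),
      Tendsto (fun n => moll (b n) w x₁) atTop (𝓝 (w x₁)) := by
    by_contra! hcon
    have h1 : Metric.ball x₀ (r / 4) ⊆
        {x | ¬ Tendsto (fun n => moll (b n) w x) atTop (𝓝 (w x))} := fun x hx => hcon x hx
    have h2 := measure_mono_null h1 hlim
    exact (Metric.measure_ball_pos volume x₀ (by positivity : 0 < r / 4)).ne' h2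
  refine ⟨w x₁, r / 4, by positivity, ?_⟩
  filter_upwards [hlim] with x hx hxb
  have h1 : w x = w x₁ := by
    refine tendsto_nhds_unique hx (hx₁lim.congr' ?_)
    filter_upwards [hconst] with n hn
    exact hn x₁ hx₁ x hxb
  rw [← h1]
  have : ζ x = 1 := hζ1 x (Metric.ball_subset_ball (by linarith) hxb)
  simp [w, this]

/-- On a connected open set, a function with vanishing weak gradient is constant. -/
theorem HasWeakGrad.ae_eq_const (hΩo : IsOpen Ω) (hΩc : IsConnected Ω) {u : Euc d → ℝ}
    (hu : HasWeakGrad Ω u (fun _ => 0)) : ∃ c, ∀ᵐ x ∂(volume.restrict Ω), u x = c := by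
  choose! c r hr hc using fun x (hx : x ∈ Ω) => hu.exists_const_near hΩo hx
  have hloc : ∀ x ∈ Ω, ∀ᶠ y in 𝓝[Ω] x, c x = c y := by
    intro x hx
    filter_upwards [self_mem_nhdsWithin,
      mem_nhdsWithin_of_mem_nhds (Metric.ball_mem_nhds x (hr x hx))] with y hy hyx
    have hopen : IsOpen (Metric.ball x (r x) ∩ Metric.ball y (r y)) :=
      Metric.isOpen_ball.inter Metric.isOpen_ball
    have hpos : 0 < volume (Metric.ball x (r x) ∩ Metric.ball y (r y)) :=
      hopen.measure_pos volume ⟨y, hyx, Metric.mem_ball_self (hr y hy)⟩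
    by_contra hne
    refine hpos.ne' (measure_mono_null (fun z hz => ?_)
      (show volume {z | ¬ ((z ∈ Metric.ball x (r x) → u z = c x) ∧
        (z ∈ Metric.ball y (r y) → u z = c y))} = 0 from (hc x hx).and (hc y hy)))
    rintro ⟨h1, h2⟩
    exact hne ((h1 hz.1).symm.trans (h2 hz.2))
  obtain ⟨x₀, hx₀⟩ := hΩc.nonempty
  have hall : ∀ y ∈ Ω, c x₀ = c y := fun y hy =>
    hΩc.isPreconnected.induction₂ (fun x y => c x = c y) hloc
      (fun x y z _ _ _ h1 h2 => h1.trans h2) (fun x y _ _ h => h.symm) hx₀ hy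
  refine ⟨c x₀, (ae_restrict_iff' hΩo.measurableSet).2 ?_⟩
  change volume {x | ¬ (x ∈ Ω → u x = c x₀)} = 0
  refine measure_null_of_locally_null _ fun x hx => ?_
  have hxΩ : x ∈ Ω := by
    by_contra h
    exact hx fun h' => absurd h' h
  refine ⟨{x' | ¬ (x' ∈ Ω → u x' = c x₀)} ∩ Metric.ball x (r x), inter_mem self_mem_nhdsWithin
    (mem_nhdsWithin_of_mem_nhds (Metric.ball_mem_nhds x (hr x hxΩ))), ?_⟩
  refine measure_mono_null ?_ (hc x hxΩ)
  rintro y ⟨hy1, hy2⟩ hy3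
  exact hy1 fun _ => (hy3 hy2).trans (hall x hxΩ).symm

theorem IsSmoothBoundedDomain.volume_ne_top (hΩ : IsSmoothBoundedDomain Ω) : volume Ω ≠ ⊤ :=
  hΩ.isBounded.measure_lt_top.ne

theorem IsSmoothBoundedDomain.isFiniteMeasure (hΩ : IsSmoothBoundedDomain Ω) :
    IsFiniteMeasure (volume.restrict Ω) := ⟨by simpa using hΩ.volume_ne_top.lt_top⟩

theorem IsSmoothBoundedDomain.volume_real_pos (hΩ : IsSmoothBoundedDomain Ω) :
    0 < volume.real Ω :=
  ENNReal.toReal_pos (hΩ.isOpen.measure_pos volume hΩ.isConnected.nonempty).ne' hΩ.volume_ne_top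

theorem tendsto_integral_of_l2 {μ : Measure (Euc d)} {u : ℕ → Euc d → ℝ} {v ρ : Euc d → ℝ}
    (hu : ∀ n, MemLp (u n) 2 μ) (hv : MemLp v 2 μ) (hρ : MemLp ρ 2 μ)
    (hlim : Tendsto (fun n => l2 μ (fun x => u n x - v x)) atTop (𝓝 0)) :
    Tendsto (fun n => ∫ x, u n x * ρ x ∂μ) atTop (𝓝 (∫ x, v x * ρ x ∂μ)) := by
  rw [tendsto_iff_dist_tendsto_zero]
  refine squeeze_zero (fun _ => dist_nonneg) (fun n => ?_) (by simpa using hlim.mul_const (l2 μ ρ))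
  rw [Real.dist_eq, ← integral_sub (integrable_mul_of_memLp (hu n) hρ)
    (integrable_mul_of_memLp hv hρ)]
  simp only [← sub_mul]
  exact abs_integral_mul_le ((hu n).sub hv) hρ

/-- The **Poincaré inequality** for functions of mean value zero. -/
theorem IsSmoothBoundedDomain.poincare (hd : 1 ≤ d) (hΩ : IsSmoothBoundedDomain Ω) :
    ∃ C, 0 ≤ C ∧ ∀ u g, HasWeakGrad Ω u g → ∫ x in Ω, u x = 0 →
      l2 (volume.restrict Ω) u ≤ C * l2 (volume.restrict Ω) g := by
  by_contra! hcon
  set μ := volume.restrict Ω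
  have := hΩ.isFiniteMeasure
  choose u g hu hmean hlt using fun n : ℕ => hcon (n + 1) (by positivity)
  have hpos : ∀ n, 0 < l2 μ (u n) := fun n =>
    lt_of_le_of_lt (mul_nonneg (by positivity) (l2_nonneg _)) (hlt n)
  let w : ℕ → Euc d → ℝ := fun n x => (l2 μ (u n))⁻¹ * u n x
  let q : ℕ → Euc d → Euc d := fun n x => (l2 μ (u n))⁻¹ • g n x
  have hw : ∀ n, HasWeakGrad Ω (w n) (q n) := fun n => (hu n).const_mul _
  have hw1 : ∀ n, l2 μ (w n) = 1 := fun n => by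
    have := l2_const_smul (μ := μ) (l2 μ (u n))⁻¹ (u n)
    rw [abs_of_pos (inv_pos.2 (hpos n)), inv_mul_cancel₀ (hpos n).ne'] at this
    exact this
  have hq1 : ∀ n, l2 μ (q n) ≤ 1 / ((n : ℝ) + 1) := fun n => by
    have := l2_const_smul (μ := μ) (l2 μ (u n))⁻¹ (g n)
    rw [abs_of_pos (inv_pos.2 (hpos n))] at this
    rw [this, inv_mul_eq_div, div_le_div_iff₀ (hpos n) (by positivity)]
    have := hlt n
    linarith
  have hq2 : ∀ n, l2 μ (q n) ≤ 1 := fun n => by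
    refine (hq1 n).trans ?_
    rw [div_le_one (by positivity)]
    linarith [(Nat.cast_nonneg n : (0 : ℝ) ≤ n)]
  obtain ⟨k, v, p, hk, hv, hlim, -⟩ := hΩ.rellich hd hw (fun n => (hw1 n).le) hq2
  have hq0 : Tendsto (fun n => l2 μ (fun x => q (k n) x - (0 : Euc d))) atTop (𝓝 0) := by
    simp only [sub_zero]
    exact squeeze_zero (fun n => l2_nonneg _) (fun n => hq1 (k n))
      (tendsto_one_div_add_atTop_nhds_zero_nat.comp hk.tendsto_atTop)
  have hv0 : HasWeakGrad Ω v (fun _ => 0) :=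
    hasWeakGrad_of_limit (fun n => hw (k n)) hv.memLp MemLp.zero hlim hq0
  obtain ⟨c, hc⟩ := hv0.ae_eq_const hΩ.isOpen hΩ.isConnected
  have hone : MemLp (fun _ : Euc d => (1 : ℝ)) 2 μ := memLp_const 1
  have h1 := tendsto_integral_of_l2 (fun n => (hw (k n)).memLp) hv.memLp hone hlim
  have h2 : ∀ n, ∫ x, w (k n) x * 1 ∂μ = 0 := fun n => by
    simp only [w, mul_one]
    rw [integral_const_mul, hmean, mul_zero]
  have h3 : ∫ x, v x * 1 ∂μ = 0 :=
    tendsto_nhds_unique h1 (tendsto_const_nhds.congr fun n => (h2 n).symm)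
  have hc0 : c = 0 := by
    have h4 : ∫ x, v x * 1 ∂μ = ∫ _, c ∂μ := integral_congr_ae (by
      filter_upwards [hc] with x hx
      rw [hx, mul_one])
    rw [h3, integral_const, smul_eq_mul] at h4
    have h5 : μ.real univ = volume.real Ω := by simp [μ, Measure.real]
    rw [h5] at h4
    exact (mul_eq_zero.1 h4.symm).resolve_left hΩ.volume_real_pos.ne'
  have hv1 : l2 μ v = 0 := by
    rw [← l2_zero (μ := μ) (V := ℝ)]
    refine l2_congr ?_
    filter_upwards [hc] with x hx
    rw [hx, hc0]
  have h6 : ∀ n, (1 : ℝ) ≤ l2 μ (fun x => w (k n) x - v x) := fun n => by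
    have h7 := l2_add_le ((hw (k n)).memLp.sub hv.memLp) hv.memLp
    have h8 : (fun x => (w (k n) - v) x + v x) = w (k n) := by
      funext x
      simp
    rw [hv1, add_zero] at h7
    have h9 : l2 μ (w (k n)) ≤ l2 μ (fun x => w (k n) x - v x) := by
      have h10 := h7
      rw [h8] at h10
      exact h10
    rw [hw1] at h9
    exact h9
  exact absurd (ge_of_tendsto' hlim h6) (by norm_num)

end Rellich

/-! ### Weak solutions of the Neumann problem -/

section Neumann

variable {d : ℕ} {Ω : Set (Euc d)}

/-- The gradients of functions in `H¹(Ω)` with mean value zero. Integrability is part of the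
definition, since otherwise the vanishing of the integral could be that of a junk value. -/
def gradSubmodule (Ω : Set (Euc d)) : Submodule ℝ (Lp (Euc d) 2 (volume.restrict Ω)) where
  carrier := {G | ∃ u, HasWeakGrad Ω u G ∧ ∫ x in Ω, u x = 0 ∧ Integrable u (volume.restrict Ω)}
  add_mem' := by
    rintro G G' ⟨u, hu, h0, hi⟩ ⟨u', hu', h0', hi'⟩
    refine ⟨fun x => u x + u' x, (hu.add hu').congr_grad (Lp.coeFn_add G G').symm, ?_,
      hi.add hi'⟩
    rw [integral_add hi hi', h0, h0', add_zero]
  zero_mem' := by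
    refine ⟨fun _ => 0, ⟨MemLp.zero, Lp.memLp _, fun φ hφ v => ?_⟩, by simp,
      integrable_zero _ _ _⟩
    have : ∫ x in Ω, inner ℝ ((0 : Lp (Euc d) 2 (volume.restrict Ω)) x) v * φ x = 0 :=
      integral_eq_zero_of_ae (by
        filter_upwards [Lp.coeFn_zero (Euc d) 2 (volume.restrict Ω)] with x hx
        have h1 : inner ℝ ((0 : Lp (Euc d) 2 (volume.restrict Ω)) x) v = (0 : ℝ) := by
          rw [hx]
          exact inner_zero_left v
        change _ * _ = (0 : ℝ)
        rw [h1, zero_mul])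
    rw [this]
    simp
  smul_mem' := by
    rintro c G ⟨u, hu, h0, hi⟩
    refine ⟨fun x => c * u x, (hu.const_mul c).congr_grad (Lp.coeFn_smul c G).symm, ?_,
      hi.const_mul c⟩
    rw [integral_const_mul, h0, mul_zero]

/-- By the Poincaré inequality, convergence of the gradients bounds the functions in `H¹`, and
Rellich's theorem provides the limit function. -/
theorem isClosed_gradSubmodule (hd : 1 ≤ d) (hΩ : IsSmoothBoundedDomain Ω) :
    IsClosed (gradSubmodule Ω : Set (Lp (Euc d) 2 (volume.restrict Ω))) := by
  have := hΩ.isFiniteMeasure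
  obtain ⟨C, hC, hP⟩ := hΩ.poincare hd
  refine IsSeqClosed.isClosed fun G H hG hlim => ?_
  choose u hu h0 hi using hG
  obtain ⟨B, hB⟩ := (Metric.isBounded_range_of_tendsto _ hlim).exists_norm_le
  have hB' : ∀ n, l2 (volume.restrict Ω) (G n) ≤ B := fun n => hB _ ⟨n, rfl⟩
  have hB0 : 0 ≤ B := (l2_nonneg _).trans (hB' 0)
  have hu' : ∀ n, l2 (volume.restrict Ω) (u n) ≤ max B (C * B) := fun n =>
    (hP _ _ (hu n) (h0 n)).trans
      ((mul_le_mul_of_nonneg_left (hB' n) hC).trans (le_max_right _ _))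
  obtain ⟨k, v, p, hk, hv, hlim', -⟩ :=
    hΩ.rellich hd hu hu' (fun n => (hB' n).trans (le_max_left _ _))
  have hGH : Tendsto (fun n => l2 (volume.restrict Ω) (fun x => G (k n) x - H x)) atTop (𝓝 0) := by
    have h1 := (tendsto_iff_norm_sub_tendsto_zero.1 hlim).comp hk.tendsto_atTop
    refine h1.congr fun n => ?_
    exact l2_congr (Lp.coeFn_sub _ _)
  refine ⟨v, hasWeakGrad_of_limit (fun n => hu (k n)) hv.memLp (Lp.memLp H) hlim' hGH, ?_,
    hv.memLp.integrable (by norm_num)⟩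
  have h1 := tendsto_integral_of_l2 (fun n => (hu (k n)).memLp) hv.memLp
    (memLp_const (1 : ℝ)) hlim'
  have h2 : ∀ n, ∫ x in Ω, u (k n) x * 1 = 0 := fun n => by simp only [mul_one, h0]
  have h3 : ∫ x in Ω, v x * 1 = 0 :=
    tendsto_nhds_unique h1 (tendsto_const_nhds.congr fun n => (h2 n).symm)
  simpa using h3

/-- The weak Neumann problem is solvable for right-hand sides of mean value zero: by the Poincaré
inequality, `∇u ↦ ∫ f u` is a bounded functional on the gradients of functions of mean value
zero, and it is represented by one of them. -/
theorem IsSmoothBoundedDomain.exists_weak_solution (hd : 1 ≤ d) (hΩ : IsSmoothBoundedDomain Ω)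
    {f : Euc d → ℝ} (hf : MemLp f 2 (volume.restrict Ω)) (hf0 : ∫ x in Ω, f x = 0) :
    ∃ u g, HasWeakGrad Ω u g ∧ ∫ x in Ω, u x = 0 ∧
      ∀ φ p, HasWeakGrad Ω φ p → ∫ x in Ω, inner ℝ (g x) (p x) = ∫ x in Ω, f x * φ x := by
  have := hΩ.isFiniteMeasure
  obtain ⟨C, hC, hP⟩ := hΩ.poincare hd
  have : CompleteSpace (gradSubmodule Ω) := (isClosed_gradSubmodule hd hΩ).completeSpace_coe
  choose U hU hU0 hUi using fun G : gradSubmodule Ω => G.2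
  have key : ∀ (G : gradSubmodule Ω) u g, HasWeakGrad Ω u g → ∫ x in Ω, u x = 0 →
      g =ᵐ[volume.restrict Ω] (G : Lp (Euc d) 2 (volume.restrict Ω)) →
      ∫ x in Ω, f x * U G x = ∫ x in Ω, f x * u x := by
    intro G u g hu h0 hg
    have hi : Integrable u (volume.restrict Ω) := hu.memLp.integrable (by norm_num)
    have hw := (hU G).sub hu
    have hw0 : ∫ x in Ω, (U G x - u x) = 0 := by
      rw [integral_sub (hUi G) hi, hU0, h0, sub_zero]
    have h1 := hP _ _ hw hw0
    have h2 : l2 (volume.restrict Ω)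
        (fun x => (G : Lp (Euc d) 2 (volume.restrict Ω)) x - g x) = 0 := by
      rw [← l2_zero (μ := volume.restrict Ω) (V := Euc d)]
      refine l2_congr ?_
      filter_upwards [hg] with x hx
      rw [hx, sub_self]
    rw [h2, mul_zero] at h1
    have h3 := abs_integral_mul_le hf hw.memLp
    have h4 : |∫ x in Ω, f x * (U G x - u x)| ≤ 0 :=
      h3.trans (mul_nonpos_of_nonneg_of_nonpos (l2_nonneg _) h1)
    have h5 : ∫ x in Ω, f x * (U G x - u x) = 0 := abs_nonpos_iff.1 h4
    simp only [mul_sub] at h5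
    rw [integral_sub (integrable_mul_of_memLp hf (hU G).memLp)
      (integrable_mul_of_memLp hf hu.memLp)] at h5
    linarith
  let ℓ₀ : gradSubmodule Ω →ₗ[ℝ] ℝ :=
    { toFun := fun G => ∫ x in Ω, f x * U G x
      map_add' := fun G H => by
        rw [key (G + H) _ _ ((hU G).add (hU H))
          (by rw [integral_add (hUi G) (hUi H), hU0, hU0, add_zero])
          (Lp.coeFn_add (G : Lp (Euc d) 2 (volume.restrict Ω)) H).symm]
        simp only [mul_add]
        exact integral_add (integrable_mul_of_memLp hf (hU G).memLp)
          (integrable_mul_of_memLp hf (hU H).memLp)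
      map_smul' := fun c G => by
        rw [key (c • G) _ _ ((hU G).const_mul c) (by rw [integral_const_mul, hU0, mul_zero])
          (Lp.coeFn_smul c (G : Lp (Euc d) 2 (volume.restrict Ω))).symm]
        simp only [mul_left_comm _ c]
        rw [integral_const_mul]
        rfl }
  let ℓ : gradSubmodule Ω →L[ℝ] ℝ := ℓ₀.mkContinuous (l2 (volume.restrict Ω) f * C) fun G => by
    refine (abs_integral_mul_le hf (hU G).memLp).trans ?_
    rw [mul_assoc]
    exact mul_le_mul_of_nonneg_left (hP _ _ (hU G) (hU0 G)) (l2_nonneg _)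
  set G₀ := (InnerProductSpace.toDual ℝ (gradSubmodule Ω)).symm ℓ
  have hG₀ : ∀ G : gradSubmodule Ω, inner ℝ G₀ G = ∫ x in Ω, f x * U G x := fun G => by
    rw [InnerProductSpace.toDual_symm_apply]
    rfl
  refine ⟨U G₀, _, hU G₀, hU0 G₀, fun φ p hφ => ?_⟩
  have hφi : Integrable φ (volume.restrict Ω) := hφ.memLp.integrable (by norm_num)
  set m := (volume.real Ω)⁻¹ * ∫ x in Ω, φ x
  have hψ := hφ.sub (hasWeakGrad_const hΩ.volume_ne_top m)
  have hψ0 : ∫ x in Ω, (φ x - m) = 0 := by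
    rw [integral_sub hφi (integrable_const m), integral_const, smul_eq_mul,
      measureReal_restrict_apply_univ]
    simp only [m]
    rw [mul_inv_cancel_left₀ hΩ.volume_real_pos.ne', sub_self]
  have hpG : hφ.memLp_grad.toLp p ∈ gradSubmodule Ω :=
    ⟨_, hψ.congr_grad (by
      filter_upwards [hφ.memLp_grad.coeFn_toLp] with x hx
      rw [hx, sub_zero]), hψ0, hφi.sub (integrable_const m)⟩
  have h1 := hG₀ ⟨_, hpG⟩
  rw [key ⟨_, hpG⟩ _ _ hψ hψ0 (by
      filter_upwards [hφ.memLp_grad.coeFn_toLp] with x hx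
      rw [hx, sub_zero]), Submodule.coe_inner, L2.inner_def] at h1
  have h2 : ∫ x in Ω, f x * (φ x - m) = ∫ x in Ω, f x * φ x := by
    simp only [mul_sub]
    rw [integral_sub (integrable_mul_of_memLp hf hφ.memLp)
      (integrable_mul_of_memLp hf (memLp_const m)), integral_mul_const, hf0, zero_mul, sub_zero]
  rw [← h2, ← h1]
  refine integral_congr_ae ?_
  filter_upwards [hφ.memLp_grad.coeFn_toLp] with x hx
  rw [hx]

end Neumann

/-! ### Tangential regularity up to the boundary -/

section Tangential

variable {d : ℕ} {D : Set (Euc d)} {e τ : Euc d} {γ : Euc d → ℝ}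

theorem integral_inner_add_left {μ : Measure (Euc d)} {A B v : Euc d → Euc d} (hA : MemLp A 2 μ)
    (hB : MemLp B 2 μ) (hv : MemLp v 2 μ) :
    ∫ x, inner ℝ (A x + B x) (v x) ∂μ =
      (∫ x, inner ℝ (A x) (v x) ∂μ) + ∫ x, inner ℝ (B x) (v x) ∂μ := by
  simp only [inner_add_left]
  exact integral_add (integrable_inner hA hv) (integrable_inner hB hv)

theorem integral_inner_sub_left {μ : Measure (Euc d)} {A B v : Euc d → Euc d} (hA : MemLp A 2 μ)
    (hB : MemLp B 2 μ) (hv : MemLp v 2 μ) :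
    ∫ x, inner ℝ (A x - B x) (v x) ∂μ =
      (∫ x, inner ℝ (A x) (v x) ∂μ) - ∫ x, inner ℝ (B x) (v x) ∂μ := by
  simp only [inner_sub_left]
  exact integral_sub (integrable_inner hA hv) (integrable_inner hB hv)

theorem integral_inner_add_right {μ : Measure (Euc d)} {A B v : Euc d → Euc d} (hv : MemLp v 2 μ)
    (hA : MemLp A 2 μ) (hB : MemLp B 2 μ) :
    ∫ x, inner ℝ (v x) (A x + B x) ∂μ =
      (∫ x, inner ℝ (v x) (A x) ∂μ) + ∫ x, inner ℝ (v x) (B x) ∂μ := by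
  simp only [inner_add_right]
  exact integral_add (integrable_inner hv hA) (integrable_inner hv hB)

theorem integral_inner_sub_right {μ : Measure (Euc d)} {A B v : Euc d → Euc d} (hv : MemLp v 2 μ)
    (hA : MemLp A 2 μ) (hB : MemLp B 2 μ) :
    ∫ x, inner ℝ (v x) (A x - B x) ∂μ =
      (∫ x, inner ℝ (v x) (A x) ∂μ) - ∫ x, inner ℝ (v x) (B x) ∂μ := by
  simp only [inner_sub_right]
  exact integral_sub (integrable_inner hv hA) (integrable_inner hv hB)

theorem memLp_comp_flow {V : Type*} [NormedAddCommGroup V] (hγ : IsGraphFun e γ)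
    (hD : FlowInvariant γ e τ D) (h : ℝ) {f : Euc d → V} (hf : MemLp f 2 (volume.restrict D)) :
    MemLp (fun x => f (flow γ e τ h x)) 2 (volume.restrict D) :=
  hf.comp_measurePreserving (hγ.measurePreserving_flow_restrict hD h)

theorem IsGraphFun.continuous_gradient (hγ : IsGraphFun e γ) : Continuous (gradient γ) :=
  (InnerProductSpace.toDual ℝ (Euc d)).symm.continuous.comp
    (hγ.contDiff.continuous_fderiv (by simp))

theorem norm_gradient_sub (x y : Euc d) :
    ‖gradient γ x - gradient γ y‖ = ‖fderiv ℝ γ x - fderiv ℝ γ y‖ := by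
  rw [gradient, gradient, ← map_sub, LinearIsometryEquiv.norm_map]

/-- The commutator of the flow with the gradient is bounded in `L²` by the flow time. -/
theorem l2_inner_smul_gradient_le {L : ℝ} (hγ : IsGraphFun e γ)
    (hL : ∀ x y, ‖fderiv ℝ γ x - fderiv ℝ γ y‖ ≤ L * ‖x - y‖) (h : ℝ)
    {f : Euc d → Euc d} (hf : MemLp f 2 (volume.restrict D)) (hL0 : 0 ≤ L) :
    MemLp (fun x => inner ℝ (f x) e • (gradient γ (x + h • τ) - gradient γ x)) 2
        (volume.restrict D) ∧
      l2 (volume.restrict D) (fun x => inner ℝ (f x) e • (gradient γ (x + h • τ) - gradient γ x)) ≤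
        |h| * (L * ‖τ‖) * l2 (volume.restrict D) f := by
  have hb : ∀ x, ‖inner ℝ (f x) e • (gradient γ (x + h • τ) - gradient γ x)‖ ≤
      |h| * (L * ‖τ‖) * ‖f x‖ := by
    intro x
    rw [norm_smul, norm_gradient_sub]
    have h1 : ‖inner ℝ (f x) e‖ ≤ ‖f x‖ := by
      have := norm_inner_le_norm (𝕜 := ℝ) (f x) e
      rwa [hγ.norm_eq, mul_one] at this
    have h2 := hL (x + h • τ) x
    rw [add_sub_cancel_left, norm_smul, Real.norm_eq_abs] at h2
    calc _ ≤ ‖f x‖ * (L * (|h| * ‖τ‖)) :=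
          mul_le_mul h1 h2 (norm_nonneg _) (norm_nonneg _)
      _ = _ := by ring
  have hc : Continuous fun x => gradient γ (x + h • τ) - gradient γ x :=
    (hγ.continuous_gradient.comp (continuous_id.add continuous_const)).sub hγ.continuous_gradient
  have hm : AEStronglyMeasurable
      (fun x => inner ℝ (f x) e • (gradient γ (x + h • τ) - gradient γ x)) (volume.restrict D) :=
    (memLp_inner_const hf e).1.smul hc.aestronglyMeasurable
  exact ⟨hf.of_le_mul hm (Eventually.of_forall hb),
    l2_le_of_norm_le (by positivity) hf (Eventually.of_forall hb)⟩

theorem IsGraphFun.integral_inner_comp_flow (hγ : IsGraphFun e γ) (hD : FlowInvariant γ e τ D)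
    (h : ℝ) (A v : Euc d → Euc d) :
    ∫ x in D, inner ℝ (A x) (v (flow γ e τ (-h) x)) =
      ∫ x in D, inner ℝ (A (flow γ e τ h x)) (v x) := by
  rw [← hγ.integral_comp_flow hD h]
  simp only [hγ.flow_neg_flow]

/-- Difference quotients of the gradient of a weak solution along a tangential flow are bounded
in `L²`. The equation is tested with the second difference quotient of the solution; the natural
boundary condition is built into the equation, so that no boundary term appears. -/
theorem HasWeakGrad.l2_grad_comp_flow_sub_le (hDo : IsOpen D) (hγ : IsGraphFun e γ)
    (hD : FlowInvariant γ e τ D) {U k : Euc d → ℝ} {g Fv : Euc d → Euc d}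
    (hU : HasWeakGrad D U g) (hk : MemLp k 2 (volume.restrict D))
    (hF : MemLp Fv 2 (volume.restrict D))
    (hFC : ∃ C, ∀ h, l2 (volume.restrict D) (fun x => Fv (flow γ e τ h x) - Fv x) ≤ C * |h|)
    (heq : ∀ φ p, HasWeakGrad D φ p → ∫ x in D, inner ℝ (g x - Fv x) (p x) = ∫ x in D, k x * φ x) :
    ∃ C, ∀ h, l2 (volume.restrict D) (fun x => g (flow γ e τ h x) - g x) ≤ C * |h| := by
  obtain ⟨CF, hCF⟩ := hFC
  obtain ⟨L, hL0, hL⟩ := hγ.lipschitz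
  obtain ⟨L', hL'0, hL'⟩ := hγ.bounded
  set μ := volume.restrict D
  have hg := hU.memLp_grad
  have hA : MemLp (fun x => g x - Fv x) 2 μ := hg.sub hF
  set K := l2 μ k * ((1 + L') * ‖τ‖) + l2 μ (fun x => g x - Fv x) * (L * ‖τ‖) +
    ((L * ‖τ‖) * l2 μ g + CF)
  refine ⟨K + L * ‖τ‖ * l2 μ g, fun h => ?_⟩
  -- the first difference and its gradient; `r` comes from the chain rule for the flow
  have hV := (hU.comp_flow hγ hD h).sub hU
  set V : Euc d → ℝ := fun x => U (flow γ e τ h x) - U x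
  have hgT : MemLp (fun x => g (flow γ e τ h x)) 2 μ := memLp_comp_flow hγ hD h hg
  obtain ⟨hr, hr'⟩ := l2_inner_smul_gradient_le (τ := τ) hγ hL h hgT hL0
  rw [l2_comp_measurePreserving (hγ.measurePreserving_flow_restrict hD h) hg] at hr'
  set r : Euc d → Euc d := fun x =>
    inner ℝ (g (flow γ e τ h x)) e • (gradient γ (x + h • τ) - gradient γ x)
  set v : Euc d → Euc d := fun x => g (flow γ e τ h x) + r x - g x
  have hv : MemLp v 2 μ := hV.memLp_grad
  -- the second difference and its gradient
  have hφ := (hV.comp_flow hγ hD (-h)).sub hV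
  have hvS : MemLp (fun x => v (flow γ e τ (-h) x)) 2 μ := memLp_comp_flow hγ hD (-h) hv
  obtain ⟨hs, hs'⟩ := l2_inner_smul_gradient_le (τ := τ) hγ hL (-h) hvS hL0
  rw [l2_comp_measurePreserving (hγ.measurePreserving_flow_restrict hD (-h)) hv, abs_neg] at hs'
  set s : Euc d → Euc d := fun x =>
    inner ℝ (v (flow γ e τ (-h) x)) e • (gradient γ (x + (-h) • τ) - gradient γ x)
  have hφ' : l2 μ (fun x => V (flow γ e τ (-h) x) - V x) ≤ |h| * (((1 + L') * ‖τ‖) * l2 μ v) := by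
    have h1 := hV.l2_comp_flow_sub_le hDo hγ hD (-h)
    rw [abs_neg] at h1
    refine h1.trans (mul_le_mul_of_nonneg_left ?_ (abs_nonneg _))
    refine l2_le_of_norm_le (by positivity) hv (Eventually.of_forall fun x => ?_)
    refine (norm_inner_le_norm _ _).trans ?_
    rw [mul_comm]
    exact mul_le_mul_of_nonneg_right (hγ.norm_flowField_le hL' x) (norm_nonneg _)
  have h1 := heq _ _ hφ
  -- invariance of the measure moves the difference from the test function to `g - Fv`
  have hAT : MemLp (fun x => g (flow γ e τ h x) - Fv (flow γ e τ h x)) 2 μ :=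
    memLp_comp_flow hγ hD h hA
  have h2 : ∫ x in D, inner ℝ (g x - Fv x) (v (flow γ e τ (-h) x) + s x - v x) =
      (∫ x in D, inner ℝ (g (flow γ e τ h x) - Fv (flow γ e τ h x)) (v x)) +
        (∫ x in D, inner ℝ (g x - Fv x) (s x)) - ∫ x in D, inner ℝ (g x - Fv x) (v x) := by
    rw [← hγ.integral_inner_comp_flow hD h (fun x => g x - Fv x) v]
    have h3 : MemLp (fun x => v (flow γ e τ (-h) x) + s x) 2 μ := hvS.add hs
    rw [integral_inner_sub_right hA h3 hv, integral_inner_add_right hA hvS hs]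
  have h1' := h2.symm.trans h1
  have hFT : MemLp (fun x => Fv (flow γ e τ h x) - Fv x) 2 μ :=
    (memLp_comp_flow hγ hD h hF).sub hF
  have h3 : l2 μ v ^ 2 = (∫ x in D, inner ℝ (g (flow γ e τ h x) - Fv (flow γ e τ h x)) (v x)) -
      (∫ x in D, inner ℝ (g x - Fv x) (v x)) + (∫ x in D, inner ℝ (r x) (v x)) +
      ∫ x in D, inner ℝ (Fv (flow γ e τ h x) - Fv x) (v x) := by
    have h4 : ∀ x, v x = (g (flow γ e τ h x) - Fv (flow γ e τ h x)) - (g x - Fv x) + r x +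
        (Fv (flow γ e τ h x) - Fv x) := fun x => by
      simp only [v]
      abel
    have h5 : MemLp (fun x => (g (flow γ e τ h x) - Fv (flow γ e τ h x)) - (g x - Fv x)) 2 μ :=
      hAT.sub hA
    have h6 : MemLp
        (fun x => (g (flow γ e τ h x) - Fv (flow γ e τ h x)) - (g x - Fv x) + r x) 2 μ :=
      h5.add hr
    rw [l2_sq_inner hv, ← integral_inner_sub_left hAT hA hv,
      ← integral_inner_add_left h5 hr hv, ← integral_inner_add_left h6 hFT hv]
    refine integral_congr_ae (Eventually.of_forall fun x => ?_)
    change inner ℝ (v x) (v x) = inner ℝ (_ - _ + r x + _) (v x)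
    rw [← h4]
  have e1 := abs_integral_mul_le hk hφ.memLp
  have e2 := abs_integral_inner_le hA hs
  have e3 := abs_integral_inner_le hr hv
  have e4 := abs_integral_inner_le hFT hv
  have hv0 := l2_nonneg (μ := μ) v
  have e1' : l2 μ k * l2 μ (fun x => V (flow γ e τ (-h) x) - V x) ≤
      l2 μ k * (|h| * (((1 + L') * ‖τ‖) * l2 μ v)) :=
    mul_le_mul_of_nonneg_left hφ' (l2_nonneg _)
  have e2' := mul_le_mul_of_nonneg_left hs' (l2_nonneg (μ := μ) (fun x => g x - Fv x))
  have e3' := mul_le_mul_of_nonneg_right hr' hv0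
  have e4' := mul_le_mul_of_nonneg_right (hCF h) hv0
  have h4 : l2 μ v ^ 2 ≤ (K * |h|) * l2 μ v := by
    have a1 := abs_le.1 (e1.trans e1')
    have a2 := abs_le.1 (e2.trans e2')
    have a3 := abs_le.1 (e3.trans e3')
    have a4 := abs_le.1 (e4.trans e4')
    have : (K * |h|) * l2 μ v = l2 μ k * (|h| * (((1 + L') * ‖τ‖) * l2 μ v)) +
        l2 μ (fun x => g x - Fv x) * (|h| * (L * ‖τ‖) * l2 μ v) +
        |h| * (L * ‖τ‖) * l2 μ g * l2 μ v + CF * |h| * l2 μ v := by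
      simp only [K]; ring
    rw [this, h3]
    linarith [a1.2, a2.1, a3.2, a4.2]
  have h5 : l2 μ v ≤ K * |h| := by
    rcases hv0.eq_or_lt with h0 | h0
    · rw [← h0]
      have hCF0 : 0 ≤ CF * |h| := (l2_nonneg _).trans (hCF h)
      have : K * |h| = (l2 μ k * ((1 + L') * ‖τ‖) + l2 μ (fun x => g x - Fv x) * (L * ‖τ‖) +
        ((L * ‖τ‖) * l2 μ g)) * |h| + CF * |h| := by simp only [K]; ring
      rw [this]
      have := l2_nonneg (μ := μ) k
      have := l2_nonneg (μ := μ) g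
      have := l2_nonneg (μ := μ) (fun x => g x - Fv x)
      positivity
    · rw [sq] at h4
      exact le_of_mul_le_mul_right h4 h0
  have h6 := l2_sub_le hv hr
  have h7 : (fun x => v x - r x) = fun x => g (flow γ e τ h x) - g x := by
    funext x
    simp only [v]
    abel
  rw [h7] at h6
  calc _ ≤ l2 μ v + l2 μ r := h6
    _ ≤ K * |h| + |h| * (L * ‖τ‖) * l2 μ g := add_le_add h5 hr'
    _ = _ := by ring

/-- Bounded difference quotients along a flow bound the derivative in the direction of the flow
in the sense of distributions. -/
theorem abs_integral_flowField_le (hγ : IsGraphFun e γ) (hD : FlowInvariant γ e τ D)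
    {w φ : Euc d → ℝ} {C : ℝ} (hw : MemLp w 2 (volume.restrict D))
    (hC : ∀ h, l2 (volume.restrict D) (fun x => w (flow γ e τ h x) - w x) ≤ C * |h|)
    (hφ : IsTest D φ) :
    |∫ x in D, w x * fderiv ℝ φ x (flowField γ e τ x)| ≤ C * l2 (volume.restrict D) φ := by
  have h1 := hγ.hasDerivAt_integral_flow (e := e) (τ := τ) hw hφ 0
  simp only [flow_zero] at h1
  have hφm : MemLp φ 2 (volume.restrict D) := hφ.memLp 2
  have h2 := h1.le_of_lip' (C := C * l2 (volume.restrict D) φ) (by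
    have := hC 1
    have := (l2_nonneg _).trans this
    simp only [abs_one, mul_one] at this
    exact mul_nonneg this (l2_nonneg _)) (Eventually.of_forall fun s => ?_)
  · exact h2
  · have h3 : ∫ x in D, w x * φ (flow γ e τ s x) = ∫ x in D, w (flow γ e τ (-s) x) * φ x := by
      rw [← hγ.integral_comp_flow hD (-s)]
      simp only [hγ.flow_flow_neg]
    have hwT : MemLp (fun x => w (flow γ e τ (-s) x)) 2 (volume.restrict D) :=
      memLp_comp_flow hγ hD (-s) hw
    simp only [flow_zero]
    rw [h3, ← integral_sub (integrable_mul_of_memLp hwT hφm)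
      (integrable_mul_of_memLp hw hφm)]
    simp only [← sub_mul]
    refine (abs_integral_mul_le (hwT.sub hw) hφm).trans ?_
    have h4 := hC (-s)
    rw [abs_neg] at h4
    calc _ ≤ C * |s| * l2 (volume.restrict D) φ :=
          mul_le_mul_of_nonneg_right h4 (l2_nonneg _)
      _ = _ := by rw [sub_zero, Real.norm_eq_abs]; ring

end Tangential

/-! ### Normal regularity up to the boundary -/

section Normal

variable {d : ℕ} {D : Set (Euc d)} {e τ : Euc d} {γ : Euc d → ℝ}

/-- The functional `L` on test functions in `D` is bounded with respect to the `L²` norm. -/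
def TestBounded (D : Set (Euc d)) (L : (Euc d → ℝ) → ℝ) : Prop :=
  ∃ C, 0 ≤ C ∧ ∀ φ, IsTest D φ → |L φ| ≤ C * l2 (volume.restrict D) φ

namespace TestBounded

variable {L L' : (Euc d → ℝ) → ℝ}

theorem of_le {C : ℝ} (h : ∀ φ, IsTest D φ → |L φ| ≤ C * l2 (volume.restrict D) φ) :
    TestBounded D L :=
  ⟨max C 0, le_max_right _ _, fun φ hφ =>
    (h φ hφ).trans (mul_le_mul_of_nonneg_right (le_max_left _ _) (l2_nonneg _))⟩

theorem congr (h : TestBounded D L) (hL : ∀ φ, IsTest D φ → L' φ = L φ) : TestBounded D L' := by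
  obtain ⟨C, hC, h⟩ := h
  exact ⟨C, hC, fun φ hφ => (hL φ hφ).symm ▸ h φ hφ⟩

theorem add (h : TestBounded D L) (h' : TestBounded D L') :
    TestBounded D (fun φ => L φ + L' φ) := by
  obtain ⟨C, hC, h⟩ := h
  obtain ⟨C', hC', h'⟩ := h'
  refine ⟨C + C', add_nonneg hC hC', fun φ hφ => (abs_add_le _ _).trans ?_⟩
  rw [add_mul]
  exact add_le_add (h φ hφ) (h' φ hφ)

theorem neg (h : TestBounded D L) : TestBounded D (fun φ => - L φ) := by
  obtain ⟨C, hC, h⟩ := h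
  exact ⟨C, hC, fun φ hφ => by rw [abs_neg]; exact h φ hφ⟩

theorem sub (h : TestBounded D L) (h' : TestBounded D L') :
    TestBounded D (fun φ => L φ - L' φ) := by
  simp only [sub_eq_add_neg]
  exact h.add h'.neg

theorem sum {ι : Type*} {s : Finset ι} {L : ι → (Euc d → ℝ) → ℝ}
    (h : ∀ i ∈ s, TestBounded D (L i)) : TestBounded D (fun φ => ∑ i ∈ s, L i φ) := by
  classical
  induction s using Finset.induction_on with
  | empty => exact ⟨0, le_rfl, fun φ _ => by simp⟩
  | insert i s hi ih =>
    refine ((h i (Finset.mem_insert_self i s)).add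
      (ih fun j hj => h j (Finset.mem_insert_of_mem hj))).congr fun φ _ => ?_
    rw [Finset.sum_insert hi]

theorem comp_mul (h : TestBounded D L) {b : Euc d → ℝ} (hb : ContDiff ℝ ∞ b) {K : ℝ}
    (hK : ∀ x, |b x| ≤ K) : TestBounded D (fun φ => L (fun x => b x * φ x)) := by
  obtain ⟨C, hC, h⟩ := h
  have hK0 : 0 ≤ K := (abs_nonneg _).trans (hK 0)
  refine ⟨C * K, by positivity, fun φ hφ => (h _ (hφ.mul_left hb)).trans ?_⟩
  rw [mul_assoc]
  refine mul_le_mul_of_nonneg_left (l2_le_of_norm_le hK0 (hφ.memLp 2)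
    (Eventually.of_forall fun x => ?_)) hC
  rw [norm_mul]
  exact mul_le_mul_of_nonneg_right (hK x) (norm_nonneg _)

theorem integral_mul {k : Euc d → ℝ} (hk : MemLp k 2 (volume.restrict D)) :
    TestBounded D (fun φ => ∫ x in D, k x * φ x) :=
  ⟨l2 (volume.restrict D) k, l2_nonneg _, fun _ hφ => abs_integral_mul_le hk (hφ.memLp 2)⟩

end TestBounded

theorem IsTest.hasWeakGrad {φ : Euc d → ℝ} (hφ : IsTest D φ) : HasWeakGrad D φ (gradient φ) := by
  refine ⟨hφ.memLp 2, hφ.contDiff_gradient.continuous.memLp_of_hasCompactSupport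
    hφ.hasCompactSupport_gradient, fun ψ hψ v => ?_⟩
  have h1 := (hψ.mul_left hφ.contDiff).integral_fderiv_eq_zero v
  have h2 : ∀ x, fderiv ℝ (fun y => φ y * ψ y) x v =
      φ x * fderiv ℝ ψ x v + inner ℝ (gradient φ x) v * ψ x := fun x => by
    rw [fderiv_fun_mul (hφ.differentiable x) (hψ.differentiable x), inner_gradient]
    simp [mul_comm]
  simp only [h2] at h1
  rw [integral_add] at h1
  · linarith
  · exact integrable_mul_of_memLp (hφ.memLp 2) ((hψ.dirDeriv v).memLp 2)
  · simp only [inner_gradient]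
    exact integrable_mul_of_memLp ((hφ.dirDeriv v).memLp 2) (hψ.memLp 2)

theorem IsGraphFun.fderiv_self (hγ : IsGraphFun e γ) (x : Euc d) : fderiv ℝ γ x e = 0 :=
  fderiv_eq_zero_of_invariant hγ.differentiable hγ.invariant x

/-- Decomposition of a vector into a part tangential to the graph and a vertical part. -/
theorem IsGraphFun.flowField_add_normal (hγ : IsGraphFun e γ) (w x : Euc d) :
    flowField γ e (w - inner ℝ w e • e) x + inner ℝ (normalField e γ x) w • e = w := by
  rw [flowField, inner_normalField, map_sub, map_smul, hγ.fderiv_self, smul_zero, sub_zero,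
    real_inner_comm]
  module

theorem IsGraphFun.inner_tangential (hγ : IsGraphFun e γ) (w : Euc d) :
    inner ℝ (w - inner ℝ w e • e) e = 0 := by
  rw [inner_sub_left, real_inner_smul_left, hγ.inner_self, mul_one, sub_self]

theorem IsGraphFun.normalField_invariant (hγ : IsGraphFun e γ) (y : Euc d) (t : ℝ) :
    normalField e γ (y + t • e) = normalField e γ y := by
  rw [normalField, normalField, gradient, gradient, hγ.fderiv_invariant]

theorem IsGraphFun.one_le_inner_normalField (hγ : IsGraphFun e γ) (x : Euc d) :
    1 ≤ inner ℝ (normalField e γ x) (normalField e γ x) := by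
  have h1 : inner ℝ (normalField e γ x) e = (1 : ℝ) := by
    rw [inner_normalField, hγ.inner_self, hγ.fderiv_self, sub_zero]
  have h2 := abs_real_inner_le_norm (normalField e γ x) e
  rw [h1, hγ.norm_eq, mul_one, abs_one] at h2
  rw [real_inner_self_eq_norm_sq]
  exact one_le_pow₀ h2

theorem fderiv_mul_of_invariant {b φ : Euc d → ℝ} (hb : ContDiff ℝ ∞ b)
    (hinv : ∀ (y : Euc d) (t : ℝ), b (y + t • e) = b y) (hφ : IsTest D φ) (x : Euc d) :
    fderiv ℝ (fun y => b y * φ y) x e = b x * fderiv ℝ φ x e := by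
  have hbd : Differentiable ℝ b := hb.differentiable (by simp)
  rw [fderiv_fun_mul (hbd x) (hφ.differentiable x)]
  simp [fderiv_eq_zero_of_invariant hbd hinv x]

theorem IsGraphFun.isTest_flowField (hγ : IsGraphFun e γ) {φ : Euc d → ℝ} (hφ : IsTest D φ) :
    IsTest D (fun x => fderiv ℝ φ x (flowField γ e τ x)) := by
  have h1 : ContDiff ℝ ∞ (fun x => fderiv ℝ γ x τ) :=
    (hγ.contDiff.fderiv_right (m := ∞) (by simp)).clm_apply contDiff_const
  have h2 := (hφ.dirDeriv τ).add ((hφ.dirDeriv e).mul_left h1)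
  have h3 : (fun x => fderiv ℝ φ x (flowField γ e τ x)) =
      fun x => fderiv ℝ φ x τ + fderiv ℝ γ x τ * fderiv ℝ φ x e := by
    funext x
    simp [flowField]
  rw [h3]
  exact h2

/-- The derivative in the direction `e` commutes with the derivative along a flow field. -/
theorem IsGraphFun.fderiv_flowField_comm (hγ : IsGraphFun e γ) {φ : Euc d → ℝ} (hφ : IsTest D φ)
    (x : Euc d) :
    fderiv ℝ (fun y => fderiv ℝ φ y e) x (flowField γ e τ x) =
      fderiv ℝ (fun y => fderiv ℝ φ y (flowField γ e τ y)) x e := by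
  have hφ' : Differentiable ℝ (fderiv ℝ φ) :=
    (hφ.contDiff.fderiv_right (m := ∞) (by simp)).differentiable (by simp)
  have hdir : ∀ v w, fderiv ℝ (fun y => fderiv ℝ φ y v) x w = fderiv ℝ (fderiv ℝ φ) x w v := by
    intro v w
    rw [fderiv_clm_apply (hφ' x) (differentiableAt_const v)]
    simp
  have hsymm : ∀ v w, fderiv ℝ (fderiv ℝ φ) x v w = fderiv ℝ (fderiv ℝ φ) x w v := fun v w =>
    second_derivative_symmetric_of_eventually
      (Eventually.of_forall fun y => (hφ.differentiable y).hasFDerivAt) (hφ' x).hasFDerivAt v w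
  have h1 : ContDiff ℝ ∞ (fun x => fderiv ℝ γ x τ) :=
    (hγ.contDiff.fderiv_right (m := ∞) (by simp)).clm_apply contDiff_const
  have h3 : (fun y => fderiv ℝ φ y (flowField γ e τ y)) =
      fun y => fderiv ℝ φ y τ + fderiv ℝ γ y τ * fderiv ℝ φ y e := by
    funext y
    simp [flowField]
  rw [h3, fderiv_fun_add ((hφ.dirDeriv τ).differentiable x)
    (((hφ.dirDeriv e).mul_left h1).differentiable x), add_apply,
    fderiv_mul_of_invariant h1 (fun y t => by rw [hγ.fderiv_invariant]) (hφ.dirDeriv e), hdir, hdir,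
    hdir, flowField, map_add, map_smul, add_apply, smul_apply, smul_eq_mul, hsymm τ e]

theorem l2_le_sum {μ : Measure (Euc d)} {f : Euc d → Euc d} (hf : MemLp f 2 μ) :
    l2 μ f ≤ ∑ i, l2 μ (fun x => f x i) := by
  have h0 : 0 ≤ ∑ i, l2 μ (fun x => f x i) := Finset.sum_nonneg fun i _ => l2_nonneg _
  rw [← sq_le_sq₀ (l2_nonneg _) h0, l2_sq hf]
  have h1 : ∀ x, ‖f x‖ ^ 2 = ∑ i, ‖f x i‖ ^ 2 := fun x => EuclideanSpace.norm_sq_eq _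
  simp only [h1]
  rw [integral_finsetSum _ fun i _ => integrable_norm_sq (memLp_apply hf i)]
  have h2 : ∀ i, ∫ x, ‖f x i‖ ^ 2 ∂μ = l2 μ (fun x => f x i) ^ 2 := fun i =>
    (l2_sq (memLp_apply hf i)).symm
  simp only [h2]
  exact Finset.sum_sq_le_sq_sum_of_nonneg fun i _ => l2_nonneg _

theorem inner_single_right (x : Euc d) (i : Fin d) :
    inner ℝ x (EuclideanSpace.single i (1 : ℝ)) = x i := by
  simp [EuclideanSpace.inner_single_right]

/-- A field whose components lie in `H¹` has bounded tangential difference quotients. -/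
theorem exists_l2_comp_flow_sub_le (hDo : IsOpen D) (hγ : IsGraphFun e γ)
    (hD : FlowInvariant γ e τ D) {Fv : Euc d → Euc d} (hFm : MemLp Fv 2 (volume.restrict D))
    (hF : ∀ v, ∃ q, HasWeakGrad D (fun x => inner ℝ (Fv x) v) q) :
    ∃ C, ∀ h, l2 (volume.restrict D) (fun x => Fv (flow γ e τ h x) - Fv x) ≤ C * |h| := by
  choose q hq using hF
  refine ⟨∑ i, l2 (volume.restrict D) (fun x =>
    inner ℝ (q (EuclideanSpace.single i 1) x) (flowField γ e τ x)), fun h => ?_⟩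
  refine (l2_le_sum ((memLp_comp_flow hγ hD h hFm).sub hFm)).trans ?_
  rw [Finset.sum_mul]
  refine Finset.sum_le_sum fun i _ => ?_
  have h1 := (hq (EuclideanSpace.single i 1)).l2_comp_flow_sub_le hDo hγ hD h
  rw [mul_comm]
  simp only [inner_single_right] at h1
  exact h1

/-- A weak solution of a Neumann problem above a graph is twice weakly differentiable up to the
boundary. Tangential derivatives of the gradient are controlled by difference quotients, and
the equation determines the remaining derivative, since the graph is nowhere vertical. -/
theorem HasWeakGrad.testBounded_epigraph (hγ : IsGraphFun e γ) {U k : Euc d → ℝ}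
    {g Fv : Euc d → Euc d} (hU : HasWeakGrad (epigraph e γ) U g)
    (hk : MemLp k 2 (volume.restrict (epigraph e γ)))
    (hFm : MemLp Fv 2 (volume.restrict (epigraph e γ)))
    (hF : ∀ v, ∃ q, HasWeakGrad (epigraph e γ) (fun x => inner ℝ (Fv x) v) q)
    (heq : ∀ φ p, HasWeakGrad (epigraph e γ) φ p →
      ∫ x in epigraph e γ, inner ℝ (g x - Fv x) (p x) = ∫ x in epigraph e γ, k x * φ x)
    (v w : Euc d) :
    TestBounded (epigraph e γ)
      (fun φ => ∫ x in epigraph e γ, inner ℝ (g x) v * fderiv ℝ φ x w) := by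
  set D := epigraph e γ
  have hDo : IsOpen D := hγ.isOpen_epigraph
  obtain ⟨L, hL0, hL⟩ := hγ.bounded
  have hg := hU.memLp_grad
  have hgv := fun v => memLp_inner_const hg v
  have hX := fun τ => hγ.memLp_inner_flowField (τ := τ) hg
  -- `n w` does not depend on the `e`-component, so it passes through derivatives along `e`
  let n : Euc d → Euc d → ℝ := fun w x => inner ℝ (normalField e γ x) w
  have hn : ∀ w, ContDiff ℝ ∞ (n w) := fun w => hγ.contDiff_normalField.inner ℝ contDiff_const
  have hninv : ∀ w (y : Euc d) (t : ℝ), n w (y + t • e) = n w y := fun w y t => by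
    simp only [n, hγ.normalField_invariant]
  have hnb : ∀ w x, |n w x| ≤ (1 + L) * ‖w‖ := fun w x =>
    (abs_real_inner_le_norm _ _).trans
      (mul_le_mul_of_nonneg_right (hγ.norm_normalField_le hL x) (norm_nonneg _))
  let t : Euc d → Euc d := fun w => w - inner ℝ w e • e
  have hdec : ∀ w x, flowField γ e (t w) x + n w x • e = w := fun w x =>
    hγ.flowField_add_normal w x
  -- derivatives along tangential flows
  have hT : ∀ v w, TestBounded D
      (fun φ => ∫ x in D, inner ℝ (g x) v * fderiv ℝ φ x (flowField γ e (t w) x)) := by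
    intro v w
    have hinv : FlowInvariant γ e (t w) D := hγ.flowInvariant_epigraph (hγ.inner_tangential w)
    obtain ⟨C, hC⟩ := hU.l2_grad_comp_flow_sub_le hDo hγ hinv hk hFm
      (exists_l2_comp_flow_sub_le hDo hγ hinv hFm hF) heq
    refine TestBounded.of_le (C := ‖v‖ * C) fun φ hφ => ?_
    refine abs_integral_flowField_le hγ hinv (hgv v) (fun h => ?_) hφ
    rw [mul_assoc]
    refine (l2_le_of_norm_le (norm_nonneg v) ((memLp_comp_flow hγ hinv h hg).sub hg)
      (Eventually.of_forall fun x => ?_)).trans (mul_le_mul_of_nonneg_left (hC h) (norm_nonneg v))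
    rw [← inner_sub_left, mul_comm]
    exact norm_inner_le_norm _ _
  -- mixed derivatives, by exchanging the order
  have hN : ∀ w, TestBounded D
      (fun φ => ∫ x in D, inner ℝ (g x) (flowField γ e (t w) x) * fderiv ℝ φ x e) := by
    intro w
    refine (hT e w).congr fun φ hφ => ?_
    have h1 := hU.integral_flowField (τ := t w) hγ (hφ.dirDeriv e)
    have h2 := hU.integral_eq _ (hγ.isTest_flowField (τ := t w) hφ) e
    simp only [hγ.fderiv_flowField_comm hφ] at h1
    linarith
  -- the equation, with the divergence of `Fv` moved to the right-hand side
  have hE : TestBounded D (fun φ => ∫ x in D, inner ℝ (g x) (gradient φ x)) := by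
    choose q hq using hF
    refine ((TestBounded.integral_mul hk).sub (TestBounded.sum (s := Finset.univ) fun i _ =>
      TestBounded.integral_mul (memLp_inner_const (hq (EuclideanSpace.single i 1)).memLp_grad
        (EuclideanSpace.single i 1)))).congr fun φ hφ => ?_
    have h1 := heq φ _ hφ.hasWeakGrad
    rw [integral_inner_sub_left hg hFm hφ.hasWeakGrad.memLp_grad] at h1
    have h2 : ∫ x in D, inner ℝ (Fv x) (gradient φ x) = - ∑ i, ∫ x in D,
        inner ℝ (q (EuclideanSpace.single i 1) x) (EuclideanSpace.single i 1) * φ x := by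
      have h3 : ∀ x, inner ℝ (Fv x) (gradient φ x) = ∑ i, inner ℝ (Fv x) (EuclideanSpace.single i 1)
          * fderiv ℝ φ x (EuclideanSpace.single i 1) := fun x => by
        rw [inner_eq_sum (Fv x) (gradient φ x)]
        simp only [← inner_gradient, inner_single_right]
      simp only [h3]
      rw [integral_finsetSum _ fun i _ => integrable_mul_of_memLp (hq _).memLp
        ((hφ.dirDeriv _).memLp 2), ← Finset.sum_neg_distrib]
      exact Finset.sum_congr rfl fun i _ => (hq _).integral_eq φ hφ _
    rw [h2] at h1
    linarith
  -- subtracting the tangential derivatives from the equation leaves the derivative along `e` of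
  -- the component of the gradient normal to the graph
  have hS1 : TestBounded D
      (fun φ => ∫ x in D, inner ℝ (g x) (normalField e γ x) * fderiv ℝ φ x e) := by
    refine (hE.sub (TestBounded.sum (s := Finset.univ) fun i _ =>
      hT (EuclideanSpace.single i 1) (EuclideanSpace.single i 1))).congr fun φ hφ => ?_
    rw [← integral_finsetSum _ fun i _ => integrable_mul_of_memLp (hgv _)
      ((hγ.isTest_flowField hφ).memLp 2), ← integral_sub (integrable_inner hg
      hφ.hasWeakGrad.memLp_grad) (integrable_finsetSum _ fun i _ => integrable_mul_of_memLp (hgv _)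
      ((hγ.isTest_flowField hφ).memLp 2))]
    refine integral_congr_ae (Eventually.of_forall fun x => ?_)
    beta_reduce
    rw [inner_eq_sum (g x) (gradient φ x), inner_eq_sum (g x) (normalField e γ x)]
    simp only [inner_single_right]
    rw [Finset.sum_mul, ← Finset.sum_sub_distrib]
    refine Finset.sum_congr rfl fun i _ => ?_
    have h1 := congrArg (fderiv ℝ φ x) (hdec (EuclideanSpace.single i 1) x)
    rw [map_add, map_smul, smul_eq_mul] at h1
    have h2 : gradient φ x i = fderiv ℝ φ x (EuclideanSpace.single i 1) := by
      rw [← inner_gradient, inner_single_right]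
    have h3 : n (EuclideanSpace.single i 1) x = normalField e γ x i := inner_single_right _ _
    rw [h2, ← h1, h3]
    ring
  have hS2 : TestBounded D (fun φ => ∫ x in D, inner ℝ (g x) e *
      (inner ℝ (normalField e γ x) (normalField e γ x) * fderiv ℝ φ x e)) := by
    refine (hS1.sub (TestBounded.sum (s := Finset.univ) fun i _ =>
      (hN (EuclideanSpace.single i 1)).comp_mul (hn (EuclideanSpace.single i 1))
        (hnb (EuclideanSpace.single i 1)))).congr fun φ hφ => ?_
    have hi : ∀ i ∈ Finset.univ, Integrable (fun x =>
        inner ℝ (g x) (flowField γ e (t (EuclideanSpace.single i 1)) x) *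
        fderiv ℝ (fun y => n (EuclideanSpace.single i 1) y * φ y) x e) (volume.restrict D) :=
      fun i _ => integrable_mul_of_memLp (hX _) (((hφ.mul_left (hn _)).dirDeriv e).memLp 2)
    have hi' : Integrable (fun x => inner ℝ (g x) (normalField e γ x) * fderiv ℝ φ x e)
        (volume.restrict D) := by
      have h1 : ∀ x, inner ℝ (g x) (normalField e γ x) * fderiv ℝ φ x e = ∑ i,
          inner ℝ (g x) (EuclideanSpace.single i 1) *
            (n (EuclideanSpace.single i 1) x * fderiv ℝ φ x e) := fun x => by
        rw [inner_eq_sum (g x) (normalField e γ x)]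
        simp only [n, inner_single_right, Finset.sum_mul, mul_assoc]
      simp only [h1]
      exact integrable_finsetSum _ fun i _ => integrable_mul_of_memLp (hgv _)
        (((hφ.dirDeriv e).mul_left (hn _)).memLp 2)
    rw [← integral_finsetSum _ hi, ← integral_sub hi' (integrable_finsetSum _ hi)]
    refine integral_congr_ae (Eventually.of_forall fun x => ?_)
    simp only [fderiv_mul_of_invariant (hn _) (hninv _) hφ]
    have h1 : ∀ i, inner ℝ (g x) (flowField γ e (t (EuclideanSpace.single i 1)) x) =
        g x i - normalField e γ x i * inner ℝ (g x) e := fun i => by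
      have h2 := congrArg (inner ℝ (g x)) (hdec (EuclideanSpace.single i 1) x)
      rw [inner_add_right, inner_smul_right, inner_single_right] at h2
      simp only [n, inner_single_right] at h2
      linarith
    simp only [h1, n, inner_single_right]
    rw [inner_eq_sum (g x) (normalField e γ x),
      inner_eq_sum (normalField e γ x) (normalField e γ x),
      Finset.sum_mul, Finset.sum_mul, Finset.mul_sum, ← Finset.sum_sub_distrib]
    refine Finset.sum_congr rfl fun i _ => ?_
    ring
  -- `‖n‖ ≥ 1`, so the factor can be absorbed into the test function
  have hS3 : TestBounded D (fun φ => ∫ x in D, inner ℝ (g x) e * fderiv ℝ φ x e) := by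
    have hpos : ∀ x, inner ℝ (normalField e γ x) (normalField e γ x) ≠ (0 : ℝ) := fun x =>
      (zero_lt_one.trans_le (hγ.one_le_inner_normalField x)).ne'
    have hb : ContDiff ℝ ∞ (fun x => (inner ℝ (normalField e γ x) (normalField e γ x) : ℝ)⁻¹) :=
      (hγ.contDiff_normalField.inner ℝ hγ.contDiff_normalField).inv hpos
    refine (hS2.comp_mul hb (K := 1) fun x => ?_).congr fun φ hφ => ?_
    · have h1 := hγ.one_le_inner_normalField x
      rw [abs_inv, abs_of_nonneg (zero_le_one.trans h1)]
      exact inv_le_one_of_one_le₀ h1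
    · refine integral_congr_ae (Eventually.of_forall fun x => ?_)
      simp only
      rw [fderiv_mul_of_invariant hb (fun y t => by rw [hγ.normalField_invariant]) hφ,
        mul_inv_cancel_left₀ (hpos x)]
  have hS4 : ∀ v, TestBounded D (fun φ => ∫ x in D, inner ℝ (g x) v * fderiv ℝ φ x e) := by
    intro v
    refine ((hN v).add (hS3.comp_mul (hn v) (hnb v))).congr fun φ hφ => ?_
    rw [← integral_add (integrable_mul_of_memLp (hX _) ((hφ.dirDeriv e).memLp 2))
      (integrable_mul_of_memLp (hgv e) (((hφ.mul_left (hn v)).dirDeriv e).memLp 2))]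
    refine integral_congr_ae (Eventually.of_forall fun x => ?_)
    simp only [fderiv_mul_of_invariant (hn _) (hninv _) hφ]
    nth_rewrite 1 [← hdec v x]
    rw [inner_add_right, inner_smul_right]
    ring
  refine ((hT v w).add ((hS4 v).comp_mul (hn w) (hnb w))).congr fun φ hφ => ?_
  rw [← integral_add (integrable_mul_of_memLp (hgv v) ((hγ.isTest_flowField hφ).memLp 2))
    (integrable_mul_of_memLp (hgv v) (((hφ.mul_left (hn w)).dirDeriv e).memLp 2))]
  refine integral_congr_ae (Eventually.of_forall fun x => ?_)
  simp only [fderiv_mul_of_invariant (hn _) (hninv _) hφ]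
  nth_rewrite 1 [← hdec w x]
  rw [map_add, map_smul, smul_eq_mul]
  ring

end Normal

/-! ### Regularity of weak solutions of the Neumann problem -/

section Regularity

variable {d : ℕ} {Ω D D' B : Set (Euc d)}

theorem memLp_restrict_congr {V : Type*} [NormedAddCommGroup V] (hB : MeasurableSet B)
    (hD : D ∩ B = D' ∩ B) {f : Euc d → V} (hf : ∀ x ∉ B, f x = 0)
    (hm : MemLp f 2 (volume.restrict D)) : MemLp f 2 (volume.restrict D') := by
  have h : f = B.indicator f := by
    ext x
    by_cases hx : x ∈ B <;> simp [hx, hf]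
  rw [h, memLp_indicator_iff_restrict hB, ← restrict_indicator_congr hB hD,
    ← memLp_indicator_iff_restrict hB, ← h]
  exact hm

theorem IsTest.memLp_inner_gradient {ζ : Euc d → ℝ} (hζ : IsTest B ζ) {μ : Measure (Euc d)}
    {g : Euc d → Euc d} (hg : MemLp g 2 μ) : MemLp (fun x => inner ℝ (g x) (gradient ζ x)) 2 μ := by
  obtain ⟨C, -, hC⟩ := hζ.exists_gradient_bound
  refine hg.of_le_mul (c := C)
    (hg.1.inner hζ.contDiff_gradient.continuous.aestronglyMeasurable)
    (Eventually.of_forall fun x => ?_)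
  refine (norm_inner_le_norm _ _).trans ?_
  rw [mul_comm]
  exact mul_le_mul_of_nonneg_right (hC x) (norm_nonneg _)

/-- Second derivatives of a weak solution are locally bounded in `L²` near each point of the
closure of the domain, by localization to the region above a graph. -/
theorem IsSmoothBoundedDomain.exists_local_bound (hd : 1 ≤ d) (hΩ : IsSmoothBoundedDomain Ω)
    {u f : Euc d → ℝ} {g : Euc d → Euc d} (hu : HasWeakGrad Ω u g)
    (hf : MemLp f 2 (volume.restrict Ω))
    (heq : ∀ φ p, HasWeakGrad Ω φ p → ∫ x in Ω, inner ℝ (g x) (p x) = ∫ x in Ω, f x * φ x)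
    {x₀ : Euc d} (hx₀ : x₀ ∈ closure Ω) :
    ∃ r, 0 < r ∧ ∀ v w, ∃ C, 0 ≤ C ∧ ∀ φ, IsTest (Ω ∩ Metric.ball x₀ r) φ →
      |∫ x in Ω, inner ℝ (g x) v * fderiv ℝ φ x w| ≤ C * l2 (volume.restrict Ω) φ := by
  obtain ⟨e, γ, r, hr, hγ, hD⟩ := hΩ.exists_chart hd hx₀
  obtain ⟨ζ, hζ, hζ1⟩ := exists_test_eq_one x₀ hr
  set B := Metric.ball x₀ r
  have hB : MeasurableSet B := measurableSet_ball
  have hζ0 : ∀ x ∉ B, ζ x = 0 := fun x hx => hζ.eq_zero hx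
  have hζ0' : ∀ x ∉ B, gradient ζ x = 0 := fun x hx => hζ.gradient_eq_zero hx
  have hg := hu.memLp_grad
  -- `ζ u` solves a Neumann problem above the graph with right-hand side `k + div (u ∇ζ)`
  set k : Euc d → ℝ := fun x => ζ x * f x - inner ℝ (g x) (gradient ζ x)
  have hk0 : ∀ x ∉ B, k x = 0 := fun x hx => by
    simp only [k]
    rw [hζ0 x hx, hζ0' x hx, zero_mul, inner_zero_right, sub_zero]
  have hk : MemLp k 2 (volume.restrict (epigraph e γ)) :=
    memLp_restrict_congr hB hD hk0 ((hζ.memLp_mul hf).sub (hζ.memLp_inner_gradient hg))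
  have hFm : MemLp (fun x => u x • gradient ζ x) 2 (volume.restrict (epigraph e γ)) :=
    memLp_restrict_congr hB hD (fun x hx => by rw [hζ0' x hx, smul_zero])
      (memLp_smul_gradient hζ hu.memLp)
  have hζg : MemLp (fun x => ζ x • g x) 2 (volume.restrict (epigraph e γ)) :=
    memLp_restrict_congr hB hD (fun x hx => by rw [hζ0 x hx, zero_smul]) (hζ.memLp_smul hg)
  have hF : ∀ v, ∃ q, HasWeakGrad (epigraph e γ) (fun x => inner ℝ (u x • gradient ζ x) v) q := by
    intro v
    have h1 : (fun x => inner ℝ (u x • gradient ζ x) v) = fun x => fderiv ℝ ζ x v * u x := by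
      funext x
      rw [real_inner_smul_left, inner_gradient, mul_comm]
    rw [h1]
    exact ⟨_, hu.mul_test hB hD (hζ.dirDeriv v)⟩
  have heq' : ∀ φ p, HasWeakGrad (epigraph e γ) φ p → ∫ x in epigraph e γ,
      inner ℝ (ζ x • g x + u x • gradient ζ x - u x • gradient ζ x) (p x) =
        ∫ x in epigraph e γ, k x * φ x := by
    intro φ p hφ
    have h1 := hφ.mul_test hB hD.symm hζ
    have h2 := heq _ _ h1
    simp only [add_sub_cancel_right]
    have h3 : ∀ x, inner ℝ (ζ x • g x) (p x) - k x * φ x =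
        inner ℝ (g x) (ζ x • p x + φ x • gradient ζ x) - f x * (ζ x * φ x) := fun x => by
      simp only [k, inner_add_right, real_inner_smul_left, inner_smul_right]
      ring
    have h4 : ∫ x in epigraph e γ, (inner ℝ (ζ x • g x) (p x) - k x * φ x) = 0 := by
      rw [integral_restrict_congr hB hD.symm
        (fun x hx => by rw [hζ0 x hx, hk0 x hx, zero_smul, inner_zero_left]; ring)]
      simp only [h3]
      rw [integral_sub (integrable_inner hg h1.memLp_grad) (integrable_mul_of_memLp hf h1.memLp),
        h2, sub_self]
    rw [integral_sub (integrable_inner hζg hφ.memLp_grad)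
      (integrable_mul_of_memLp hk hφ.memLp)] at h4
    linarith
  refine ⟨r / 2, by positivity, fun v w => ?_⟩
  obtain ⟨C, hC, h⟩ :=
    (hu.mul_test hB hD hζ).testBounded_epigraph hγ hk hFm hF heq' v w
  refine ⟨C, hC, fun φ hφ => ?_⟩
  have hsub : Metric.ball x₀ (r / 2) ⊆ B := Metric.ball_subset_ball (by linarith)
  have hφB : IsTest B φ := hφ.mono fun x hx => hsub hx.2
  have hφG : IsTest (epigraph e γ) φ := hφ.mono fun x hx =>
    (hD.subset ⟨hx.1, hsub hx.2⟩ : x ∈ epigraph e γ ∩ B).1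
  have h1 := h φ hφG
  rw [l2_restrict_congr hB hD.symm (fun x hx => hφB.eq_zero hx)] at h1
  refine le_trans (le_of_eq ?_) h1
  congr 1
  rw [integral_restrict_congr hB hD
    (fun x hx => by rw [(hφB.dirDeriv w).eq_zero hx, mul_zero])]
  refine integral_congr_ae (Eventually.of_forall fun x => ?_)
  by_cases hx : x ∈ Metric.ball x₀ (r / 2)
  · have h2 : gradient ζ x = 0 := by
      have h3 : ζ =ᶠ[𝓝 x] fun _ => (1 : ℝ) := by
        filter_upwards [Metric.isOpen_ball.mem_nhds hx] with y hy using hζ1 y hy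
      rw [gradient, h3.fderiv_eq, fderiv_fun_const]
      simp
    simp only [hζ1 x hx, h2, one_smul, smul_zero, add_zero]
  · have h2 : fderiv ℝ φ x w = 0 := (hφ.dirDeriv w).eq_zero fun h' => hx h'.2
    simp only [h2, mul_zero]

open scoped Manifold in
/-- The local bounds are glued with a partition of unity on the closure of the domain. -/
theorem IsSmoothBoundedDomain.testBounded_of_weak (hd : 1 ≤ d) (hΩ : IsSmoothBoundedDomain Ω)
    {u f : Euc d → ℝ} {g : Euc d → Euc d} (hu : HasWeakGrad Ω u g)
    (hf : MemLp f 2 (volume.restrict Ω))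
    (heq : ∀ φ p, HasWeakGrad Ω φ p → ∫ x in Ω, inner ℝ (g x) (p x) = ∫ x in Ω, f x * φ x)
    (v w : Euc d) : TestBounded Ω (fun φ => ∫ x in Ω, inner ℝ (g x) v * fderiv ℝ φ x w) := by
  have hloc := fun x : closure Ω => hΩ.exists_local_bound hd hu hf heq x.2
  choose r hr hbd using hloc
  have hc : IsCompact (closure Ω) := hΩ.isBounded.isCompact_closure
  obtain ⟨s, hs⟩ := hc.elim_finite_subcover (fun x : closure Ω => Metric.ball (x : Euc d) (r x))
    (fun _ => Metric.isOpen_ball) fun x hx => mem_iUnion.2 ⟨⟨x, hx⟩, Metric.mem_ball_self (hr _)⟩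
  obtain ⟨ρ, hρ⟩ := SmoothPartitionOfUnity.exists_isSubordinate 𝓘(ℝ, Euc d) isClosed_closure
    (fun x : s => Metric.ball ((x : closure Ω) : Euc d) (r x)) (fun _ => Metric.isOpen_ball)
    (fun x hx => by
      obtain ⟨i, hi, hx'⟩ := mem_iUnion₂.1 (hs hx)
      exact mem_iUnion.2 ⟨⟨i, hi⟩, hx'⟩)
  have hsm : ∀ i, ContDiff ℝ ∞ (ρ i) := fun i => (ρ i).contMDiff.contDiff
  have htest : ∀ (i : s) φ, IsTest Ω φ →
      IsTest (Ω ∩ Metric.ball ((i : closure Ω) : Euc d) (r i)) (fun x => ρ i x * φ x) :=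
    fun i φ hφ => ⟨(hφ.mul_left (hsm i)).contDiff, (hφ.mul_left (hsm i)).compact,
      subset_inter (hφ.mul_left (hsm i)).subset (tsupport_mul_subset_left.trans (hρ i))⟩
  have hpart : ∀ i ∈ (Finset.univ : Finset s), TestBounded Ω
      (fun φ => ∫ x in Ω, inner ℝ (g x) v * fderiv ℝ (fun y => ρ i y * φ y) x w) := by
    intro i _
    obtain ⟨C, hC, h⟩ := hbd i v w
    refine ⟨C, hC, fun φ hφ => (h _ (htest i φ hφ)).trans (mul_le_mul_of_nonneg_left
      (l2_mono (hφ.memLp 2) (Eventually.of_forall fun x => ?_)) hC)⟩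
    rw [norm_mul, Real.norm_of_nonneg (ρ.nonneg i x)]
    exact mul_le_of_le_one_left (norm_nonneg _) (ρ.le_one i x)
  refine (TestBounded.sum hpart).congr fun φ hφ => ?_
  rw [← integral_finsetSum _ fun i _ => integrable_mul_of_memLp (memLp_inner_const hu.memLp_grad v)
    (((hφ.mul_left (hsm i)).dirDeriv w).memLp 2)]
  refine integral_congr_ae (Eventually.of_forall fun x => ?_)
  have h1 : φ = fun y => ∑ i : s, ρ i y * φ y := by
    funext y
    rw [← Finset.sum_mul]
    by_cases hy : y ∈ Ω
    · have h2 := ρ.sum_eq_one (subset_closure hy)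
      rw [finsum_eq_sum_of_fintype] at h2
      rw [h2, one_mul]
    · rw [hφ.eq_zero hy, mul_zero]
  beta_reduce
  rw [← Finset.mul_sum]
  congr 1
  conv_lhs => rw [h1]
  rw [fderiv_fun_sum fun i _ => (hφ.mul_left (hsm i)).differentiable x]
  simp

/-- Weak solutions of the Neumann problem lie in `H²` and satisfy the boundary condition. -/
theorem IsSmoothBoundedDomain.memH2N_of_weak (hd : 1 ≤ d) (hΩ : IsSmoothBoundedDomain Ω)
    {u f : Euc d → ℝ} {g : Euc d → Euc d} (hu : HasWeakGrad Ω u g)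
    (hf : MemLp f 2 (volume.restrict Ω))
    (heq : ∀ φ p, HasWeakGrad Ω φ p → ∫ x in Ω, inner ℝ (g x) (p x) = ∫ x in Ω, f x * φ x) :
    MemH2N Ω u ∧ ∀ᵐ x ∂(volume.restrict Ω), - laplacian Ω u x = f x := by
  have hderiv : ∀ i : Fin d, ∃ q, HasWeakGrad Ω (weakDeriv Ω i u) q := by
    intro i
    have hb := fun j : Fin d => hΩ.testBounded_of_weak hd hu hf heq (EuclideanSpace.single i 1)
      (EuclideanSpace.single j 1)
    choose C hC hb using hb
    obtain ⟨q, hq⟩ := exists_hasWeakGrad (C := ∑ j, C j)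
      (memLp_inner_const hu.memLp_grad (EuclideanSpace.single i 1)) fun j φ hφ =>
      (hb j φ hφ).trans (mul_le_mul_of_nonneg_right
        (Finset.single_le_sum (fun j _ => hC j) (Finset.mem_univ j)) (l2_nonneg _))
    refine ⟨q, hq.congr ?_⟩
    filter_upwards [hu.weakDeriv_ae hΩ.isOpen] with x hx
    rw [hx i, inner_single_right]
  have hH2 : MemH2 Ω u := ⟨hu.memH1, fun i => (hderiv i).choose_spec.memH1⟩
  have hlap : laplacian Ω u =ᵐ[volume.restrict Ω] fun x => - f x := by
    have h0 := ae_eq_zero_of_integral_test hΩ.isOpen (hH2.memLp_laplacian.add hf) fun φ hφ => ?_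
    · filter_upwards [h0] with x hx
      exact eq_neg_of_add_eq_zero_left hx
    · have h1 := heq _ _ hφ.hasWeakGrad
      have h2 : ∫ x in Ω, inner ℝ (g x) (gradient φ x) = - ∫ x in Ω, laplacian Ω u x * φ x := by
        have h3 : ∀ i : Fin d,
            ∫ x in Ω, weakDeriv Ω i u x * fderiv ℝ φ x (EuclideanSpace.single i 1) =
              - ∫ x in Ω, weakDeriv Ω i (weakDeriv Ω i u) x * φ x := fun i =>
          (isL2WeakDeriv_weakDeriv (hH2.2 i) i).2 φ hφ.contDiff hφ.compact hφ.subset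
        have h4 : ∫ x in Ω, inner ℝ (g x) (gradient φ x) = ∫ x in Ω, ∑ i,
            weakDeriv Ω i u x * fderiv ℝ φ x (EuclideanSpace.single i 1) := by
          refine integral_congr_ae ?_
          filter_upwards [hu.weakDeriv_ae hΩ.isOpen] with x hx
          rw [inner_eq_sum]
          refine Finset.sum_congr rfl fun i _ => ?_
          rw [hx i, ← inner_gradient, inner_single_right]
        rw [h4, integral_finsetSum _ fun i _ => integrable_mul_of_memLp (hH2.2 i).1
          ((hφ.dirDeriv _).memLp 2)]
        simp only [h3]
        simp only [laplacian, Finset.sum_mul]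
        rw [integral_finsetSum _ fun i _ => integrable_mul_of_memLp
          (isL2WeakDeriv_weakDeriv (hH2.2 i) i).1 (hφ.memLp 2), Finset.sum_neg_distrib]
      simp only [Pi.add_apply, add_mul]
      rw [integral_add (integrable_mul_of_memLp hH2.memLp_laplacian (hφ.memLp 2))
        (integrable_mul_of_memLp hf (hφ.memLp 2))]
      linarith
  refine ⟨⟨hH2, fun φ hφ => ?_⟩, ?_⟩
  · rw [hu.integral_gradInner hΩ.isOpen hφ.hasWeakGrad, heq _ _ hφ.hasWeakGrad]
    have h1 : ∫ x in Ω, laplacian Ω u x * φ x = ∫ x in Ω, - (f x * φ x) := by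
      refine integral_congr_ae ?_
      filter_upwards [hlap] with x hx
      rw [hx, neg_mul]
    rw [h1, integral_neg, add_neg_cancel]
  · filter_upwards [hlap] with x hx
    rw [hx, neg_neg]

/-- Every `f ∈ L²(Ω)` of mean value zero is `-Δu` for some `u ∈ H²_N(Ω)`. -/
theorem IsSmoothBoundedDomain.isNeumannSolution_neumannInv (hd : 1 ≤ d)
    (hΩ : IsSmoothBoundedDomain Ω) {f : Euc d → ℝ} (hf : MemLp f 2 (volume.restrict Ω))
    (hf0 : ∫ x in Ω, f x = 0) : IsNeumannSolution Ω f (neumannInv Ω f) := by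
  obtain ⟨u, g, hu, hu0, heq⟩ := hΩ.exists_weak_solution hd hf hf0
  have h1 := hΩ.memH2N_of_weak hd hu hf heq
  have h2 : ∃ u, IsNeumannSolution Ω f u := ⟨u, h1.1, h1.2, by rw [mean, hu0, mul_zero]⟩
  rw [neumannInv, dif_pos h2]
  exact h2.choose_spec

end Regularity

/-! ### The double-well potential -/

section Potential

theorem deriv_W (a r : ℝ) : deriv (W a) r = a * ((r ^ 2 - 1) * r) := by
  have h1 : HasDerivAt (fun r : ℝ => r ^ 2 - 1) (2 * r) r := by
    simpa using (hasDerivAt_pow 2 r).sub_const 1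
  have h2 := (h1.pow 2).const_mul (a / 4)
  have h3 : HasDerivAt (W a) (a / 4 * (↑2 * (r ^ 2 - 1) ^ (2 - 1) * (2 * r))) r := h2
  rw [h3.deriv]
  norm_num
  ring

/-- `W'` is monotone up to a linear term, with quartic gain. -/
theorem deriv_W_sub_mul_ge {a : ℝ} (ha : 0 < a) (r s : ℝ) :
    a / 4 * ((r - s) ^ 2) ^ 2 - a * (r - s) ^ 2 ≤
      (deriv (W a) r - deriv (W a) s) * (r - s) := by
  rw [deriv_W, deriv_W]
  have h1 : (a * ((r ^ 2 - 1) * r) - a * ((s ^ 2 - 1) * s)) * (r - s) -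
      (a / 4 * ((r - s) ^ 2) ^ 2 - a * (r - s) ^ 2) = a * (3 / 4 * ((r - s) * (r + s)) ^ 2) := by
    ring
  have h2 : 0 ≤ a * (3 / 4 * ((r - s) * (r + s)) ^ 2) := by positivity
  linarith

/-- Coercivity of `W'` about `α`. The constant comes from completing squares in the quartic
polynomial `W(r) - W'(r)(r - α)`, whose leading coefficient `-3a/4` is negative. -/
theorem W_le_deriv_W_mul {a : ℝ} (ha : 0 < a) (α r : ℝ) :
    W a r ≤ deriv (W a) r * (r - α) + a * ((α ^ 2 + 1) ^ 2 / 2 + α ^ 2 / 2 + 1 / 4) := by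
  rw [deriv_W, W]
  have h1 : a * ((r ^ 2 - 1) * r) * (r - α) + a * ((α ^ 2 + 1) ^ 2 / 2 + α ^ 2 / 2 + 1 / 4) -
      a / 4 * (r ^ 2 - 1) ^ 2 = a * ((r ^ 2 / 2 - α * r) ^ 2 + (r + α) ^ 2 / 2 +
        (r ^ 2 - (α ^ 2 + 1)) ^ 2 / 2) := by ring
  have h2 : 0 ≤ a * ((r ^ 2 / 2 - α * r) ^ 2 + (r + α) ^ 2 / 2 +
        (r ^ 2 - (α ^ 2 + 1)) ^ 2 / 2) := by positivity
  linarith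

variable {d : ℕ} {μ : Measure (Euc d)} {u w ψ : Euc d → ℝ}

theorem memLp_mul_four (hu : MemLp u 4 μ) (hw : MemLp w 4 μ) : MemLp (fun x => u x * w x) 2 μ := by
  have : ENNReal.HolderTriple 4 4 2 := ⟨by
    rw [← two_mul, show (4 : ENNReal) = 2 * 2 by norm_num,
      ENNReal.mul_inv (Or.inl (by norm_num)) (Or.inl (by norm_num)), ← mul_assoc,
      ENNReal.mul_inv_cancel (by norm_num) (by norm_num), one_mul]⟩
  exact hw.mul hu

theorem l2_mul_sq_le (hu : MemLp u 4 μ) (hw : MemLp w 4 μ) :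
    l2 μ (fun x => u x * w x) ^ 2 ≤ l2 μ (fun x => u x * u x) * l2 μ (fun x => w x * w x) := by
  rw [l2_sq (memLp_mul_four hu hw)]
  have h1 : ∀ x, ‖u x * w x‖ ^ 2 = (u x * u x) * (w x * w x) := fun x => by
    rw [Real.norm_eq_abs, sq_abs]
    ring
  simp only [h1]
  exact (le_abs_self _).trans (abs_integral_mul_le (memLp_mul_four hu hu) (memLp_mul_four hw hw))

theorem memLp_four_of_six [IsFiniteMeasure μ] (hu : MemLp u 6 μ) : MemLp u 4 μ :=
  hu.mono_exponent (by norm_num)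

theorem memLp_sq_sub_one [IsFiniteMeasure μ] (hu : MemLp u 4 μ) :
    MemLp (fun x => u x ^ 2 - 1) 2 μ := by
  have := (memLp_mul_four hu hu).sub (memLp_const (1 : ℝ))
  simp only [← sq] at this
  exact this

theorem integrable_W [IsFiniteMeasure μ] (a : ℝ) (hu : MemLp u 4 μ) :
    Integrable (fun x => W a (u x)) μ := by
  have h1 := integrable_mul_of_memLp (memLp_sq_sub_one hu) (memLp_sq_sub_one hu)
  refine (h1.const_mul (a / 4)).congr (Eventually.of_forall fun x => ?_)
  simp only [W]
  ring

theorem memLp_deriv_W [IsFiniteMeasure μ] (a : ℝ) (hu : MemLp u 6 μ) :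
    MemLp (fun x => deriv (W a) (u x)) 2 μ := by
  have h3 : MemLp (fun x => u x ^ 3) 2 μ := by
    refine (memLp_two_iff_integrable_sq (hu.1.pow 3)).2 ?_
    have := hu.integrable_norm_pow (p := 6) (by norm_num)
    refine this.congr (Eventually.of_forall fun x => ?_)
    change ‖u x‖ ^ 6 = (u x ^ 3) ^ 2
    rw [Real.norm_eq_abs, show |u x| ^ 6 = (|u x| ^ 2) ^ 3 by ring, sq_abs]
    ring
  have h1 : MemLp u 2 μ := hu.mono_exponent (by norm_num)
  have h4 := (h3.sub h1).const_mul a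
  refine h4.ae_eq (Eventually.of_forall fun x => ?_)
  simp only [deriv_W, Pi.sub_apply]
  ring

/-- Convergence in `L⁴`, expressed through the `L²` norm of the square, passes to the potential
energy and to the nonlinearity. -/
theorem tendsto_potential [IsFiniteMeasure μ] (a : ℝ) {v : ℕ → Euc d → ℝ}
    (hv : ∀ n, MemLp (v n) 4 μ) (hw : MemLp w 4 μ)
    (hlim : Tendsto (fun n => l2 μ (fun x => (v n x - w x) * (v n x - w x))) atTop (𝓝 0)) :
    Tendsto (fun n => ∫ x, W a (v n x) ∂μ) atTop (𝓝 (∫ x, W a (w x) ∂μ)) ∧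
    ∀ ψ, MemLp ψ 4 μ → Tendsto (fun n => ∫ x, deriv (W a) (v n x) * ψ x ∂μ) atTop
      (𝓝 (∫ x, deriv (W a) (w x) * ψ x ∂μ)) := by
  have hφ : ∀ n, MemLp (fun x => v n x - w x) 4 μ := fun n => (hv n).sub hw
  have hmul : ∀ ψ, MemLp ψ 4 μ →
      Tendsto (fun n => l2 μ (fun x => (v n x - w x) * ψ x)) atTop (𝓝 0) := by
    intro ψ hψ
    have h1 : Tendsto (fun n => Real.sqrt (l2 μ (fun x => (v n x - w x) * (v n x - w x)) *
        l2 μ (fun x => ψ x * ψ x))) atTop (𝓝 0) := by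
      have h2 := (Real.continuous_sqrt.tendsto _).comp (hlim.mul_const (l2 μ (fun x => ψ x * ψ x)))
      rw [zero_mul, Real.sqrt_zero] at h2
      exact h2
    exact squeeze_zero (fun n => l2_nonneg _)
      (fun n => Real.le_sqrt_of_sq_le (l2_mul_sq_le (hφ n) hψ)) h1
  -- the difference of the squares
  let D : ℕ → Euc d → ℝ := fun n x => (v n x - w x) * (v n x - w x) + 2 * ((v n x - w x) * w x)
  have hDm : ∀ n, MemLp (D n) 2 μ := fun n =>
    (memLp_mul_four (hφ n) (hφ n)).add ((memLp_mul_four (hφ n) hw).const_mul 2)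
  have hD : Tendsto (fun n => l2 μ (D n)) atTop (𝓝 0) := by
    have h1 := hlim.add ((hmul w hw).const_mul 2)
    rw [mul_zero, add_zero] at h1
    refine squeeze_zero (fun n => l2_nonneg _) (fun n => ?_) h1
    refine (l2_add_le (memLp_mul_four (hφ n) (hφ n))
      ((memLp_mul_four (hφ n) hw).const_mul 2)).trans (add_le_add le_rfl (le_of_eq ?_))
    have h2 := l2_const_smul (μ := μ) 2 (fun x => (v n x - w x) * w x)
    rw [abs_of_pos (by norm_num : (0 : ℝ) < 2)] at h2
    exact h2
  have h1 := memLp_sq_sub_one hw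
  constructor
  · have h2 : ∀ n, ∫ x, W a (v n x) ∂μ = (∫ x, W a (w x) ∂μ) +
        a / 4 * ((∫ x, D n x * D n x ∂μ) + 2 * ∫ x, D n x * (w x ^ 2 - 1) ∂μ) := by
      intro n
      have i1 := integrable_mul_of_memLp (hDm n) (hDm n)
      have i2 := (integrable_mul_of_memLp (hDm n) h1).const_mul 2
      have i3 : Integrable (fun x => a / 4 * (D n x * D n x + 2 * (D n x * (w x ^ 2 - 1)))) μ :=
        (i1.add i2).const_mul _
      rw [← integral_const_mul, ← integral_add i1 i2, ← integral_const_mul,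
        ← integral_add (integrable_W a hw) i3]
      refine integral_congr_ae (Eventually.of_forall fun x => ?_)
      simp only [W, D]
      ring
    simp only [h2]
    have h3 : Tendsto (fun n => ∫ x, D n x * D n x ∂μ) atTop (𝓝 0) := by
      refine squeeze_zero_norm (fun n => abs_integral_mul_le (hDm n) (hDm n)) ?_
      simpa using hD.mul hD
    have h4 : Tendsto (fun n => ∫ x, D n x * (w x ^ 2 - 1) ∂μ) atTop (𝓝 0) := by
      refine squeeze_zero_norm (fun n => abs_integral_mul_le (hDm n) h1) ?_
      simpa using hD.mul_const _
    simpa using ((h3.add (h4.const_mul 2)).const_mul (a / 4)).const_add (∫ x, W a (w x) ∂μ)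
  · intro ψ hψ
    have hwψ := memLp_mul_four hw hψ
    have hφψ := fun n => memLp_mul_four (hφ n) hψ
    have h2 : ∀ n, ∫ x, deriv (W a) (v n x) * ψ x ∂μ = (∫ x, deriv (W a) (w x) * ψ x ∂μ) +
        a * ((∫ x, D n x * (w x * ψ x) ∂μ) + ((∫ x, D n x * ((v n x - w x) * ψ x) ∂μ) +
          ∫ x, (w x ^ 2 - 1) * ((v n x - w x) * ψ x) ∂μ)) := by
      intro n
      have i1 := integrable_mul_of_memLp (hDm n) hwψ
      have i2 := integrable_mul_of_memLp (hDm n) (hφψ n)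
      have i3 := integrable_mul_of_memLp h1 (hφψ n)
      have i4 : Integrable (fun x => deriv (W a) (w x) * ψ x) μ := by
        refine ((integrable_mul_of_memLp h1 hwψ).const_mul a).congr
          (Eventually.of_forall fun x => ?_)
        simp only [deriv_W]
        ring
      have i5 : Integrable (fun x => D n x * ((v n x - w x) * ψ x) +
          (w x ^ 2 - 1) * ((v n x - w x) * ψ x)) μ := i2.add i3
      have i6 : Integrable (fun x => a * (D n x * (w x * ψ x) + (D n x * ((v n x - w x) * ψ x) +
          (w x ^ 2 - 1) * ((v n x - w x) * ψ x)))) μ := (i1.add i5).const_mul a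
      rw [← integral_add i2 i3, ← integral_add i1 i5, ← integral_const_mul, ← integral_add i4 i6]
      refine integral_congr_ae (Eventually.of_forall fun x => ?_)
      simp only [deriv_W, D]
      ring
    simp only [h2]
    have h3 : Tendsto (fun n => ∫ x, D n x * (w x * ψ x) ∂μ) atTop (𝓝 0) := by
      refine squeeze_zero_norm (fun n => abs_integral_mul_le (hDm n) hwψ) ?_
      simpa using hD.mul_const _
    have h4 : Tendsto (fun n => ∫ x, D n x * ((v n x - w x) * ψ x) ∂μ) atTop (𝓝 0) := by
      refine squeeze_zero_norm (fun n => abs_integral_mul_le (hDm n) (hφψ n)) ?_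
      simpa using hD.mul (hmul ψ hψ)
    have h5 : Tendsto (fun n => ∫ x, (w x ^ 2 - 1) * ((v n x - w x) * ψ x) ∂μ) atTop (𝓝 0) := by
      refine squeeze_zero_norm (fun n => abs_integral_mul_le h1 (hφψ n)) ?_
      simpa using (hmul ψ hψ).const_mul _
    simpa using ((h3.add (h4.add h5)).const_mul a).const_add (∫ x, deriv (W a) (w x) * ψ x ∂μ)

end Potential

/-! ### Compactness of almost critical points -/

section Critical

variable {d : ℕ} {Ω : Set (Euc d)} {a α : ℝ}

theorem HasWeakGrad.F_eq (hΩ : IsOpen Ω) {u : Euc d → ℝ} {g : Euc d → Euc d}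
    (hu : HasWeakGrad Ω u g) (a : ℝ) :
    F Ω a u = l2 (volume.restrict Ω) g ^ 2 / 2 + ∫ x in Ω, W a (u x) := by
  rw [F, hu.gradNormSq_eq hΩ]

theorem memLp_residual (hd1 : 1 ≤ d) (hd3 : d ≤ 3) (hΩ : IsSmoothBoundedDomain Ω) (a : ℝ)
    {v : Euc d → ℝ} (hv : MemH2N Ω v) : MemLp (residual Ω a v) 2 (volume.restrict Ω) := by
  have := hΩ.isFiniteMeasure
  have h6 := hv.1.1.hasWeakGrad.memLp_six hd1 hd3 hΩ
  exact (hv.1.memLp_laplacian.neg.add (memLp_deriv_W a h6)).sub (memLp_const _)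

/-- The weak form of the residual of the Euler-Lagrange equation. -/
theorem integral_residual_mul (hd1 : 1 ≤ d) (hd3 : d ≤ 3) (hΩ : IsSmoothBoundedDomain Ω) (a : ℝ)
    {v φ : Euc d → ℝ} {g p : Euc d → Euc d} (hv : MemH2N Ω v) (hg : HasWeakGrad Ω v g)
    (hφ : HasWeakGrad Ω φ p) :
    ∫ x in Ω, residual Ω a v x * φ x = (∫ x in Ω, inner ℝ (g x) (p x)) +
      (∫ x in Ω, deriv (W a) (v x) * φ x) -
        mean Ω (fun y => deriv (W a) (v y)) * ∫ x in Ω, φ x := by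
  have := hΩ.isFiniteMeasure
  have h6 := hg.memLp_six hd1 hd3 hΩ
  have h1 := hv.2 φ hφ.memH1
  rw [hg.integral_gradInner hΩ.isOpen hφ] at h1
  have i1 := integrable_mul_of_memLp hv.1.memLp_laplacian hφ.memLp
  have i2 := integrable_mul_of_memLp (memLp_deriv_W a h6) hφ.memLp
  have i3 : Integrable φ (volume.restrict Ω) := hφ.memLp.integrable (by norm_num)
  have h2 : ∫ x in Ω, residual Ω a v x * φ x = ∫ x in Ω, (deriv (W a) (v x) * φ x -
      laplacian Ω v x * φ x - mean Ω (fun y => deriv (W a) (v y)) * φ x) := by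
    refine integral_congr_ae (Eventually.of_forall fun x => ?_)
    simp only [residual, chemPot]
    ring
  have i4 : Integrable (fun x => deriv (W a) (v x) * φ x - laplacian Ω v x * φ x)
      (volume.restrict Ω) := i2.sub i1
  rw [h2, integral_sub i4 (i3.const_mul _), integral_sub i2 i1, integral_const_mul]
  linarith

theorem integral_residual (hd1 : 1 ≤ d) (hd3 : d ≤ 3) (hΩ : IsSmoothBoundedDomain Ω) (a : ℝ)
    {v : Euc d → ℝ} (hv : MemH2N Ω v) : ∫ x in Ω, residual Ω a v x = 0 := by
  have h1 := integral_residual_mul hd1 hd3 hΩ a hv hv.1.1.hasWeakGrad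
    (hasWeakGrad_const hΩ.volume_ne_top 1)
  simp only [mul_one, inner_zero_right, integral_zero, zero_add, integral_const, smul_eq_mul,
    measureReal_restrict_apply_univ] at h1
  rw [h1, mean, mul_comm _ (volume.real Ω), mul_inv_cancel_left₀ hΩ.volume_real_pos.ne', sub_self]

theorem integral_eq_mean_mul (hΩ : IsSmoothBoundedDomain Ω) (u : Euc d → ℝ) :
    ∫ x in Ω, u x = mean Ω u * volume.real Ω := by
  rw [mean, mul_comm, mul_inv_cancel_left₀ hΩ.volume_real_pos.ne']

theorem tendsto_mean_of_integral {v : ℕ → Euc d → ℝ} {w : Euc d → ℝ}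
    (h : Tendsto (fun n => ∫ x in Ω, v n x) atTop (𝓝 (∫ x in Ω, w x))) :
    Tendsto (fun n => mean Ω (v n)) atTop (𝓝 (mean Ω w)) := h.const_mul _

theorem tendsto_l2_of_sub {V : Type*} [NormedAddCommGroup V] {μ : Measure (Euc d)}
    {g : ℕ → Euc d → V} {p : Euc d → V} (hg : ∀ n, MemLp (g n) 2 μ) (hp : MemLp p 2 μ)
    (h : Tendsto (fun n => l2 μ (fun x => g n x - p x)) atTop (𝓝 0)) :
    Tendsto (fun n => l2 μ (g n)) atTop (𝓝 (l2 μ p)) := by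
  rw [tendsto_iff_norm_sub_tendsto_zero]
  refine squeeze_zero (fun n => norm_nonneg _) (fun n => ?_) h
  rw [Real.norm_eq_abs, abs_sub_le_iff]
  have h1 := l2_add_le ((hg n).sub hp) hp
  have h2 := l2_sub_le (hg n) ((hg n).sub hp)
  have e1 : (fun x => (g n - p) x + p x) = g n := by
    funext x
    simp
  have e2 : (fun x => g n x - (g n - p) x) = p := by
    funext x
    simp
  rw [e1] at h1
  rw [e2] at h2
  have e3 : l2 μ (g n - p) = l2 μ (fun x => g n x - p x) := rfl
  rw [e3] at h1 h2
  constructor <;> linarith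

/-- A sequence bounded in `H¹` along which the residuals tend to zero in the dual of the space of
functions of mean value zero has a subsequence converging strongly in `H¹` and in `L⁴`.
The equation for the sequence is tested with its distance from the weak limit; the potential is
convex up to a quadratic term, which tends to zero by the Rellich theorem. -/
theorem exists_strong_limit (hd1 : 1 ≤ d) (hd3 : d ≤ 3) (hΩ : IsSmoothBoundedDomain Ω) (ha : 0 < a)
    {v : ℕ → Euc d → ℝ} {g : ℕ → Euc d → Euc d} {δ : ℕ → ℝ} {C : ℝ}
    (hv : ∀ n, MemH2N Ω (v n)) (hg : ∀ n, HasWeakGrad Ω (v n) (g n)) (hm : ∀ n, mean Ω (v n) = α)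
    (hC : ∀ n, l2 (volume.restrict Ω) (g n) ≤ C) (hδ : Tendsto δ atTop (𝓝 0))
    (hres : ∀ n φ p, HasWeakGrad Ω φ p →
      |∫ x in Ω, residual Ω a (v n) x * φ x| ≤ δ n * l2 (volume.restrict Ω) p) :
    ∃ (k : ℕ → ℕ) (w : Euc d → ℝ) (p : Euc d → Euc d), StrictMono k ∧ HasWeakGrad Ω w p ∧
      mean Ω w = α ∧
      Tendsto (fun n => l2 (volume.restrict Ω) (fun x => g (k n) x - p x)) atTop (𝓝 0) ∧
      Tendsto (fun n => l2 (volume.restrict Ω)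
        (fun x => (v (k n) x - w x) * (v (k n) x - w x))) atTop (𝓝 0) := by
  have := hΩ.isFiniteMeasure
  set μ := volume.restrict Ω
  obtain ⟨CP, hCP, hP⟩ := hΩ.poincare hd1
  have hvα : ∀ n, l2 μ (v n) ≤ CP * C + l2 μ (fun _ : Euc d => α) := by
    intro n
    have h1 := (hg n).sub (hasWeakGrad_const hΩ.volume_ne_top α)
    have h2 : ∫ x in Ω, (v n x - α) = 0 := by
      rw [integral_sub ((hg n).memLp.integrable (by norm_num)) (integrable_const _), integral_const,
        smul_eq_mul, measureReal_restrict_apply_univ, integral_eq_mean_mul hΩ, hm n]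
      ring
    have h3 := hP _ _ h1 h2
    simp only [sub_zero] at h3
    have h4 := l2_add_le h1.memLp (memLp_const α)
    simp only [sub_add_cancel] at h4
    have h5 := mul_le_mul_of_nonneg_left (hC n) hCP
    have h6 : l2 μ (fun x => v n x) = l2 μ (v n) := rfl
    rw [h6] at h4
    have h7 : l2 μ (fun x => g n x) = l2 μ (g n) := rfl
    rw [h7] at h3
    linarith
  obtain ⟨k, w, p, hk, hw, hlim, hweak⟩ := hΩ.rellich hd1 hg
    (C := max C (CP * C + l2 μ (fun _ : Euc d => α)))
    (fun n => (hvα n).trans (le_max_right _ _)) (fun n => (hC n).trans (le_max_left _ _))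
  have hφ := fun n => (hg (k n)).sub hw
  have hw6 := hw.memLp_six hd1 hd3 hΩ
  have hv6 := fun n => (hg n).memLp_six hd1 hd3 hΩ
  have hmw : mean Ω w = α := by
    have h1 := tendsto_integral_of_l2 (fun n => (hg (k n)).memLp) hw.memLp (memLp_const 1) hlim
    simp only [mul_one] at h1
    exact tendsto_nhds_unique (tendsto_mean_of_integral h1)
      (tendsto_const_nhds.congr fun n => (hm (k n)).symm)
  have hφ0 : ∀ n, ∫ x in Ω, (v (k n) x - w x) = 0 := fun n => by
    rw [integral_sub ((hg (k n)).memLp.integrable (by norm_num))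
      (hw.memLp.integrable (by norm_num)), integral_eq_mean_mul hΩ, integral_eq_mean_mul hΩ w, hm,
      hmw, sub_self]
  have hφ4 : ∀ n, MemLp (fun x => v (k n) x - w x) 4 μ := fun n =>
    memLp_four_of_six ((hv6 (k n)).sub hw6)
  have hδk := hδ.comp hk.tendsto_atTop
  -- the terms of the equation that tend to zero
  have t1 : Tendsto (fun n => ∫ x in Ω, residual Ω a (v (k n)) x * (v (k n) x - w x)) atTop
      (𝓝 0) := by
    have h1 : Tendsto (fun n => |δ (k n)| * (C + l2 μ p)) atTop (𝓝 0) := by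
      have := hδk.abs.mul_const (C + l2 μ p)
      simpa using this
    refine squeeze_zero_norm (fun n => ?_) h1
    refine (hres (k n) _ _ (hφ n)).trans ?_
    refine mul_le_mul (le_abs_self _) ((l2_sub_le (hg (k n)).memLp_grad hw.memLp_grad).trans
      (add_le_add (hC _) le_rfl)) (l2_nonneg _) (abs_nonneg _)
  have t2 : Tendsto (fun n => ∫ x in Ω, inner ℝ (g (k n) x - p x) (p x)) atTop (𝓝 0) :=
    hweak p hw.memLp_grad
  have t3 : Tendsto (fun n => ∫ x in Ω, deriv (W a) (w x) * (v (k n) x - w x)) atTop (𝓝 0) := by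
    refine squeeze_zero_norm (fun n => abs_integral_mul_le (memLp_deriv_W a hw6) (hφ n).memLp) ?_
    simpa using hlim.const_mul (l2 μ fun x => deriv (W a) (w x))
  -- the equation tested with `v (k n) - w`
  have key : ∀ n, l2 μ (fun x => g (k n) x - p x) ^ 2 +
      a / 4 * l2 μ (fun x => (v (k n) x - w x) * (v (k n) x - w x)) ^ 2 ≤
      (∫ x in Ω, residual Ω a (v (k n)) x * (v (k n) x - w x)) -
      (∫ x in Ω, inner ℝ (g (k n) x - p x) (p x)) -
      (∫ x in Ω, deriv (W a) (w x) * (v (k n) x - w x)) +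
      a * l2 μ (fun x => v (k n) x - w x) ^ 2 := by
    intro n
    have h1 := integral_residual_mul hd1 hd3 hΩ a (hv (k n)) (hg (k n)) (hφ n)
    rw [hφ0 n, mul_zero, sub_zero] at h1
    have h2 : l2 μ (fun x => g (k n) x - p x) ^ 2 =
        (∫ x in Ω, inner ℝ (g (k n) x) (g (k n) x - p x)) -
        ∫ x in Ω, inner ℝ (g (k n) x - p x) (p x) := by
      rw [l2_sq_inner (hφ n).memLp_grad, integral_inner_sub_left (hg (k n)).memLp_grad
        hw.memLp_grad (hφ n).memLp_grad]
      congr 1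
      refine integral_congr_ae (Eventually.of_forall fun x => ?_)
      exact real_inner_comm _ _
    have i1 := integrable_mul_of_memLp (memLp_deriv_W a (hv6 (k n))) (hφ n).memLp
    have i2 := integrable_mul_of_memLp (memLp_deriv_W a hw6) (hφ n).memLp
    have i3 := integrable_norm_sq (memLp_mul_four (hφ4 n) (hφ4 n))
    have i4 := integrable_norm_sq (hφ n).memLp
    have h3 : a / 4 * l2 μ (fun x => (v (k n) x - w x) * (v (k n) x - w x)) ^ 2 -
        a * l2 μ (fun x => v (k n) x - w x) ^ 2 ≤
        (∫ x in Ω, deriv (W a) (v (k n) x) * (v (k n) x - w x)) -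
        ∫ x in Ω, deriv (W a) (w x) * (v (k n) x - w x) := by
      rw [l2_sq (memLp_mul_four (hφ4 n) (hφ4 n)), l2_sq (hφ n).memLp, ← integral_const_mul,
        ← integral_const_mul, ← integral_sub (i3.const_mul _) (i4.const_mul _),
        ← integral_sub i1 i2]
      refine integral_mono ((i3.const_mul _).sub (i4.const_mul _)) (i1.sub i2) fun x => ?_
      have h4 := deriv_W_sub_mul_ge ha (v (k n) x) (w x)
      simp only [Real.norm_eq_abs, sq_abs]
      rw [← sq, ← sub_mul]
      exact h4
    linarith
  have hlim2 : Tendsto (fun n => (∫ x in Ω, residual Ω a (v (k n)) x * (v (k n) x - w x)) -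
      (∫ x in Ω, inner ℝ (g (k n) x - p x) (p x)) -
      (∫ x in Ω, deriv (W a) (w x) * (v (k n) x - w x)) +
      a * l2 μ (fun x => v (k n) x - w x) ^ 2) atTop (𝓝 0) := by
    have := ((t1.sub t2).sub t3).add ((hlim.pow 2).const_mul a)
    simpa using this
  have hsqrt : ∀ s : ℕ → ℝ, (∀ n, 0 ≤ s n) → Tendsto (fun n => s n ^ 2) atTop (𝓝 0) →
      Tendsto s atTop (𝓝 0) := fun s hs h => by
    have h1 := (Real.continuous_sqrt.tendsto _).comp h
    rw [Real.sqrt_zero] at h1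
    exact h1.congr fun n => Real.sqrt_sq (hs n)
  refine ⟨k, w, p, hk, hw, hmw, hsqrt _ (fun n => l2_nonneg _) ?_,
    hsqrt _ (fun n => l2_nonneg _) ?_⟩
  · refine squeeze_zero (fun n => sq_nonneg _) (fun n => ?_) hlim2
    have := key n
    have h2 : 0 ≤ a / 4 * l2 μ (fun x => (v (k n) x - w x) * (v (k n) x - w x)) ^ 2 := by positivity
    linarith
  · have h1 := hlim2.const_mul (4 / a)
    rw [mul_zero] at h1
    refine squeeze_zero (fun n => sq_nonneg _) (fun n => ?_) h1
    have h2 := mul_le_mul_of_nonneg_left ((le_add_of_nonneg_left (sq_nonneg _)).trans (key n))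
      (by positivity : 0 ≤ 4 / a)
    rwa [← mul_assoc, div_mul_div_cancel₀ (by positivity), div_self (by positivity),
      one_mul] at h2

/-- The Palais-Smale condition for the energy with prescribed mean value: almost critical points
at energy levels that converge to `b` produce a critical point at the level `b`. -/
theorem Z_nonempty_of_tendsto (hd1 : 1 ≤ d) (hd3 : d ≤ 3) (hΩ : IsSmoothBoundedDomain Ω)
    (ha : 0 < a) {v : ℕ → Euc d → ℝ} {β δ : ℕ → ℝ} {b : ℝ} (hv : ∀ n, v n ∈ M2 Ω a α (β n))
    (hβ : Tendsto β atTop (𝓝 b)) (hδ : Tendsto δ atTop (𝓝 0))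
    (hres : ∀ n φ p, HasWeakGrad Ω φ p →
      |∫ x in Ω, residual Ω a (v n) x * φ x| ≤ δ n * l2 (volume.restrict Ω) p) :
    (Z Ω a α b).Nonempty := by
  have := hΩ.isFiniteMeasure
  set μ := volume.restrict Ω
  have hg := fun n => (hv n).1.1.1.hasWeakGrad
  set g : ℕ → Euc d → Euc d := fun n x => WithLp.toLp 2 fun i => weakDeriv Ω i (v n) x
  obtain ⟨B, hB⟩ := (Metric.isBounded_range_of_tendsto _ hβ).exists_norm_le
  have hF := fun n => (hg n).F_eq hΩ.isOpen a
  have hgC : ∀ n, l2 μ (g n) ≤ Real.sqrt (2 * B) := by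
    intro n
    refine Real.le_sqrt_of_sq_le ?_
    have h1 : 0 ≤ ∫ x in Ω, W a (v n x) := integral_nonneg fun x => by
      simp only [W, Pi.zero_apply]
      positivity
    have h2 := (le_abs_self _).trans (hB _ ⟨n, rfl⟩)
    have h3 := hF n
    rw [(hv n).2.2.2] at h3
    linarith
  obtain ⟨k, w, p, hk, hw, hmw, hgp, hvw⟩ := exists_strong_limit hd1 hd3 hΩ ha
    (fun n => (hv n).1) hg (fun n => (hv n).2.2.1) hgC hδ hres
  have hw6 := hw.memLp_six hd1 hd3 hΩ
  have hv6 := fun n => (hg n).memLp_six hd1 hd3 hΩ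
  obtain ⟨hW, hW'⟩ := tendsto_potential a (fun n => memLp_four_of_six (hv6 (k n)))
    (memLp_four_of_six hw6) hvw
  have hFw : F Ω a w = b := by
    have h1 := (((tendsto_l2_of_sub (fun n => (hg (k n)).memLp_grad) hw.memLp_grad
      hgp).pow 2).div_const 2).add hW
    rw [← hw.F_eq hΩ.isOpen] at h1
    refine tendsto_nhds_unique h1 ((hβ.comp hk.tendsto_atTop).congr fun n => ?_)
    rw [Function.comp_apply, ← (hv (k n)).2.2.2, hF (k n)]
  -- the limit equation
  set c := mean Ω (fun y => deriv (W a) (w y))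
  have hcl : Tendsto (fun n => mean Ω (fun y => deriv (W a) (v (k n) y))) atTop (𝓝 c) := by
    have h1 := hW' (fun _ => 1) (memLp_const 1)
    simp only [mul_one] at h1
    exact tendsto_mean_of_integral h1
  have heq : ∀ φ q, HasWeakGrad Ω φ q → ∫ x in Ω, inner ℝ (p x) (q x) =
      ∫ x in Ω, (c - deriv (W a) (w x)) * φ x := by
    intro φ q hφ
    have h1 : Tendsto (fun n => ∫ x in Ω, residual Ω a (v (k n)) x * φ x) atTop (𝓝 0) := by
      refine squeeze_zero_norm (fun n => hres (k n) φ q hφ) ?_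
      simpa using (hδ.comp hk.tendsto_atTop).mul_const (l2 μ q)
    have h2 : Tendsto (fun n => ∫ x in Ω, inner ℝ (g (k n) x) (q x)) atTop
        (𝓝 (∫ x in Ω, inner ℝ (p x) (q x))) := by
      rw [tendsto_iff_norm_sub_tendsto_zero]
      have h3 := hgp.mul_const (l2 μ q)
      rw [zero_mul] at h3
      refine squeeze_zero (fun n => norm_nonneg _) (fun n => ?_) h3
      rw [← integral_inner_sub_left (hg (k n)).memLp_grad hw.memLp_grad hφ.memLp_grad]
      exact abs_integral_inner_le ((hg (k n)).memLp_grad.sub hw.memLp_grad) hφ.memLp_grad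
    have h3 := (h2.add (hW' φ (memLp_four_of_six (hφ.memLp_six hd1 hd3 hΩ)))).sub
      (hcl.mul_const (∫ x in Ω, φ x))
    have h4 := tendsto_nhds_unique h1 (h3.congr fun n =>
      (integral_residual_mul hd1 hd3 hΩ a (hv (k n)).1 (hg (k n)) hφ).symm)
    simp only [sub_mul]
    rw [integral_sub ((hφ.memLp.integrable (by norm_num)).const_mul c)
      (integrable_mul_of_memLp (memLp_deriv_W a hw6) hφ.memLp), integral_const_mul]
    linarith
  obtain ⟨hH2, hlap⟩ := hΩ.memH2N_of_weak hd1 hw ((memLp_const c).sub (memLp_deriv_W a hw6)) heq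
  refine ⟨w, ⟨hH2, hw.memH1, hmw, hFw⟩, ?_⟩
  filter_upwards [hlap] with x hx
  rw [residual, chemPot, hx]
  simp only [Pi.sub_apply]
  ring

end Critical

/-! ### Regular energy levels -/

section Levels

variable {d : ℕ} {Ω : Set (Euc d)} {a α : ℝ}

/-- The levels carrying critical points form a closed set, by the Palais-Smale condition applied to
critical points. -/
theorem isOpen_O (hd1 : 1 ≤ d) (hd3 : d ≤ 3) (hΩ : IsSmoothBoundedDomain Ω) (ha : 0 < a) (α : ℝ) :
    IsOpen (O Ω a α) := by
  have h1 : O Ω a α = Ioi (betaInf Ω a α) ∩ {β | (Z Ω a α β).Nonempty}ᶜ := by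
    ext β
    simp only [O, mem_inter_iff, mem_Ioi, mem_compl_iff, mem_ofPred_eq, not_nonempty_iff_eq_empty]
  rw [h1]
  refine isOpen_Ioi.inter (isOpen_compl_iff.2 (IsSeqClosed.isClosed fun β b hβ hlim => ?_))
  choose v hv using hβ
  refine Z_nonempty_of_tendsto hd1 hd3 hΩ ha (fun n => (hv n).1) hlim
    (tendsto_const_nhds (x := (0 : ℝ))) fun n φ p _ => ?_
  have h2 : ∫ x in Ω, residual Ω a (v n) x * φ x = 0 := integral_eq_zero_of_ae (by
    filter_upwards [(hv n).2] with x hx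
    simp only [hx, zero_mul, Pi.zero_apply])
  rw [h2, abs_zero, zero_mul]

/-- Critical points with prescribed mean value have bounded energy, as one sees by testing the
equation with `w - α`. -/
theorem energy_le_of_mem_Z (hd1 : 1 ≤ d) (hd3 : d ≤ 3) (hΩ : IsSmoothBoundedDomain Ω) (ha : 0 < a)
    {β : ℝ} {w : Euc d → ℝ} (hw : w ∈ Z Ω a α β) :
    β ≤ a * ((α ^ 2 + 1) ^ 2 / 2 + α ^ 2 / 2 + 1 / 4) * volume.real Ω := by
  have := hΩ.isFiniteMeasure
  obtain ⟨⟨hH2, hH1, hm, hF⟩, hres⟩ := hw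
  have hg := hH1.hasWeakGrad
  set g : Euc d → Euc d := fun x => WithLp.toLp 2 fun i => weakDeriv Ω i w x
  have h6 := hg.memLp_six hd1 hd3 hΩ
  have hφ := hg.sub (hasWeakGrad_const hΩ.volume_ne_top α)
  have h1 := integral_residual_mul hd1 hd3 hΩ a hH2 hg hφ
  have h0 : ∫ x in Ω, (w x - α) = 0 := by
    rw [integral_sub (hg.memLp.integrable (by norm_num)) (integrable_const _), integral_const,
      smul_eq_mul, measureReal_restrict_apply_univ, integral_eq_mean_mul hΩ, hm]
    ring
  have h2 : ∫ x in Ω, residual Ω a w x * (w x - α) = 0 := integral_eq_zero_of_ae (by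
    filter_upwards [hres] with x hx
    simp only [hx, zero_mul, Pi.zero_apply])
  simp only [sub_zero] at h1
  rw [h2, h0, mul_zero, sub_zero, ← l2_sq_inner hg.memLp_grad] at h1
  rw [hg.F_eq hΩ.isOpen] at hF
  have i1 := integrable_mul_of_memLp (memLp_deriv_W a h6) hφ.memLp
  have h3 : ∫ x in Ω, W a (w x) ≤ (∫ x in Ω, deriv (W a) (w x) * (w x - α)) +
      a * ((α ^ 2 + 1) ^ 2 / 2 + α ^ 2 / 2 + 1 / 4) * volume.real Ω := by
    have h4 : ∫ _ in Ω, a * ((α ^ 2 + 1) ^ 2 / 2 + α ^ 2 / 2 + 1 / 4) =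
        a * ((α ^ 2 + 1) ^ 2 / 2 + α ^ 2 / 2 + 1 / 4) * volume.real Ω := by
      rw [integral_const, smul_eq_mul, measureReal_restrict_apply_univ, mul_comm]
    rw [← h4, ← integral_add i1 (integrable_const _)]
    exact integral_mono (integrable_W a (memLp_four_of_six h6)) (i1.add (integrable_const _))
      fun x => W_le_deriv_W_mul ha α (w x)
  have := sq_nonneg (l2 (volume.restrict Ω) g)
  linarith

theorem eventually_mem_O (hd1 : 1 ≤ d) (hd3 : d ≤ 3) (hΩ : IsSmoothBoundedDomain Ω) (ha : 0 < a)
    (α : ℝ) : ∀ᶠ β in atTop, β ∈ O Ω a α := by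
  filter_upwards [eventually_gt_atTop (betaInf Ω a α), eventually_gt_atTop
    (a * ((α ^ 2 + 1) ^ 2 / 2 + α ^ 2 / 2 + 1 / 4) * volume.real Ω)] with β h1 h2
  refine ⟨h1, eq_empty_iff_forall_notMem.2 fun w hw => ?_⟩
  exact absurd (energy_le_of_mem_Z hd1 hd3 hΩ ha hw) (not_le.2 h2)

/-- The `L²` norm of `∇N(f)` is the norm of `f` in the dual of the functions of mean value zero;
here `f` is the residual. -/
theorem abs_integral_residual_le (hd1 : 1 ≤ d) (hd3 : d ≤ 3) (hΩ : IsSmoothBoundedDomain Ω)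
    {v φ : Euc d → ℝ} {p : Euc d → Euc d} (hv : MemH2N Ω v) (hφ : HasWeakGrad Ω φ p) :
    |∫ x in Ω, residual Ω a v x * φ x| ≤
      Real.sqrt (gradNormSq Ω (neumannInv Ω (residual Ω a v))) * l2 (volume.restrict Ω) p := by
  obtain ⟨hN, hlap, -⟩ := hΩ.isNeumannSolution_neumannInv hd1 (memLp_residual hd1 hd3 hΩ a hv)
    (integral_residual hd1 hd3 hΩ a hv)
  set N := neumannInv Ω (residual Ω a v)
  have hg := hN.1.1.hasWeakGrad
  have h1 := hN.2 φ hφ.memH1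
  rw [hg.integral_gradInner hΩ.isOpen hφ] at h1
  have h2 : ∫ x in Ω, residual Ω a v x * φ x = ∫ x in Ω, - (laplacian Ω N x * φ x) := by
    refine integral_congr_ae ?_
    filter_upwards [hlap] with x hx
    rw [← hx, neg_mul]
  rw [integral_neg] at h2
  rw [h2, ← eq_neg_of_add_eq_zero_left h1, hg.gradNormSq_eq hΩ.isOpen, Real.sqrt_sq (l2_nonneg _)]
  exact abs_integral_inner_le hg.memLp_grad hφ.memLp_grad

/-- A minimizing sequence with infimum zero would be a Palais-Smale sequence at the level `β`. -/
theorem mInf_pos (hd1 : 1 ≤ d) (hd3 : d ≤ 3) (hΩ : IsSmoothBoundedDomain Ω) (ha : 0 < a) {β : ℝ}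
    (hβ : β ∈ O Ω a α) (M : ℝ) : 0 < mInf Ω a α β M := by
  by_contra hcon
  have h1 : ∀ n : ℕ, ∃ v ∈ M2 Ω a α β,
      gradNormSq Ω (neumannInv Ω (residual Ω a v)) < 1 / ((n : ℝ) + 1) := by
    intro n
    have h2 : mInf Ω a α β M < ((1 / ((n : ℝ) + 1) : ℝ) : EReal) :=
      (not_lt.1 hcon).trans_lt (by exact_mod_cast Nat.one_div_pos_of_nat)
    obtain ⟨t, ⟨v, hv, -, rfl⟩, ht⟩ := sInf_lt_iff.1 h2
    exact ⟨v, hv, by exact_mod_cast ht⟩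
  choose v hv hlt using h1
  have h3 : Tendsto (fun n : ℕ => Real.sqrt (1 / ((n : ℝ) + 1))) atTop (𝓝 0) := by
    have h4 := (Real.continuous_sqrt.tendsto 0).comp
      (tendsto_one_div_add_atTop_nhds_zero_nat (𝕜 := ℝ))
    rw [Real.sqrt_zero] at h4
    exact h4
  have h5 := Z_nonempty_of_tendsto hd1 hd3 hΩ ha hv tendsto_const_nhds h3 fun n φ p hφ =>
    (abs_integral_residual_le hd1 hd3 hΩ (hv n).1 hφ).trans
      (mul_le_mul_of_nonneg_right (Real.sqrt_le_sqrt (hlt n).le) (l2_nonneg _))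
  exact h5.ne_empty hβ.2

end Levels

end PhaseField

end

theorem lemma2p3 (d : ℕ) (hd1 : 1 ≤ d) (hd3 : d ≤ 3) (Ω : Set (PhaseField.Euc d))
    (hΩ : PhaseField.IsSmoothBoundedDomain Ω) (a : ℝ) (ha : 0 < a) (α : ℝ) :
    (IsOpen (PhaseField.O Ω a α) ∧ ∀ᶠ β in atTop, β ∈ PhaseField.O Ω a α) ∧
    ∀ β ∈ PhaseField.O Ω a α, ∀ M : ℝ, 0 < M → 0 < PhaseField.mInf Ω a α β M :=
  ⟨⟨PhaseField.isOpen_O hd1 hd3 hΩ ha α, PhaseField.eventually_mem_O hd1 hd3 hΩ ha α⟩,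
    fun _ hβ M _ => PhaseField.mInf_pos hd1 hd3 hΩ ha hβ M⟩
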